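/- **Theorem.** Let $\mathbb F=\mathbb F_2$. Consider planar diagrams in the strip $\mathbb R\times[0,1]$ from $k$ bottom points to $l$ top points ($k,l\ge 0$), read from bottom to top: finite vertical stackings, with matching end points, of generating diagrams, each of which is one of the following elementary diagrams with finitely many trivial vertical strands on its left and right: a vertical strand $\mathrm{id}_Q$ (from $1$ to $1$ points), a cup (from $0$ to $2$ points), a cap (from $2$ to $0$ points), a half strand $hf$ (from $0$ to $1$ point). The grading of diagrams is additive under stacking, with $\mathrm{gr}(\mathrm{id}_Q)=\mathrm{gr}(hf)=0$, $\mathrm{gr}(\mathrm{cap})=1$, $\mathrm{gr}(\mathrm{cup})=-1$. The local relations are: vertical strands are identities; isotopy of a single strand, $(\mathrm{cap}\otimes \mathrm{id}_Q)(\mathrm{id}_Q\otimes \mathrm{cup})=\mathrm{id}_Q=(\mathrm{id}_Q\otimes \mathrm{cap})(\mathrm{cup}\otimes \mathrm{id}_Q)$; isotopy of disjoint diagrams (far commutativity); handle slide, $\mathrm{cup}\circ \mathrm{cap}=\mathrm{id}_{Q}\otimes\mathrm{id}_{Q}$; loop, $\mathrm{cap}\circ \mathrm{cup}=$ the empty diagram;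 and $hf\otimes \mathrm{id}_Q=\mathrm{id}_Q\otimes hf$. Let $\mathcal I'$ be the additive DG category over $\mathbb F$ whose objects are the finite formal direct sums of objects $Q^k[m]$, $k\ge 0$, $m\in\mathbb Z$, where $\mathrm{Hom}^p(Q^k[m],Q^l[n])$ is the space of linear combinations of diagrams from $k$ to $l$ points of degree $p+n-m$ modulo the local relations, morphisms between direct sums are matrices, the composition is vertical stacking, and the differential is zero; it is monoidal through horizontal composition, with $Q^k[m]\otimes Q^l[n]=Q^{k+l}[m+n]$ and unit $\mathbf 1=Q^0$. Let $\mathcal I$ be the DG category of one-sided twisted complexes over $\mathcal I'$: its objects are pairs $(\bigoplus_{i=1}^n a_i,f)$ with $a_i\in\mathcal I'$, $f=\sum_{i<j}f_{i}^{j}$, $f_i^j\in\mathrm{Hom}^1(a_i,a_j)$, and $\sum_k f_k^j\circ f_i^k=0$ for all $i,j$; its morphism complexes are the graded spaces of matrices, with differential $d h=h\circ f+g\circ h$ for $h:(\bigoplus a_i,f)\to(\bigoplus b_j,g)$. It has the monoidal DG bifunctor $\otimes:\mathcal I\times\mathcal I\to\mathcal I$ given by $(a,f)\otimes(b,g)=(a\otimes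 b,\,f\otimes 1+1\otimes g)$ on objects and by the tensor product of matrices on morphisms, with unit $\mathbf 1$. Then: 1. The zeroth cohomology category $H^0(\mathcal I)$, with the shift functor $[1]$ and with the triangles isomorphic to triangles $X\xrightarrow{h}Y\to\mathrm{Cone}(h)\to X[1]$ of cones of closed morphisms $h$ of degree $0$ as distinguished triangles, is a triangulated category. 2. $Q\otimes Q\cong \mathbf 1[1]$ in $H^0(\mathcal I)$. 3. Let $K_0(\mathcal I)$ be the Grothendieck group of the triangulated category $H^0(\mathcal I)$. There is a well-defined biadditive multiplication on $K_0(\mathcal I)$ with $[X]\cdot[Y]=[X\otimes Y]$ for all objects $X,Y$ of $\mathcal I$, and with it $K_0(\mathcal I)$ is isomorphic to the ring $\mathbb Z[i]$ of Gaussian integers, by an isomorphism that sends $[\mathbf 1]$ to $1$ and $[Q]$ to $i$. -/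

import Mathlib

open CategoryTheory CategoryTheory.Limits CategoryTheory.Pretriangulated

universe u

namespace SqrtNegOne

/-- The ground field with two elements. -/
abbrev F : Type := ZMod 2

/-- A DG category over the field with two elements. `Hom X Y n` is the degree `n` part of the
cochain complex of morphisms, `d` its differential (of degree `1`), and `comp h f g` is the
composite "first `f`, then `g`". All signs are trivial, since the characteristic is two. A degree
which is determined by others is passed as a separate variable together with an equation, so that
no transport along equations of integers is needed. -/
class DGCategory (C : Type u) where
  Hom : C → C → ℤ → Type
  [addCommGroup : ∀ X Y n, AddCommGroup (Hom X Y n)]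
  [module : ∀ X Y n, Module F (Hom X Y n)]
  d : ∀ {X Y : C} {p q : ℤ}, p + 1 = q → (Hom X Y p →ₗ[F] Hom X Y q)
  one : ∀ X : C, Hom X X 0
  comp : ∀ {X Y Z : C} {p q r : ℤ}, p + q = r → (Hom X Y p →ₗ[F] Hom Y Z q →ₗ[F] Hom X Z r)
  id_comp : ∀ {X Y : C} {p : ℤ} (f : Hom X Y p), comp (zero_add p) (one X) f = f
  comp_id : ∀ {X Y : C} {p : ℤ} (f : Hom X Y p), comp (add_zero p) f (one Y) = f
  assoc : ∀ {W X Y Z : C} {p q r pq qr s : ℤ} (h₁ : p + q = pq) (h₂ : q + r = qr)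
    (h₃ : pq + r = s) (h₄ : p + qr = s) (f : Hom W X p) (g : Hom X Y q) (h : Hom Y Z r),
    comp h₃ (comp h₁ f g) h = comp h₄ f (comp h₂ g h)
  d_d : ∀ {X Y : C} {p q r : ℤ} (h₁ : p + 1 = q) (h₂ : q + 1 = r) (f : Hom X Y p),
    d h₂ (d h₁ f) = 0
  d_comp : ∀ {X Y Z : C} {p q r p' q' r' : ℤ} (h : p + q = r) (hp : p + 1 = p')
    (hq : q + 1 = q') (hr : r + 1 = r') (h₁ : p' + q = r') (h₂ : p + q' = r')
    (f : Hom X Y p) (g : Hom Y Z q),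
    d hr (comp h f g) = comp h₁ (d hp f) g + comp h₂ f (d hq g)

namespace DGCategory

attribute [reducible, instance] DGCategory.addCommGroup DGCategory.module

variable {C : Type u} [DGCategory C]

theorem add_self {X Y : C} {p : ℤ} (f : Hom X Y p) : f + f = 0 := by
  rw [← two_smul F f, show (2 : F) = 0 from rfl, zero_smul]

theorem eq_of_add_eq_zero {X Y : C} {p : ℤ} {f g : Hom X Y p} (h : f + g = 0) : f = g := by
  rw [← add_zero f, ← add_self g, ← add_assoc, h, zero_add]

theorem zero_comp {X Y Z : C} {p q r : ℤ} (h : p + q = r) (g : Hom Y Z q) :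
    comp h (0 : Hom X Y p) g = 0 := by rw [map_zero, LinearMap.zero_apply]

theorem comp_zero {X Y Z : C} {p q r : ℤ} (h : p + q = r) (f : Hom X Y p) :
    comp h f (0 : Hom Y Z q) = 0 := map_zero _

theorem d_zero {X Y : C} {p q : ℤ} (h : p + 1 = q) : d h (0 : Hom X Y p) = 0 := map_zero _

theorem d_id (X : C) {q : ℤ} (h : 0 + 1 = q) : d h (one X) = 0 := by
  have h1 := d_comp (zero_add 0) h h h (by omega) (by omega) (one X) (one X)
  subst h
  rw [id_comp] at h1
  have h2 := comp_id (d (C := C) (rfl : (0 : ℤ) + 1 = 0 + 1) (one X))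
  have h3 := id_comp (d (C := C) (rfl : (0 : ℤ) + 1 = 0 + 1) (one X))
  rw [h1]
  exact (congrArg₂ (· + ·) h2 h3).trans (add_self _)

theorem d_comp_eq_zero {X Y Z : C} {p q r r' : ℤ} (h : p + q = r) (hr : r + 1 = r')
    {f : Hom X Y p} {g : Hom Y Z q} (hf : d (rfl : p + 1 = p + 1) f = 0)
    (hg : d (rfl : q + 1 = q + 1) g = 0) : d hr (comp h f g) = 0 := by
  rw [d_comp h rfl rfl hr (by omega) (by omega), hf, hg, map_zero, map_zero,
    LinearMap.zero_apply, add_zero]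

/-- A closed isomorphism of degree zero. -/
def IsDGIso {X Y : C} (f : Hom X Y 0) : Prop :=
  d (zero_add 1) f = 0 ∧
    ∃ g : Hom Y X 0, comp (add_zero 0) f g = one X ∧ comp (add_zero 0) g f = one Y

end DGCategory

open DGCategory

/-- The category with the same objects, whose morphisms are the homogeneous morphisms of arbitrary
degree (without addition). It is only used to check identities of iterated compositions. -/
structure Homog (C : Type u) : Type u where
  of ::
  as : C

namespace Homog

variable {C : Type u} [DGCategory C]

/-- A homogeneous morphism together with its degree. -/
def hom {X Y : C} {p : ℤ} (f : Hom X Y p) : Σ n, Hom X Y n := ⟨p, f⟩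

theorem hom_inj {X Y : C} {p : ℤ} {f g : Hom X Y p} (h : hom f = hom g) : f = g :=
  eq_of_heq (Sigma.mk.inj h).2

theorem hom_comp {X Y Z : C} {p q r r' : ℤ} (h : p + q = r) (h' : p + q = r') (f : Hom X Y p)
    (g : Hom Y Z q) : hom (comp h f g) = hom (comp h' f g) := by subst h; subst h'; rfl

instance : Category (Homog C) where
  Hom X Y := Σ n, Hom X.as Y.as n
  id X := hom (one X.as)
  comp f g := hom (comp rfl f.2 g.2)
  id_comp f := (hom_comp _ _ _ _).trans (congrArg hom (DGCategory.id_comp f.2))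
  comp_id f := (hom_comp _ _ _ _).trans (congrArg hom (DGCategory.comp_id f.2))
  assoc f g h := (congrArg hom (DGCategory.assoc rfl rfl rfl (add_assoc _ _ _).symm f.2 g.2 h.2)).trans
    (hom_comp _ _ _ _)

/-- A homogeneous morphism as a morphism of `Homog C`. -/
def toHom {X Y : C} {p : ℤ} (f : Hom X Y p) : (of X : Homog C) ⟶ of Y := hom f

theorem toHom_inj {X Y : C} {p : ℤ} {f g : Hom X Y p} (h : toHom f = toHom g) : f = g :=
  hom_inj h

theorem toHom_comp {X Y Z : C} {p q r : ℤ} (h : p + q = r) (f : Hom X Y p) (g : Hom Y Z q) :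
    toHom (comp h f g) = toHom f ≫ toHom g := hom_comp _ _ _ _

theorem toHom_one (X : C) : toHom (one X) = 𝟙 (of X : Homog C) := rfl

end Homog

/-- A choice of shifts in a DG category: `sh n X` is the object `X[n]`, which comes with a closed
isomorphism `X → X[n]` of degree `-n`, whose inverse has degree `n`. -/
class HasDGShift (C : Type u) [DGCategory C] where
  sh : ℤ → C → C
  s : ∀ (n : ℤ) (X : C) {m : ℤ}, n + m = 0 → Hom X (sh n X) m
  t : ∀ (n : ℤ) (X : C), Hom (sh n X) X n
  s_t : ∀ (n : ℤ) (X : C) {m : ℤ} (h : n + m = 0) (h' : m + n = 0),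
    comp h' (s n X h) (t n X) = one X
  t_s : ∀ (n : ℤ) (X : C) {m : ℤ} (h : n + m = 0),
    comp h (t n X) (s n X h) = one (sh n X)
  d_s : ∀ (n : ℤ) (X : C) {m q : ℤ} (h : n + m = 0) (hq : m + 1 = q), d hq (s n X h) = 0
  d_t : ∀ (n : ℤ) (X : C) {q : ℤ} (hq : n + 1 = q), d hq (t n X) = 0

namespace HasDGShift

variable {C : Type u} [DGCategory C] [HasDGShift C]

/-- The transport of a morphism `f : X → Y` of degree `p` to a morphism `X[n] → Y[n]`. -/
def shHom (n : ℤ) {X Y : C} {p : ℤ} (f : Hom X Y p) : Hom (sh n X) (sh n Y) p :=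
  comp (by omega : n + (p - n) = p) (t n X)
    (comp (by omega : p + -n = p - n) f (s n Y (add_neg_cancel n)))

open Homog (toHom toHom_comp toHom_inj toHom_one)

theorem toHom_s_t (n : ℤ) (X : C) {m : ℤ} (h : n + m = 0) :
    toHom (s n X h) ≫ toHom (t n X) = 𝟙 _ := by
  have h' : m + n = 0 := by omega
  rw [← toHom_comp h', s_t, toHom_one]

theorem toHom_t_s (n : ℤ) (X : C) {m : ℤ} (h : n + m = 0) :
    toHom (t n X) ≫ toHom (s n X h) = 𝟙 _ := by
  rw [← toHom_comp h, t_s, toHom_one]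

theorem toHom_s_t_assoc (n : ℤ) (X : C) {m : ℤ} (h : n + m = 0) {Z : Homog C}
    (f : Homog.of X ⟶ Z) : toHom (s n X h) ≫ toHom (t n X) ≫ f = f := by
  rw [← Category.assoc, toHom_s_t, Category.id_comp]

theorem toHom_t_s_assoc (n : ℤ) (X : C) {m : ℤ} (h : n + m = 0) {Z : Homog C}
    (f : Homog.of (sh n X) ⟶ Z) : toHom (t n X) ≫ toHom (s n X h) ≫ f = f := by
  rw [← Category.assoc, toHom_t_s, Category.id_comp]

theorem toHom_s (n : ℤ) (X : C) {m : ℤ} (h : n + m = 0) :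
    toHom (s n X h) = toHom (s n X (add_neg_cancel n)) := by
  obtain rfl : m = -n := by omega
  rfl

theorem toHom_shHom (n : ℤ) {X Y : C} {p : ℤ} (f : Hom X Y p) :
    toHom (shHom n f) = toHom (t n X) ≫ toHom f ≫ toHom (s n Y (add_neg_cancel n)) := by
  rw [shHom, toHom_comp, toHom_comp]

theorem s_shHom (n : ℤ) {X Y : C} {p m q : ℤ} (f : Hom X Y p) (h : n + m = 0) (h₁ : m + p = q)
    (h₂ : p + m = q) : comp h₁ (s n X h) (shHom n f) = comp h₂ f (s n Y h) := by
  apply toHom_inj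
  rw [toHom_comp, toHom_comp, toHom_shHom, toHom_s_t_assoc, toHom_s n Y h]

theorem shHom_t (n : ℤ) {X Y : C} {p q : ℤ} (f : Hom X Y p) (h₁ : p + n = q)
    (h₂ : n + p = q) : comp h₁ (shHom n f) (t n Y) = comp h₂ (t n X) f := by
  apply toHom_inj
  simp only [toHom_comp, toHom_shHom, Category.assoc, toHom_s_t, Category.comp_id]

theorem shHom_comp (n : ℤ) {X Y Z : C} {p q r : ℤ} (h : p + q = r) (f : Hom X Y p)
    (g : Hom Y Z q) : shHom n (comp h f g) = comp h (shHom n f) (shHom n g) := by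
  apply toHom_inj
  simp only [toHom_comp, toHom_shHom, Category.assoc, toHom_s_t_assoc]

theorem shHom_id (n : ℤ) (X : C) : shHom n (one X) = one (sh n X) := by
  apply toHom_inj
  simp only [toHom_shHom, toHom_one, Category.id_comp, toHom_t_s]

theorem d_shHom (n : ℤ) {X Y : C} {p q : ℤ} (h : p + 1 = q) (f : Hom X Y p) :
    d h (shHom n f) = shHom n (d h f) := by
  rw [shHom, d_comp _ rfl (by omega : (p - n) + 1 = q - n) _ (by omega) (by omega),
    d_comp _ h rfl (by omega : (p - n) + 1 = q - n) (by omega) (by omega), d_s, d_t, map_zero,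
    map_zero, LinearMap.zero_apply, zero_add, add_zero, shHom]

theorem shHom_add (n : ℤ) {X Y : C} {p : ℤ} (f g : Hom X Y p) :
    shHom n (f + g) = shHom n f + shHom n g := by
  simp only [shHom, map_add, LinearMap.add_apply]

theorem shHom_zero (n : ℤ) (X Y : C) (p : ℤ) : shHom n (0 : Hom X Y p) = 0 := by
  simp only [shHom, map_zero, LinearMap.zero_apply]

/-- The canonical isomorphism `X[n + m] → X[n][m]`. -/
def addHom (n m : ℤ) (X : C) : Hom (sh (n + m) X) (sh m (sh n X)) 0 :=
  comp (add_neg_cancel (n + m)) (t (n + m) X)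
    (comp (by omega : -n + -m = -(n + m)) (s n X (add_neg_cancel n))
      (s m (sh n X) (add_neg_cancel m)))

/-- The inverse of `addHom`. -/
def addInv (n m : ℤ) (X : C) : Hom (sh m (sh n X)) (sh (n + m) X) 0 :=
  comp (add_neg_cancel (n + m)) (comp (add_comm m n) (t m (sh n X)) (t n X))
    (s (n + m) X (add_neg_cancel (n + m)))

/-- The canonical isomorphism `X[n] → X[m]` for `n = m`. -/
def eqHom {n m : ℤ} (h : n = m) (X : C) : Hom (sh n X) (sh m X) 0 :=
  comp (by omega) (t n X) (s m X (add_neg_cancel m))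

theorem d_addHom (n m : ℤ) (X : C) : d (zero_add 1) (addHom n m X) = 0 :=
  d_comp_eq_zero _ _ (d_t _ _ _) (d_comp_eq_zero _ _ (d_s _ _ _ _) (d_s _ _ _ _))

theorem d_addInv (n m : ℤ) (X : C) : d (zero_add 1) (addInv n m X) = 0 :=
  d_comp_eq_zero _ _ (d_comp_eq_zero _ _ (d_t _ _ _) (d_t _ _ _)) (d_s _ _ _ _)

theorem d_eqHom {n m : ℤ} (h : n = m) (X : C) : d (zero_add 1) (eqHom h X) = 0 :=
  d_comp_eq_zero _ _ (d_t _ _ _) (d_s _ _ _ _)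

theorem toHom_addHom (n m : ℤ) (X : C) : toHom (addHom n m X) = toHom (t (n + m) X) ≫
    toHom (s n X (add_neg_cancel n)) ≫ toHom (s m (sh n X) (add_neg_cancel m)) := by
  rw [addHom, toHom_comp, toHom_comp]

theorem toHom_eqHom {n m : ℤ} (h : n = m) (X : C) :
    toHom (eqHom h X) = toHom (t n X) ≫ toHom (s m X (add_neg_cancel m)) := by
  rw [eqHom, toHom_comp]

theorem addHom_addInv (n m : ℤ) (X : C) :
    comp (add_zero 0) (addHom n m X) (addInv n m X) = one _ := by
  apply toHom_inj
  simp only [addInv, toHom_addHom, toHom_comp, toHom_one, Category.assoc,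
    toHom_s_t_assoc, toHom_t_s]

theorem addInv_addHom (n m : ℤ) (X : C) :
    comp (add_zero 0) (addInv n m X) (addHom n m X) = one _ := by
  apply toHom_inj
  simp only [addInv, toHom_addHom, toHom_comp, toHom_one, Category.assoc,
    toHom_s_t_assoc, toHom_t_s, toHom_t_s_assoc]

theorem zero_nat {X Y : C} (f : Hom X Y 0) : comp (add_zero 0) (shHom 0 f) (t 0 Y) =
    comp (add_zero 0) (t 0 X) f := shHom_t _ _ _ _

theorem add_nat (n m : ℤ) {X Y : C} (f : Hom X Y 0) :
    comp (add_zero 0) (shHom (n + m) f) (addHom n m Y) =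
      comp (add_zero 0) (addHom n m X) (shHom m (shHom n f)) := by
  apply toHom_inj
  simp only [toHom_addHom, toHom_shHom, toHom_comp, Category.assoc, toHom_s_t_assoc]

theorem add_assoc_hom (m₁ m₂ m₃ : ℤ) (X : C) :
    comp (add_zero 0) (addHom (m₁ + m₂) m₃ X) (shHom m₃ (addHom m₁ m₂ X)) =
      comp (add_zero 0) (eqHom (add_assoc m₁ m₂ m₃) X)
        (comp (add_zero 0) (addHom m₁ (m₂ + m₃) X) (addHom m₂ m₃ (sh m₁ X))) := by
  apply toHom_inj
  simp only [toHom_addHom, toHom_shHom, toHom_eqHom, toHom_comp, Category.assoc, toHom_s_t_assoc]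

theorem zero_add_hom (n : ℤ) (X : C) :
    addHom 0 n X = comp (add_zero 0) (eqHom (zero_add n) X) (shHom n (s 0 X (add_zero 0))) := by
  apply toHom_inj
  simp only [toHom_addHom, toHom_shHom, toHom_eqHom, toHom_comp, Category.assoc, toHom_s_t_assoc,
    toHom_s 0 X (add_zero 0)]

theorem add_zero_hom (n : ℤ) (X : C) :
    addHom n 0 X = comp (add_zero 0) (eqHom (add_zero n) X) (s 0 (sh n X) (add_zero 0)) := by
  apply toHom_inj
  simp only [toHom_addHom, toHom_eqHom, toHom_comp, Category.assoc,
    toHom_s 0 (sh n X) (add_zero 0)]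

end HasDGShift

/-- A monoidal DG category: a DG bifunctor `⊗` with a unit object, and closed natural associativity
and unit isomorphisms of degree zero satisfying the pentagon and triangle identities. -/
class MonoidalDGCategory (C : Type u) [DGCategory C] where
  unit : C
  tensorObj : C → C → C
  tensorHom : ∀ {X Y X' Y' : C} {p q r : ℤ}, p + q = r →
    (Hom X Y p →ₗ[F] Hom X' Y' q →ₗ[F] Hom (tensorObj X X') (tensorObj Y Y') r)
  tensor_id : ∀ X Y : C, tensorHom (add_zero 0) (one X) (one Y) = one (tensorObj X Y)
  tensor_comp : ∀ {X Y Z X' Y' Z' : C} {p p' q q' pp qq pq pq' s : ℤ}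
    (h₁ : p + p' = pp) (h₂ : q + q' = qq) (h₃ : pp + qq = s)
    (h₄ : p + q = pq) (h₅ : p' + q' = pq') (h₆ : pq + pq' = s)
    (f : Hom X Y p) (f' : Hom X' Y' p') (g : Hom Y Z q) (g' : Hom Y' Z' q'),
    comp h₃ (tensorHom h₁ f f') (tensorHom h₂ g g') =
      tensorHom h₆ (comp h₄ f g) (comp h₅ f' g')
  d_tensor : ∀ {X Y X' Y' : C} {p q r p' q' r' : ℤ} (h : p + q = r) (hp : p + 1 = p')
    (hq : q + 1 = q') (hr : r + 1 = r') (h₁ : p' + q = r') (h₂ : p + q' = r')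
    (f : Hom X Y p) (g : Hom X' Y' q),
    d hr (tensorHom h f g) = tensorHom h₁ (d hp f) g + tensorHom h₂ f (d hq g)
  α : ∀ X Y Z : C, Hom (tensorObj (tensorObj X Y) Z) (tensorObj X (tensorObj Y Z)) 0
  l : ∀ X : C, Hom (tensorObj unit X) X 0
  ρ : ∀ X : C, Hom (tensorObj X unit) X 0
  α_iso : ∀ X Y Z : C, IsDGIso (α X Y Z)
  l_iso : ∀ X : C, IsDGIso (l X)
  ρ_iso : ∀ X : C, IsDGIso (ρ X)
  α_nat : ∀ {X X' Y Y' Z Z' : C} {p q r pq qr s : ℤ} (h₁ : p + q = pq) (h₂ : pq + r = s)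
    (h₃ : q + r = qr) (h₄ : p + qr = s) (f : Hom X X' p) (g : Hom Y Y' q) (h : Hom Z Z' r),
    comp (add_zero s) (tensorHom h₂ (tensorHom h₁ f g) h) (α X' Y' Z') =
      comp (zero_add s) (α X Y Z) (tensorHom h₄ f (tensorHom h₃ g h))
  l_nat : ∀ {X X' : C} {p : ℤ} (f : Hom X X' p),
    comp (add_zero p) (tensorHom (zero_add p) (one unit) f) (l X') = comp (zero_add p) (l X) f
  ρ_nat : ∀ {X X' : C} {p : ℤ} (f : Hom X X' p),
    comp (add_zero p) (tensorHom (add_zero p) f (one unit)) (ρ X') = comp (zero_add p) (ρ X) f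
  pentagon : ∀ W X Y Z : C,
    comp (add_zero 0) (comp (add_zero 0) (tensorHom (add_zero 0) (α W X Y) (one Z))
      (α W (tensorObj X Y) Z)) (tensorHom (add_zero 0) (one W) (α X Y Z)) =
    comp (add_zero 0) (α (tensorObj W X) Y Z) (α W X (tensorObj Y Z))
  triangle : ∀ X Y : C,
    comp (add_zero 0) (α X unit Y) (tensorHom (add_zero 0) (one X) (l Y)) =
      tensorHom (add_zero 0) (ρ X) (one Y)

namespace MonoidalDGCategory

variable {C : Type u} [DGCategory C] [MonoidalDGCategory C]

theorem twist_tensor {X Y X' Y' : C} {p q r p' q' r' : ℤ} (h : p + q = r) (hp : p + 1 = p')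
    (hq : q + 1 = q') (hr : r + 1 = r') (h₁ : p' + q = r') (h₂ : p + q' = r')
    (e₁ : 1 + p = p') (e₂ : 1 + q = q') (e₃ : 1 + r = r')
    (f : Hom X X 1) (g : Hom X' X' 1) (f' : Hom Y Y 1) (g' : Hom Y' Y' 1)
    (φ : Hom X Y p) (ψ : Hom X' Y' q) :
    d hr (tensorHom h φ ψ) +
        comp e₃ (tensorHom (add_zero 1) f (one X') + tensorHom (zero_add 1) (one X) g)
          (tensorHom h φ ψ) +
        comp hr (tensorHom h φ ψ)
          (tensorHom (add_zero 1) f' (one Y') + tensorHom (zero_add 1) (one Y) g') =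
      tensorHom h₁ (d hp φ + comp e₁ f φ + comp hp φ f') ψ +
        tensorHom h₂ φ (d hq ψ + comp e₂ g ψ + comp hq ψ g') := by
  rw [d_tensor h hp hq hr h₁ h₂]
  simp only [map_add, LinearMap.add_apply]
  rw [tensor_comp _ _ _ e₁ (zero_add q) h₁, tensor_comp _ _ _ (zero_add p) e₂ h₂,
    tensor_comp _ _ _ hp (add_zero q) h₁, tensor_comp _ _ _ (add_zero p) hq h₂]
  simp only [id_comp, comp_id]
  abel

theorem twist_α {X Y Z : C} (f : Hom X X 1) (g : Hom Y Y 1) (h : Hom Z Z 1) :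
    comp (add_zero 1) (tensorHom (add_zero 1)
        (tensorHom (add_zero 1) f (one Y) + tensorHom (zero_add 1) (one X) g) (one Z) +
        tensorHom (zero_add 1) (one (tensorObj X Y)) h) (α X Y Z) =
      comp (zero_add 1) (α X Y Z) (tensorHom (add_zero 1) f (one (tensorObj Y Z)) +
        tensorHom (zero_add 1) (one X)
          (tensorHom (add_zero 1) g (one Z) + tensorHom (zero_add 1) (one Y) h)) := by
  rw [← tensor_id, ← tensor_id]
  simp only [map_add, LinearMap.add_apply]
  rw [α_nat _ _ (add_zero 0) (add_zero 1), α_nat _ _ (add_zero 1) (zero_add 1),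
    α_nat _ _ (zero_add 1) (zero_add 1), add_assoc]

theorem twist_l {X : C} (f : Hom X X 1) :
    comp (add_zero 1) (tensorHom (add_zero 1) 0 (one X) + tensorHom (zero_add 1) (one unit) f)
      (l X) = comp (zero_add 1) (l X) f := by
  rw [map_zero, LinearMap.zero_apply, zero_add]
  exact l_nat f

theorem twist_ρ {X : C} (f : Hom X X 1) :
    comp (add_zero 1) (tensorHom (add_zero 1) f (one unit) + tensorHom (zero_add 1) (one X) 0)
      (ρ X) = comp (zero_add 1) (ρ X) f := by
  rw [map_zero, add_zero]
  exact ρ_nat f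

end MonoidalDGCategory

end SqrtNegOne
namespace SqrtNegOne

/-! ### Diagrams -/

/-- The elementary diagrams: a vertical strand, a cup, a cap and a half strand. -/
inductive Elt : Type
  | strand
  | cup
  | cap
  | hf

/-- The number of bottom end points. -/
def Elt.dom : Elt → ℕ
  | strand => 1
  | cup => 0
  | cap => 2
  | hf => 0

/-- The number of top end points. -/
def Elt.cod : Elt → ℕ
  | strand => 1
  | cup => 2
  | cap => 0
  | hf => 1

/-- The cohomological grading. -/
def Elt.gr : Elt → ℤ
  | strand => 0
  | cup => -1
  | cap => 1
  | hf => 0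

/-- A generating diagram: an elementary diagram with `left` trivial vertical strands on its left
and `right` trivial vertical strands on its right. -/
@[ext]
structure Gen : Type where
  left : ℕ
  elt : Elt
  right : ℕ

def Gen.dom (g : Gen) : ℕ := g.left + g.elt.dom + g.right

def Gen.cod (g : Gen) : ℕ := g.left + g.elt.cod + g.right

/-- Put `n` trivial strands on the left. -/
def Gen.addLeft (n : ℕ) (g : Gen) : Gen := ⟨n + g.left, g.elt, g.right⟩

/-- Put `n` trivial strands on the right. -/
def Gen.addRight (n : ℕ) (g : Gen) : Gen := ⟨g.left, g.elt, g.right + n⟩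

theorem Gen.addLeft_zero : Gen.addLeft 0 = id := by
  funext g; simp [Gen.addLeft]

theorem Gen.addRight_zero : Gen.addRight 0 = id := rfl

theorem Gen.addLeft_addLeft (m n : ℕ) : Gen.addLeft m ∘ Gen.addLeft n = Gen.addLeft (m + n) := by
  funext g; simp [Gen.addLeft, add_assoc]

theorem Gen.addRight_addRight (m n : ℕ) :
    Gen.addRight m ∘ Gen.addRight n = Gen.addRight (n + m) := by
  funext g; simp [Gen.addRight, add_assoc]

theorem Gen.addRight_addLeft (m n : ℕ) :
    Gen.addRight m ∘ Gen.addLeft n = Gen.addLeft n ∘ Gen.addRight m := rfl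

/-- `IsDiag k w l`: the word `w`, read from bottom to top, is a vertical stacking of generating
diagrams with matching end points, from `k` points to `l` points. The empty word is the diagram
which consists of trivial vertical strands only. -/
def IsDiag : ℕ → List Gen → ℕ → Prop
  | k, [], l => k = l
  | k, g :: w, l => k = g.dom ∧ IsDiag g.cod w l

/-- The cohomological grading of a stacking. -/
def gr (w : List Gen) : ℤ := (w.map fun g => g.elt.gr).sum

/-- The local relations; `a` and `b` are the numbers of further trivial strands on the left and on
the right. -/
inductive LocalRel : List Gen → List Gen → Prop
  /-- Vertical strands are idempotents. -/
  | strand (a b : ℕ) : LocalRel [⟨a, .strand, b⟩] []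
  /-- Isotopy of a single strand. -/
  | zigzag (a b : ℕ) : LocalRel [⟨a + 1, .cup, b⟩, ⟨a, .cap, b + 1⟩] []
  /-- Isotopy of a single strand, mirrored. -/
  | zigzag' (a b : ℕ) : LocalRel [⟨a, .cup, b + 1⟩, ⟨a + 1, .cap, b⟩] []
  /-- Isotopy of disjoint diagrams: `e` and, `m` strands to the right of it, `e'`. -/
  | isotopy (a : ℕ) (e : Elt) (m : ℕ) (e' : Elt) (b : ℕ) :
      LocalRel [⟨a, e, m + e'.dom + b⟩, ⟨a + e.cod + m, e', b⟩]
        [⟨a + e.dom + m, e', b⟩, ⟨a, e, m + e'.cod + b⟩]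
  /-- Handle slide: a cap followed by a cup equals two vertical strands. -/
  | handle (a b : ℕ) : LocalRel [⟨a, .cap, b⟩, ⟨a, .cup, b⟩] []
  /-- A loop equals the empty diagram. -/
  | loop (a b : ℕ) : LocalRel [⟨a, .cup, b⟩, ⟨a, .cap, b⟩] []
  /-- A half strand commutes with a trivial strand. -/
  | half (a b : ℕ) : LocalRel [⟨a, .hf, b + 1⟩] [⟨a + 1, .hf, b⟩]

/-- The diagrams of degree `n` from `k` points to `l` points. -/
def Diag (k l : ℕ) (n : ℤ) : Type := {w : List Gen // IsDiag k w l ∧ gr w = n}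

/-- Two diagrams (with the same end points and the same degree) differ by one application of a local
relation. -/
def Diag.Step {k l : ℕ} {n : ℤ} (w w' : Diag k l n) : Prop :=
  ∃ u v x y : List Gen, LocalRel x y ∧ w.1 = u ++ x ++ v ∧ w'.1 = u ++ y ++ v

/-- Diagrams modulo the equivalence relation generated by the local relations. As each local relation
equates two diagrams, the space of linear combinations of diagrams modulo the local relations is the
vector space `Cls k l n →₀ F` with basis `Cls k l n`. -/
def Cls (k l : ℕ) (n : ℤ) : Type := Quot (Diag.Step (k := k) (l := l) (n := n))

theorem IsDiag.append {w w' : List Gen} {k l j : ℕ} (h : IsDiag k w l) (h' : IsDiag l w' j) :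
    IsDiag k (w ++ w') j := by
  induction w generalizing k with
  | nil => cases h; exact h'
  | cons g w ih => exact ⟨h.1, ih h.2⟩

theorem gr_append (w w' : List Gen) : gr (w ++ w') = gr w + gr w' := by simp [gr]

theorem IsDiag.addRight {w : List Gen} {k l : ℕ} (n : ℕ) (h : IsDiag k w l) :
    IsDiag (k + n) (w.map (Gen.addRight n)) (l + n) := by
  induction w generalizing k with
  | nil => cases h; rfl
  | cons g w ih =>
    obtain ⟨rfl, h⟩ := h
    have h' := ih h
    simp only [Gen.cod, add_assoc] at h'
    exact ⟨by simp [Gen.dom, Gen.addRight, add_assoc],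
      by simpa [Gen.cod, Gen.addRight, add_assoc] using h'⟩

theorem IsDiag.addLeft {w : List Gen} {k l : ℕ} (n : ℕ) (h : IsDiag k w l) :
    IsDiag (n + k) (w.map (Gen.addLeft n)) (n + l) := by
  induction w generalizing k with
  | nil => cases h; rfl
  | cons g w ih =>
    obtain ⟨rfl, h⟩ := h
    have h' := ih h
    simp only [Gen.cod, add_assoc] at h'
    exact ⟨by simp [Gen.dom, Gen.addLeft, add_assoc],
      by simpa [Gen.cod, Gen.addLeft, add_assoc] using h'⟩

theorem gr_addRight (n : ℕ) (w : List Gen) : gr (w.map (Gen.addRight n)) = gr w := by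
  simp [gr, Gen.addRight, Function.comp_def]

theorem gr_addLeft (n : ℕ) (w : List Gen) : gr (w.map (Gen.addLeft n)) = gr w := by
  simp [gr, Gen.addLeft, Function.comp_def]

theorem LocalRel.addRight (n : ℕ) {x y : List Gen} (h : LocalRel x y) :
    LocalRel (x.map (Gen.addRight n)) (y.map (Gen.addRight n)) := by
  cases h with
  | strand a b => exact .strand a (b + n)
  | zigzag a b => simpa [Gen.addRight, add_right_comm] using LocalRel.zigzag a (b + n)
  | zigzag' a b => simpa [Gen.addRight, add_right_comm] using LocalRel.zigzag' a (b + n)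
  | isotopy a e m e' b =>
    simpa [Gen.addRight, add_assoc] using LocalRel.isotopy a e m e' (b + n)
  | handle a b => exact .handle a (b + n)
  | loop a b => exact .loop a (b + n)
  | half a b => simpa [Gen.addRight, add_right_comm] using LocalRel.half a (b + n)

theorem LocalRel.addLeft (n : ℕ) {x y : List Gen} (h : LocalRel x y) :
    LocalRel (x.map (Gen.addLeft n)) (y.map (Gen.addLeft n)) := by
  cases h with
  | strand a b => exact .strand (n + a) b
  | zigzag a b => exact .zigzag (n + a) b
  | zigzag' a b => exact .zigzag' (n + a) b
  | isotopy a e m e' b =>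
    simpa [Gen.addLeft, add_assoc] using LocalRel.isotopy (n + a) e m e' b
  | handle a b => exact .handle (n + a) b
  | loop a b => exact .loop (n + a) b
  | half a b => exact .half (n + a) b

/-- Vertical stacking: `w` below `w'`. -/
def Diag.comp {k l j : ℕ} {m n r : ℤ} (h : m + n = r) (w : Diag k l m) (w' : Diag l j n) :
    Diag k j r :=
  ⟨w.1 ++ w'.1, w.2.1.append w'.2.1, by rw [gr_append, w.2.2, w'.2.2, h]⟩

/-- Horizontal composition: `w` on the left of `w'`. -/
def Diag.tens {k l k' l' : ℕ} {m n r : ℤ} (h : m + n = r) (w : Diag k l m) (w' : Diag k' l' n) :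
    Diag (k + k') (l + l') r :=
  ⟨w.1.map (Gen.addRight k') ++ w'.1.map (Gen.addLeft l),
    (w.2.1.addRight k').append (w'.2.1.addLeft l), by
      rw [gr_append, gr_addRight, gr_addLeft, w.2.2, w'.2.2, h]⟩

/-- The trivial diagram. -/
def Cls.triv {k l : ℕ} {n : ℤ} (h : k = l) (hn : n = 0) : Cls k l n :=
  Quot.mk _ ⟨[], h, hn.symm⟩

def Cls.comp {k l j : ℕ} {m n r : ℤ} (h : m + n = r) : Cls k l m → Cls l j n → Cls k j r :=
  Quot.map₂ (Diag.comp h)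
    (fun w _ _ ⟨u, v, x, y, hr, h₁, h₂⟩ =>
      ⟨w.1 ++ u, v, x, y, hr, by simp [Diag.comp, h₁], by simp [Diag.comp, h₂]⟩)
    (fun _ _ w ⟨u, v, x, y, hr, h₁, h₂⟩ =>
      ⟨u, v ++ w.1, x, y, hr, by simp [Diag.comp, h₁], by simp [Diag.comp, h₂]⟩)

def Cls.tens {k l k' l' : ℕ} {m n r : ℤ} (h : m + n = r) :
    Cls k l m → Cls k' l' n → Cls (k + k') (l + l') r :=
  Quot.map₂ (Diag.tens h)
    (fun w _ _ ⟨u, v, x, y, hr, h₁, h₂⟩ =>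
      ⟨w.1.map (Gen.addRight k') ++ u.map (Gen.addLeft l), v.map (Gen.addLeft l), _, _,
        hr.addLeft l, by simp [Diag.tens, h₁], by simp [Diag.tens, h₂]⟩)
    (fun _ _ w ⟨u, v, x, y, hr, h₁, h₂⟩ =>
      ⟨u.map (Gen.addRight k'), v.map (Gen.addRight k') ++ w.1.map (Gen.addLeft l), _, _,
        hr.addRight k', by simp [Diag.tens, h₁], by simp [Diag.tens, h₂]⟩)

theorem Diag.mk_eq {k l : ℕ} {n : ℤ} {w w' : Diag k l n} (h : w.1 = w'.1) :
    (Quot.mk _ w : Cls k l n) = Quot.mk _ w' := congrArg _ (Subtype.ext h)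

theorem Cls.assoc {k l j i : ℕ} {p q r pq qr s : ℤ} (h₁ : p + q = pq) (h₂ : q + r = qr)
    (h₃ : pq + r = s) (h₄ : p + qr = s) (f : Cls k l p) (g : Cls l j q) (h : Cls j i r) :
    Cls.comp h₃ (Cls.comp h₁ f g) h = Cls.comp h₄ f (Cls.comp h₂ g h) := by
  obtain ⟨f⟩ := f; obtain ⟨g⟩ := g; obtain ⟨h⟩ := h
  exact Diag.mk_eq (List.append_assoc _ _ _)

/-- The words `w` and `w'` represent the same morphism. -/
def Conv (k l : ℕ) (n : ℤ) (w w' : List Gen) : Prop :=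
  ∃ (h : IsDiag k w l ∧ gr w = n) (h' : IsDiag k w' l ∧ gr w' = n),
    (Quot.mk _ ⟨w, h⟩ : Cls k l n) = Quot.mk _ ⟨w', h'⟩

theorem Conv.trans {k l : ℕ} {n : ℤ} {w w' w'' : List Gen} (h : Conv k l n w w')
    (h' : Conv k l n w' w'') : Conv k l n w w'' := by
  obtain ⟨a, b, e⟩ := h
  obtain ⟨a', b', e'⟩ := h'
  exact ⟨a, b', e.trans e'⟩

theorem Conv.context {k l j i : ℕ} {n p q r : ℤ} {u w w' v : List Gen} (h : Conv l j n w w')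
    (hu : IsDiag k u l) (hv : IsDiag j v i) (hp : gr u = p) (hq : gr v = q)
    (hr : p + n + q = r) : Conv k i r (u ++ w ++ v) (u ++ w' ++ v) := by
  obtain ⟨a, b, e⟩ := h
  refine ⟨⟨(hu.append a.1).append hv, by rw [gr_append, gr_append, a.2, hp, hq, hr]⟩,
    ⟨(hu.append b.1).append hv, by rw [gr_append, gr_append, b.2, hp, hq, hr]⟩, ?_⟩
  exact congrArg (fun c => Cls.comp hr (Cls.comp rfl
    (Quot.mk _ ⟨u, hu, hp⟩ : Cls k l p) c) (Quot.mk _ ⟨v, hv, hq⟩ : Cls j i q)) e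

theorem conv_swap_gen (f g : Gen) :
    Conv (g.dom + f.dom) (g.cod + f.cod) (f.elt.gr + g.elt.gr)
      [f.addLeft g.dom, g.addRight f.cod] [g.addRight f.dom, f.addLeft g.cod] := by
  obtain ⟨a', e', b'⟩ := f
  obtain ⟨a, e, b⟩ := g
  have h := LocalRel.isotopy a e (b + a') e' b'
  have hd (m n p q : ℕ) : m + n + p + q = m + (n + (p + q)) := by omega
  refine ⟨⟨⟨?_, ?_, ?_⟩, ?_⟩, ⟨⟨?_, ?_, ?_⟩, ?_⟩, ?_⟩
  all_goals first
    | (simp only [IsDiag, Gen.addLeft, Gen.addRight, Gen.dom, Gen.cod, gr, List.map, List.sum_cons,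
        List.sum_nil]; omega)
    | skip
  refine (Quot.sound ⟨[], [], _, _, h, ?_, ?_⟩).symm <;>
    simp [Gen.addLeft, Gen.addRight, Gen.dom, Gen.cod, add_assoc]

theorem conv_swap_gen_word (g : Gen) {k l : ℕ} (w : List Gen) (hw : IsDiag k w l) :
    Conv (g.dom + k) (g.cod + l) (gr w + g.elt.gr)
      (w.map (Gen.addLeft g.dom) ++ [g.addRight l])
      (g.addRight k :: w.map (Gen.addLeft g.cod)) := by
  have hd (n : ℕ) : (g.addRight n).dom = g.dom + n := by simp [Gen.addRight, Gen.dom, add_assoc]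
  have hc (n : ℕ) : (g.addRight n).cod = g.cod + n := by simp [Gen.addRight, Gen.cod, add_assoc]
  induction w generalizing k with
  | nil =>
    obtain rfl : k = l := hw
    have h : IsDiag (g.dom + k) [g.addRight k] (g.cod + k) ∧ gr [g.addRight k] = gr [] + g.elt.gr :=
      ⟨⟨(hd k).symm, hc k⟩, by simp [gr, Gen.addRight]⟩
    exact ⟨h, h, rfl⟩
  | cons f w ih =>
    obtain ⟨rfl, hw⟩ := hw
    have h1 := (ih hw).context (k := g.dom + f.dom) (u := [f.addLeft g.dom]) (v := [])
      (p := f.elt.gr) (q := 0) (r := gr (f :: w) + g.elt.gr)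
      ⟨by simp [Gen.addLeft, Gen.dom, add_assoc],
        by simp [IsDiag, Gen.addLeft, Gen.cod, Gen.dom, add_assoc]⟩
      (rfl : g.cod + l = g.cod + l) (by simp [gr, Gen.addLeft]) rfl (by simp [gr]; ring)
    have h2 := (conv_swap_gen f g).context (k := g.dom + f.dom) (u := [])
      (v := w.map (Gen.addLeft g.cod))
      (p := 0) (q := gr w) (r := gr (f :: w) + g.elt.gr) rfl (hw.addLeft g.cod) rfl
      (gr_addLeft _ _) (by simp [gr]; ring)
    simp only [List.nil_append, List.append_nil, List.cons_append, List.map_cons] at h1 h2 ⊢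
    exact h1.trans h2

theorem conv_swap {k l k' l' : ℕ} (w w' : List Gen) (hw : IsDiag k w l) (hw' : IsDiag k' w' l') :
    Conv (k + k') (l + l') (gr w + gr w')
      (w'.map (Gen.addLeft k) ++ w.map (Gen.addRight l'))
      (w.map (Gen.addRight k') ++ w'.map (Gen.addLeft l)) := by
  induction w generalizing k with
  | nil =>
    obtain rfl : k = l := hw
    have h : IsDiag (k + k') (w'.map (Gen.addLeft k)) (k + l') ∧
        gr (w'.map (Gen.addLeft k)) = gr [] + gr w' :=
      ⟨hw'.addLeft k, by rw [gr_addLeft]; simp [gr]⟩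
    simpa only [List.map_nil, List.append_nil, List.nil_append] using
      (show Conv _ _ _ _ _ from ⟨h, h, rfl⟩)
  | cons g w ih =>
    obtain ⟨rfl, hw⟩ := hw
    have hd : (g.addRight k').dom = g.dom + k' := by simp [Gen.addRight, Gen.dom, add_assoc]
    have hc : (g.addRight k').cod = g.cod + k' := by simp [Gen.addRight, Gen.cod, add_assoc]
    have h1 := (conv_swap_gen_word g w' hw').context (k := g.dom + k') (u := [])
      (v := w.map (Gen.addRight l')) (p := 0) (q := gr w) (r := gr (g :: w) + gr w')
      rfl (hw.addRight l') rfl (gr_addRight _ _) (by simp [gr]; ring)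
    have h2 := (ih hw).context (k := g.dom + k') (u := [g.addRight k']) (v := [])
      (p := g.elt.gr) (q := 0) (r := gr (g :: w) + gr w')
      ⟨hd.symm, hc⟩ (rfl : l + l' = l + l') (by simp [gr, Gen.addRight]) rfl
      (by simp [gr]; ring)
    simp only [List.nil_append, List.append_nil, List.cons_append, List.map_cons,
      List.append_assoc] at h1 h2 ⊢
    exact h1.trans h2

theorem Cls.tens_comp {k l j k' l' j' : ℕ} {p p' q q' pp qq pq pq' s : ℤ}
    (h₁ : p + p' = pp) (h₂ : q + q' = qq) (h₃ : pp + qq = s)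
    (h₄ : p + q = pq) (h₅ : p' + q' = pq') (h₆ : pq + pq' = s)
    (f : Cls k l p) (f' : Cls k' l' p') (g : Cls l j q) (g' : Cls l' j' q') :
    Cls.comp h₃ (Cls.tens h₁ f f') (Cls.tens h₂ g g') =
      Cls.tens h₆ (Cls.comp h₄ f g) (Cls.comp h₅ f' g') := by
  obtain ⟨f⟩ := f; obtain ⟨f'⟩ := f'; obtain ⟨g⟩ := g; obtain ⟨g'⟩ := g'
  obtain ⟨a, b, e⟩ := (conv_swap g.1 f'.1 g.2.1 f'.2.1).context (r := s)
    (f.2.1.addRight k') (g'.2.1.addLeft j) ((gr_addRight _ _).trans f.2.2)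
    ((gr_addLeft _ _).trans g'.2.2) (by rw [g.2.2, f'.2.2]; omega)
  refine (Diag.mk_eq ?_).trans (e.trans (Diag.mk_eq ?_)) <;>
    simp [Diag.comp, Diag.tens, List.append_assoc]

/-! ### Linear combinations of diagrams -/

/-- The bilinear extension of a map on basis elements. -/
noncomputable def bilin {A B D : Type} (op : A → B → D) :
    (A →₀ F) →ₗ[F] (B →₀ F) →ₗ[F] (D →₀ F) :=
  Finsupp.lift _ F A fun a => Finsupp.lmapDomain F F (op a)

theorem bilin_single {A B D : Type} (op : A → B → D) (a : A) (b : B) :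
    bilin op (Finsupp.single a 1) (Finsupp.single b 1) = Finsupp.single (op a b) 1 := by
  simp [bilin]

theorem basis_induction {A : Type} {P : (A →₀ F) → Prop} (x : A →₀ F) (h0 : P 0)
    (hadd : ∀ x y, P x → P y → P (x + y)) (h1 : ∀ a, P (Finsupp.single a 1)) : P x := by
  induction x using Finsupp.induction_linear with
  | zero => exact h0
  | add f g hf hg => exact hadd _ _ hf hg
  | single a b =>
    have hb : ∀ b : F, b = 0 ∨ b = 1 := by decide
    rcases hb b with rfl | rfl
    · simpa using h0
    · exact h1 a

section Bilin

variable {A₁ A₂ A₃ A₄ A₅ A₆ A₇ A₈ A₉ A₁₀ : Type}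

theorem bilin_unit_left {op : A₁ → A₂ → A₂} {u : A₁} (h : ∀ a, op u a = a) (x : A₂ →₀ F) :
    bilin op (Finsupp.single u 1) x = x := by
  induction x using basis_induction with
  | h0 => simp
  | hadd x y hx hy => rw [map_add, hx, hy]
  | h1 a => rw [bilin_single, h]

theorem bilin_unit_right {op : A₂ → A₁ → A₂} {u : A₁} (h : ∀ a, op a u = a) (x : A₂ →₀ F) :
    bilin op x (Finsupp.single u 1) = x := by
  induction x using basis_induction with
  | h0 => simp
  | hadd x y hx hy => rw [map_add, LinearMap.add_apply, hx, hy]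
  | h1 a => rw [bilin_single, h]

theorem bilin_assoc {o₁ : A₁ → A₂ → A₄} {o₂ : A₂ → A₃ → A₅} {o₃ : A₄ → A₃ → A₆}
    {o₄ : A₁ → A₅ → A₆} (H : ∀ a b c, o₃ (o₁ a b) c = o₄ a (o₂ b c))
    (x : A₁ →₀ F) (y : A₂ →₀ F) (z : A₃ →₀ F) :
    bilin o₃ (bilin o₁ x y) z = bilin o₄ x (bilin o₂ y z) := by
  induction x using basis_induction with
  | h0 => simp
  | hadd x y hx hy => simp only [map_add, LinearMap.add_apply, hx, hy]
  | h1 a =>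
  induction y using basis_induction with
  | h0 => simp
  | hadd x y hx hy => simp only [map_add, LinearMap.add_apply, hx, hy]
  | h1 b =>
  induction z using basis_induction with
  | h0 => simp
  | hadd x y hx hy => simp only [map_add, hx, hy]
  | h1 c => simp only [bilin_single, H]

theorem bilin_interchange {o₁ : A₁ → A₂ → A₅} {o₂ : A₃ → A₄ → A₆} {o₃ : A₅ → A₆ → A₉}
    {o₄ : A₁ → A₃ → A₇} {o₅ : A₂ → A₄ → A₈} {o₆ : A₇ → A₈ → A₉}
    (H : ∀ a b c d, o₃ (o₁ a b) (o₂ c d) = o₆ (o₄ a c) (o₅ b d))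
    (x : A₁ →₀ F) (y : A₂ →₀ F) (z : A₃ →₀ F) (w : A₄ →₀ F) :
    bilin o₃ (bilin o₁ x y) (bilin o₂ z w) = bilin o₆ (bilin o₄ x z) (bilin o₅ y w) := by
  induction x using basis_induction with
  | h0 => simp
  | hadd x y hx hy => simp only [map_add, LinearMap.add_apply, hx, hy]
  | h1 a =>
  induction y using basis_induction with
  | h0 => simp
  | hadd x y hx hy => simp only [map_add, LinearMap.add_apply, hx, hy]
  | h1 b =>
  induction z using basis_induction with
  | h0 => simp
  | hadd x y hx hy => simp only [map_add, LinearMap.add_apply, hx, hy]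
  | h1 c =>
  induction w using basis_induction with
  | h0 => simp
  | hadd x y hx hy => simp only [map_add, hx, hy]
  | h1 d => simp only [bilin_single, H]

theorem bilin_nat₃ {o₁ : A₁ → A₂ → A₄} {o₂ : A₄ → A₃ → A₅} {o₃ : A₅ → A₆ → A₇}
    {o₄ : A₂ → A₃ → A₈} {o₅ : A₁ → A₈ → A₉} {o₆ : A₁₀ → A₉ → A₇} {u : A₆} {v : A₁₀}
    (H : ∀ a b c, o₃ (o₂ (o₁ a b) c) u = o₆ v (o₅ a (o₄ b c)))
    (x : A₁ →₀ F) (y : A₂ →₀ F) (z : A₃ →₀ F) :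
    bilin o₃ (bilin o₂ (bilin o₁ x y) z) (Finsupp.single u 1) =
      bilin o₆ (Finsupp.single v 1) (bilin o₅ x (bilin o₄ y z)) := by
  induction x using basis_induction with
  | h0 => simp
  | hadd x y hx hy => simp only [map_add, LinearMap.add_apply, hx, hy]
  | h1 a =>
  induction y using basis_induction with
  | h0 => simp
  | hadd x y hx hy => simp only [map_add, LinearMap.add_apply, hx, hy]
  | h1 b =>
  induction z using basis_induction with
  | h0 => simp
  | hadd x y hx hy => simp only [map_add, LinearMap.add_apply, hx, hy]
  | h1 c => simp only [bilin_single, H]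

theorem bilin_nat_left {o₁ : A₂ → A₁ → A₃} {o₂ : A₃ → A₄ → A₅} {o₃ : A₆ → A₁ → A₅}
    {u : A₂} {v : A₄} {w : A₆} (H : ∀ a, o₂ (o₁ u a) v = o₃ w a) (x : A₁ →₀ F) :
    bilin o₂ (bilin o₁ (Finsupp.single u 1) x) (Finsupp.single v 1) =
      bilin o₃ (Finsupp.single w 1) x := by
  induction x using basis_induction with
  | h0 => simp
  | hadd x y hx hy => simp only [map_add, LinearMap.add_apply, hx, hy]
  | h1 a => simp only [bilin_single, H]

theorem bilin_nat_right {o₁ : A₁ → A₂ → A₃} {o₂ : A₃ → A₄ → A₅} {o₃ : A₆ → A₁ → A₅}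
    {u : A₂} {v : A₄} {w : A₆} (H : ∀ a, o₂ (o₁ a u) v = o₃ w a) (x : A₁ →₀ F) :
    bilin o₂ (bilin o₁ x (Finsupp.single u 1)) (Finsupp.single v 1) =
      bilin o₃ (Finsupp.single w 1) x := by
  induction x using basis_induction with
  | h0 => simp
  | hadd x y hx hy => simp only [map_add, LinearMap.add_apply, hx, hy]
  | h1 a => simp only [bilin_single, H]

end Bilin

/-- The objects `Q^k[m]`, with `k = pow` and `m = shift`. -/
@[ext]
structure Elem : Type where
  pow : ℕ
  shift : ℤ

/-- The morphisms `Q^k[m] → Q^l[n]` of degree `p` are the linear combinations of the classes of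
diagrams from `k` to `l` points of degree `p + n - m`. The differential is zero. -/
noncomputable instance : DGCategory Elem where
  Hom X Y p := Cls X.pow Y.pow (p + Y.shift - X.shift) →₀ F
  addCommGroup _ _ _ := inferInstance
  module _ _ _ := inferInstance
  d _ := 0
  one X := Finsupp.single (Cls.triv rfl (by omega)) 1
  comp h := bilin (Cls.comp (by omega))
  id_comp f := bilin_unit_left (by rintro ⟨a⟩; exact Diag.mk_eq rfl) f
  comp_id f := bilin_unit_right (by rintro ⟨a⟩; exact Diag.mk_eq (List.append_nil _)) f
  assoc h₁ h₂ h₃ h₄ f g h := bilin_assoc (by intro a b c; exact Cls.assoc _ _ _ _ a b c) f g h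
  d_d _ _ _ := rfl
  d_comp _ _ _ _ _ _ _ _ := by simp

namespace Elem

/-- The trivial diagram, as a morphism `Q^k[m] → Q^k[n]`; its degree is `m - n`. -/
noncomputable def triv {X Y : Elem} {p : ℤ} (h : X.pow = Y.pow) (hp : p + Y.shift = X.shift) :
    DGCategory.Hom X Y p :=
  Finsupp.single (Cls.triv h (by omega)) 1

theorem comp_triv {X Y Z : Elem} {p q r : ℤ} (h : p + q = r) (h₁ : X.pow = Y.pow)
    (h₂ : p + Y.shift = X.shift) (h₃ : Y.pow = Z.pow) (h₄ : q + Z.shift = Y.shift) :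
    DGCategory.comp h (triv h₁ h₂) (triv h₃ h₄) = triv (h₁.trans h₃) (by omega) :=
  (bilin_single _ _ _).trans rfl

/-- The object `Q^k[m] ⊗ Q^l[n] = Q^{k+l}[m+n]`. -/
def tensorObj (X Y : Elem) : Elem := ⟨X.pow + Y.pow, X.shift + Y.shift⟩

theorem tensorObj_pow {X Y X' Y' : Elem} (h : X.pow = Y.pow) (h' : X'.pow = Y'.pow) :
    (tensorObj X X').pow = (tensorObj Y Y').pow := congrArg₂ (· + ·) h h'

theorem tensorObj_shift {X Y X' Y' : Elem} {p q r : ℤ} (h : p + q = r)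
    (h₁ : p + Y.shift = X.shift) (h₂ : q + Y'.shift = X'.shift) :
    r + (tensorObj Y Y').shift = (tensorObj X X').shift := by
  dsimp only [tensorObj]; omega

/-- Horizontal composition of morphisms. -/
noncomputable def tensorHom {X Y X' Y' : Elem} {p q r : ℤ} (h : p + q = r) :
    DGCategory.Hom X Y p →ₗ[F] DGCategory.Hom X' Y' q →ₗ[F]
      DGCategory.Hom (tensorObj X X') (tensorObj Y Y') r :=
  bilin (Cls.tens (by dsimp only [tensorObj]; omega))

theorem tensor_triv {X Y X' Y' : Elem} {p q r : ℤ} (h : p + q = r) (h₁ : X.pow = Y.pow)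
    (h₂ : p + Y.shift = X.shift) (h₃ : X'.pow = Y'.pow) (h₄ : q + Y'.shift = X'.shift) :
    tensorHom h (triv h₁ h₂) (triv h₃ h₄) =
      triv (tensorObj_pow h₁ h₃) (tensorObj_shift h h₂ h₄) :=
  (bilin_single _ _ _).trans rfl

theorem one_eq_triv (X : Elem) : DGCategory.one X = triv (X := X) rfl (zero_add _) := rfl

theorem pentagon {W X Y Z A B C D : Elem} (h₁ : W.pow = X.pow) (h₁' : 0 + X.shift = W.shift)
    (h₂ : Y.pow = Z.pow) (h₂' : 0 + Z.shift = Y.shift)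
    (h₃ : (tensorObj X Z).pow = (tensorObj A C).pow)
    (h₃' : 0 + (tensorObj A C).shift = (tensorObj X Z).shift)
    (h₄ : A.pow = B.pow) (h₄' : 0 + B.shift = A.shift)
    (h₅ : C.pow = D.pow) (h₅' : 0 + D.shift = C.shift) {E : Elem}
    (h₆ : (tensorObj W Y).pow = E.pow) (h₆' : 0 + E.shift = (tensorObj W Y).shift)
    (h₇ : E.pow = (tensorObj B D).pow) (h₇' : 0 + (tensorObj B D).shift = E.shift) :
    DGCategory.comp (add_zero 0) (DGCategory.comp (add_zero 0)
      (tensorHom (add_zero 0) (triv h₁ h₁') (triv h₂ h₂')) (triv h₃ h₃'))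
      (tensorHom (add_zero 0) (triv h₄ h₄') (triv h₅ h₅')) =
    DGCategory.comp (add_zero 0) (triv h₆ h₆') (triv h₇ h₇') := by
  simp only [tensor_triv, comp_triv]

theorem triangle {A B C D E G H : Elem} (h₁ : E.pow = (tensorObj A C).pow)
    (h₁' : 0 + (tensorObj A C).shift = E.shift) (h₂ : A.pow = B.pow) (h₂' : 0 + B.shift = A.shift)
    (h₃ : C.pow = D.pow) (h₃' : 0 + D.shift = C.shift) (h₄ : G.pow = B.pow)
    (h₄' : 0 + B.shift = G.shift) (h₅ : H.pow = D.pow) (h₅' : 0 + D.shift = H.shift)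
    (hE : E = tensorObj G H) :
    DGCategory.comp (add_zero 0) (triv h₁ h₁')
      (tensorHom (add_zero 0) (triv h₂ h₂') (triv h₃ h₃')) =
    hE ▸ tensorHom (add_zero 0) (triv h₄ h₄') (triv h₅ h₅') := by
  subst hE
  simp only [tensor_triv, comp_triv]

theorem isDGIso_triv {X Y : Elem} (h : X.pow = Y.pow) (h' : 0 + Y.shift = X.shift) :
    DGCategory.IsDGIso (triv h h') :=
  ⟨rfl, triv h.symm (by omega), comp_triv _ _ _ _ _, comp_triv _ _ _ _ _⟩

end Elem

/-- `Q^k[m][n] = Q^k[m + n]`. -/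
noncomputable instance : HasDGShift Elem where
  sh n X := ⟨X.pow, X.shift + n⟩
  s n X _ h := Elem.triv rfl (by dsimp only; omega)
  t n X := Elem.triv rfl (by dsimp only; omega)
  s_t _ _ _ _ _ := Elem.comp_triv _ _ _ _ _
  t_s _ _ _ _ := Elem.comp_triv _ _ _ _ _
  d_s _ _ _ _ _ _ := rfl
  d_t _ _ _ _ := rfl

noncomputable instance : MonoidalDGCategory Elem where
  unit := ⟨0, 0⟩
  tensorObj := Elem.tensorObj
  tensorHom := Elem.tensorHom
  tensor_id _ _ := Elem.tensor_triv _ rfl (zero_add _) rfl (zero_add _)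
  tensor_comp h₁ h₂ h₃ h₄ h₅ h₆ f f' g g' :=
    bilin_interchange (by intro a b c d; exact Cls.tens_comp _ _ _ _ _ _ a b c d) f f' g g'
  d_tensor _ _ _ _ _ _ _ _ := by simp [DGCategory.d]
  α X Y Z := Elem.triv (add_assoc _ _ _) (by dsimp only [Elem.tensorObj]; omega)
  l X := Elem.triv (zero_add _) (by dsimp only [Elem.tensorObj])
  ρ X := Elem.triv (add_zero _) (by dsimp only [Elem.tensorObj]; omega)
  α_iso _ _ _ := Elem.isDGIso_triv _ _
  l_iso _ := Elem.isDGIso_triv _ _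
  ρ_iso _ := Elem.isDGIso_triv _ _
  α_nat h₁ h₂ h₃ h₄ f g h := bilin_nat₃ (by
    rintro ⟨a⟩ ⟨b⟩ ⟨c⟩
    refine Diag.mk_eq ?_
    simp [Diag.comp, Diag.tens, Elem.tensorObj, Gen.addLeft_addLeft, Gen.addRight_addRight,
      Gen.addRight_addLeft]) f g h
  l_nat f := bilin_nat_left (by
    rintro ⟨a⟩
    refine Diag.mk_eq ?_
    simp [Diag.comp, Diag.tens, Gen.addLeft_zero]) f
  ρ_nat f := bilin_nat_right (by
    rintro ⟨a⟩
    refine Diag.mk_eq ?_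
    simp [Diag.comp, Diag.tens, Gen.addRight_zero]) f
  pentagon _ _ _ _ := Elem.pentagon _ _ rfl (zero_add _) _ _ rfl (zero_add _) _ _ _ _ _ _
  triangle _ _ := Elem.triangle _ _ rfl (zero_add _) _ _ _ _ rfl (zero_add _) rfl

end SqrtNegOne
namespace SqrtNegOne

/-! ### Formal direct sums -/

/-- Formal direct sums, indexed by a finite set, of objects of `C`. -/
structure Add (C : Type u) : Type (max u 1) where
  ι : Type
  [fin : Fintype ι]
  obj : ι → C

namespace Add

attribute [instance] Add.fin

variable {C : Type u} [DGCategory C]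

/-- The entries of the identity matrix. -/
noncomputable def δ (X : Add C) (i j : X.ι) : DGCategory.Hom (X.obj i) (X.obj j) 0 :=
  open Classical in if h : i = j then h ▸ DGCategory.one (X.obj i) else 0

theorem δ_self (X : Add C) (i : X.ι) : X.δ i i = DGCategory.one (X.obj i) := by simp [δ]

theorem δ_ne (X : Add C) {i j : X.ι} (h : i ≠ j) : X.δ i j = 0 := by simp [δ, h]

theorem sum_δ_comp (X : Add C) {Y : C} {p : ℤ} (i : X.ι)
    (f : ∀ j, DGCategory.Hom (X.obj j) Y p) :
    ∑ j, DGCategory.comp (zero_add p) (X.δ i j) (f j) = f i := by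
  classical
  rw [Finset.sum_eq_single i, δ_self, DGCategory.id_comp]
  · intro j _ h
    rw [δ_ne X (Ne.symm h), map_zero, LinearMap.zero_apply]
  · simp

theorem sum_comp_δ (X : Add C) {Y : C} {p : ℤ} (i : X.ι)
    (f : ∀ j, DGCategory.Hom Y (X.obj j) p) :
    ∑ j, DGCategory.comp (add_zero p) (f j) (X.δ j i) = f i := by
  classical
  rw [Finset.sum_eq_single i, δ_self, DGCategory.comp_id]
  · intro j _ h
    rw [δ_ne X h, map_zero]
  · simp

theorem d_δ (X : Add C) (i j : X.ι) {q : ℤ} (h : 0 + 1 = q) : DGCategory.d h (X.δ i j) = 0 := by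
  by_cases hij : i = j
  · subst hij; rw [δ_self, DGCategory.d_id]
  · rw [δ_ne X hij, map_zero]

/-- Morphisms are matrices. -/
noncomputable instance : DGCategory (Add C) where
  Hom X Y p := ∀ i j, DGCategory.Hom (X.obj i) (Y.obj j) p
  addCommGroup _ _ _ := inferInstance
  module _ _ _ := inferInstance
  d h := LinearMap.pi fun i => LinearMap.pi fun j =>
    DGCategory.d h ∘ₗ LinearMap.proj j ∘ₗ LinearMap.proj i
  one X := X.δ
  comp {X Y Z} p q r h := LinearMap.mk₂ F
    (fun f g i k => ∑ j, DGCategory.comp h (f i j) (g j k))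
    (by intros; ext; simp [Finset.sum_add_distrib])
    (by intros; ext; simp [Finset.smul_sum])
    (by intros; ext; simp [Finset.sum_add_distrib])
    (by intros; ext; simp [Finset.smul_sum])
  id_comp f := by funext i k; exact sum_δ_comp _ i fun j => f j k
  comp_id f := by funext i k; exact sum_comp_δ _ k fun j => f i j
  assoc h₁ h₂ h₃ h₄ f g h := by
    funext i l
    simp only [LinearMap.mk₂_apply, map_sum, LinearMap.sum_apply]
    rw [Finset.sum_comm]
    refine Finset.sum_congr rfl fun j _ => Finset.sum_congr rfl fun k _ => ?_
    exact DGCategory.assoc h₁ h₂ h₃ h₄ _ _ _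
  d_d h₁ h₂ f := by
    funext i j
    exact DGCategory.d_d h₁ h₂ (f i j)
  d_comp h hp hq hr h₁ h₂ f g := by
    funext i k
    simp only [LinearMap.mk₂_apply, LinearMap.pi_apply, LinearMap.comp_apply, LinearMap.proj_apply,
      map_sum, Pi.add_apply, ← Finset.sum_add_distrib]
    exact Finset.sum_congr rfl fun j _ => DGCategory.d_comp h hp hq hr h₁ h₂ _ _

@[ext]
theorem hom_ext {X Y : Add C} {p : ℤ} {f g : DGCategory.Hom X Y p} (h : ∀ i j, f i j = g i j) :
    f = g := funext fun i => funext fun j => h i j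

theorem one_apply (X : Add C) (i j : X.ι) : DGCategory.one X i j = X.δ i j := rfl

theorem add_apply {X Y : Add C} {p : ℤ} (f g : DGCategory.Hom X Y p) (i j) :
    (f + g) i j = f i j + g i j := rfl

theorem zero_apply {X Y : Add C} {p : ℤ} (i j) : (0 : DGCategory.Hom X Y p) i j = 0 := rfl

theorem d_apply {X Y : Add C} {p q : ℤ} (h : p + 1 = q) (f : DGCategory.Hom X Y p) (i j) :
    DGCategory.d h f i j = DGCategory.d h (f i j) := rfl

theorem comp_apply {X Y Z : Add C} {p q r : ℤ} (h : p + q = r) (f : DGCategory.Hom X Y p)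
    (g : DGCategory.Hom Y Z q) (i k) :
    DGCategory.comp h f g i k = ∑ j, DGCategory.comp h (f i j) (g j k) := rfl

/-- The monomial matrix with entries `φ i` at the places `(i, e i)`. -/
noncomputable def diag {X Y : Add C} {p : ℤ} (e : X.ι → Y.ι)
    (φ : ∀ i, DGCategory.Hom (X.obj i) (Y.obj (e i)) p) : DGCategory.Hom X Y p :=
  fun i j => DGCategory.comp (add_zero p) (φ i) (Y.δ (e i) j)

/-- The monomial matrix with entries `φ i` at the places `(e i, i)`. -/
noncomputable def codiag {X Y : Add C} {p : ℤ} (e : X.ι → Y.ι)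
    (φ : ∀ i, DGCategory.Hom (Y.obj (e i)) (X.obj i) p) : DGCategory.Hom Y X p :=
  fun j i => DGCategory.comp (zero_add p) (Y.δ j (e i)) (φ i)

theorem diag_comp {X Y Z : Add C} {p q r : ℤ} (h : p + q = r) (e : X.ι → Y.ι)
    (φ : ∀ i, DGCategory.Hom (X.obj i) (Y.obj (e i)) p) (f : DGCategory.Hom Y Z q) (i k) :
    DGCategory.comp h (diag e φ) f i k = DGCategory.comp h (φ i) (f (e i) k) := by
  rw [comp_apply, ← sum_δ_comp Y (e i) fun j => f j k, map_sum]
  exact Finset.sum_congr rfl fun j _ => DGCategory.assoc _ _ _ _ _ _ _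

theorem comp_codiag {X Y Z : Add C} {p q r : ℤ} (h : q + p = r) (e : X.ι → Y.ι)
    (φ : ∀ i, DGCategory.Hom (Y.obj (e i)) (X.obj i) p) (f : DGCategory.Hom Z Y q) (k i) :
    DGCategory.comp h f (codiag e φ) k i = DGCategory.comp h (f k (e i)) (φ i) := by
  rw [comp_apply, ← sum_comp_δ Y (e i) fun j => f k j, map_sum, LinearMap.sum_apply]
  exact Finset.sum_congr rfl fun j _ => (DGCategory.assoc _ _ _ _ _ _ _).symm

theorem comp_diag {X Y Z : Add C} {p q r : ℤ} (h : q + p = r) {e : X.ι → Y.ι}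
    (he : Function.Injective e)
    (φ : ∀ i, DGCategory.Hom (X.obj i) (Y.obj (e i)) p) (f : DGCategory.Hom Z X q) (k i) :
    DGCategory.comp h f (diag e φ) k (e i) = DGCategory.comp h (f k i) (φ i) := by
  classical
  rw [comp_apply, Finset.sum_eq_single i]
  · rw [diag, δ_self, DGCategory.comp_id]
  · intro j _ hj
    rw [diag, δ_ne Y (he.ne hj), map_zero, map_zero]
  · simp

theorem diag_comp_diag {X Y Z : Add C} {p q r : ℤ} (h : p + q = r) (e : X.ι → Y.ι)
    (φ : ∀ i, DGCategory.Hom (X.obj i) (Y.obj (e i)) p) (e' : Y.ι → Z.ι)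
    (ψ : ∀ i, DGCategory.Hom (Y.obj i) (Z.obj (e' i)) q) :
    DGCategory.comp h (diag e φ) (diag e' ψ) =
      diag (fun i => e' (e i)) fun i => DGCategory.comp h (φ i) (ψ (e i)) := by
  ext i k
  rw [diag_comp]
  exact (DGCategory.assoc _ _ _ _ _ _ _).symm

theorem diag_id (X : Add C) : diag (X := X) (Y := X) (fun i => i) (fun _ => DGCategory.one _) =
    DGCategory.one X := by
  ext i j
  exact DGCategory.id_comp _

theorem d_diag {X Y : Add C} {p q : ℤ} (hq : p + 1 = q) (e : X.ι → Y.ι)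
    (φ : ∀ i, DGCategory.Hom (X.obj i) (Y.obj (e i)) p) :
    DGCategory.d hq (diag e φ) = diag e fun i => DGCategory.d hq (φ i) := by
  ext i j
  rw [d_apply, diag, DGCategory.d_comp (add_zero p) hq (zero_add 1) hq (add_zero q) hq, d_δ,
    map_zero, add_zero, diag]

theorem diag_comp_codiag {X Y : Add C} {p q : ℤ} (h : p + q = 0) {e : X.ι → Y.ι} (he : Function.Bijective e)
    (φ : ∀ i, DGCategory.Hom (X.obj i) (Y.obj (e i)) p)
    (ψ : ∀ i, DGCategory.Hom (Y.obj (e i)) (X.obj i) q)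
    (H : ∀ i, DGCategory.comp h (φ i) (ψ i) = DGCategory.one _) :
    DGCategory.comp h (diag e φ) (codiag e ψ) = DGCategory.one X := by
  ext i j
  rw [diag_comp, codiag]
  by_cases hij : i = j
  · subst hij
    rw [δ_self, DGCategory.id_comp, H, one_apply, δ_self]
  · rw [δ_ne Y (he.injective.ne hij), map_zero, LinearMap.zero_apply, map_zero, one_apply,
      δ_ne X hij]

theorem codiag_comp_diag {X Y : Add C} {p q : ℤ} (h : q + p = 0) {e : X.ι → Y.ι} (he : Function.Bijective e)
    (φ : ∀ i, DGCategory.Hom (X.obj i) (Y.obj (e i)) p)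
    (ψ : ∀ i, DGCategory.Hom (Y.obj (e i)) (X.obj i) q)
    (H : ∀ i, DGCategory.comp h (ψ i) (φ i) = DGCategory.one _) :
    DGCategory.comp h (codiag e ψ) (diag e φ) = DGCategory.one Y := by
  ext j k
  obtain ⟨i, rfl⟩ := he.surjective k
  rw [comp_diag h he.injective, codiag,
    DGCategory.assoc (zero_add q) h h (zero_add 0), H, DGCategory.comp_id]
  rfl

theorem isDGIso_diag {X Y : Add C} {e : X.ι → Y.ι} (he : Function.Bijective e)
    (φ : ∀ i, DGCategory.Hom (X.obj i) (Y.obj (e i)) 0) (H : ∀ i, DGCategory.IsDGIso (φ i)) :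
    DGCategory.IsDGIso (diag e φ) := by
  choose hd ψ h₁ h₂ using H
  refine ⟨?_, codiag e ψ, diag_comp_codiag _ he φ ψ h₁, codiag_comp_diag _ he φ ψ h₂⟩
  rw [d_diag]
  ext i j
  rw [diag, hd, map_zero, LinearMap.zero_apply, zero_apply]

/-- The shift of a direct sum is the direct sum of the shifts. -/
noncomputable instance [HasDGShift C] : HasDGShift (Add C) where
  sh n X := { ι := X.ι, obj := fun i => HasDGShift.sh n (X.obj i) }
  s n X _ h := diag (fun i => i) fun i => HasDGShift.s n (X.obj i) h
  t n X := diag (fun i => i) fun i => HasDGShift.t n (X.obj i)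
  s_t n X m h h' := by
    rw [diag_comp_diag]
    simp only [HasDGShift.s_t]
    exact diag_id X
  t_s n X m h := by
    rw [diag_comp_diag]
    simp only [HasDGShift.t_s]
    exact diag_id (X := { ι := X.ι, obj := fun i => HasDGShift.sh n (X.obj i) })
  d_s n X m q h hq := by
    rw [d_diag]
    ext i j
    rw [diag, HasDGShift.d_s, map_zero, LinearMap.zero_apply, zero_apply]
  d_t n X q hq := by
    rw [d_diag]
    ext i j
    rw [diag, HasDGShift.d_t, map_zero, LinearMap.zero_apply, zero_apply]

/-! The tensor product, which distributes over direct sums. -/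

section Monoidal

variable [MonoidalDGCategory C]

open MonoidalDGCategory (tensor_id tensor_comp d_tensor)

abbrev unit : Add C := { ι := Unit, obj := fun _ => MonoidalDGCategory.unit }

abbrev tensorObj (X Y : Add C) : Add C :=
  { ι := X.ι × Y.ι, obj := fun i => MonoidalDGCategory.tensorObj (X.obj i.1) (Y.obj i.2) }

/-- The Kronecker product of matrices. -/
noncomputable def tensorHom {X Y X' Y' : Add C} {p q r : ℤ} (h : p + q = r) :
    DGCategory.Hom X Y p →ₗ[F] DGCategory.Hom X' Y' q →ₗ[F]
      DGCategory.Hom (tensorObj X X') (tensorObj Y Y') r :=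
  LinearMap.mk₂ F
    (fun f g i j => MonoidalDGCategory.tensorHom h (f i.1 j.1) (g i.2 j.2))
    (fun f f' g => by
      funext i j
      exact LinearMap.map_add₂ (MonoidalDGCategory.tensorHom h) (f i.1 j.1) (f' i.1 j.1) _)
    (fun c f g => by
      funext i j; exact LinearMap.map_smul₂ (MonoidalDGCategory.tensorHom h) c (f i.1 j.1) _)
    (fun f g g' => by
      funext i j
      exact (MonoidalDGCategory.tensorHom h (f i.1 j.1)).map_add (g i.2 j.2) (g' i.2 j.2))
    (fun c f g => by
      funext i j; exact (MonoidalDGCategory.tensorHom h (f i.1 j.1)).map_smul c (g i.2 j.2))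

theorem tensorHom_apply {X Y X' Y' : Add C} {p q r : ℤ} (h : p + q = r)
    (f : DGCategory.Hom X Y p) (g : DGCategory.Hom X' Y' q) (i : (tensorObj X X').ι)
    (j : (tensorObj Y Y').ι) :
    tensorHom h f g i j = MonoidalDGCategory.tensorHom h (f i.1 j.1) (g i.2 j.2) := rfl

theorem tensor_δ (X Y : Add C) (i j : (tensorObj X Y).ι) :
    MonoidalDGCategory.tensorHom (add_zero 0) (X.δ i.1 j.1) (Y.δ i.2 j.2) =
      (tensorObj X Y).δ i j := by
  obtain ⟨i, i'⟩ := i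
  obtain ⟨j, j'⟩ := j
  by_cases h : i = j
  · by_cases h' : i' = j'
    · subst h; subst h'
      simp only [δ_self]
      exact MonoidalDGCategory.tensor_id _ _
    · rw [δ_ne Y h', map_zero, δ_ne]
      simp [h']
  · rw [δ_ne X h, map_zero, LinearMap.zero_apply, δ_ne]
    simp [h]

theorem tensor_diag {X Y X' Y' : Add C} {p q r : ℤ} (h : p + q = r) (e : X.ι → Y.ι)
    (φ : ∀ i, DGCategory.Hom (X.obj i) (Y.obj (e i)) p) (e' : X'.ι → Y'.ι)
    (φ' : ∀ i, DGCategory.Hom (X'.obj i) (Y'.obj (e' i)) q) :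
    tensorHom h (diag e φ) (diag e' φ') =
      diag (X := tensorObj X X') (Y := tensorObj Y Y') (fun i => (e i.1, e' i.2))
        fun i => MonoidalDGCategory.tensorHom h (φ i.1) (φ' i.2) := by
  ext i j
  refine Eq.trans ?_ (congrArg _ (tensor_δ Y Y' (e i.1, e' i.2) j))
  exact (tensor_comp _ _ _ _ _ _ _ _ _ _).symm

noncomputable def α (X Y Z : Add C) :
    DGCategory.Hom (tensorObj (tensorObj X Y) Z) (tensorObj X (tensorObj Y Z)) 0 :=
  diag (X := tensorObj (tensorObj X Y) Z) (Y := tensorObj X (tensorObj Y Z))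
    (fun i => (i.1.1, (i.1.2, i.2))) fun i =>
      MonoidalDGCategory.α (X.obj i.1.1) (Y.obj i.1.2) (Z.obj i.2)

noncomputable def l (X : Add C) : DGCategory.Hom (tensorObj unit X) X 0 :=
  diag (X := tensorObj unit X) (fun i => i.2) fun i => MonoidalDGCategory.l (X.obj i.2)

noncomputable def ρ (X : Add C) : DGCategory.Hom (tensorObj X unit) X 0 :=
  diag (X := tensorObj X unit) (fun i => i.1) fun i => MonoidalDGCategory.ρ (X.obj i.1)

theorem α_bij (X Y Z : Add C) : Function.Bijective fun i : (tensorObj (tensorObj X Y) Z).ι =>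
    ((i.1.1, (i.1.2, i.2)) : (tensorObj X (tensorObj Y Z)).ι) :=
  (Equiv.prodAssoc X.ι Y.ι Z.ι).bijective

theorem l_bij (X : Add C) : Function.Bijective fun i : (tensorObj (unit (C := C)) X).ι => i.2 :=
  (Equiv.punitProd X.ι).bijective

theorem ρ_bij (X : Add C) : Function.Bijective fun i : (tensorObj X (unit (C := C))).ι => i.1 :=
  (Equiv.prodPUnit X.ι).bijective

noncomputable instance : MonoidalDGCategory (Add C) where
  unit := unit
  tensorObj := tensorObj
  tensorHom := tensorHom
  tensor_id X Y := by
    ext i j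
    exact tensor_δ X Y i j
  tensor_comp h₁ h₂ h₃ h₄ h₅ h₆ f f' g g' := by
    ext i k
    rw [tensorHom_apply, comp_apply, comp_apply, comp_apply]
    simp only [map_sum, LinearMap.sum_apply, tensorHom_apply]
    rw [Finset.sum_comm]
    refine (Fintype.sum_prod_type _).trans ?_
    refine Finset.sum_congr rfl fun j _ => Finset.sum_congr rfl fun j' _ => ?_
    exact tensor_comp _ _ _ _ _ _ _ _ _ _
  d_tensor h hp hq hr h₁ h₂ f g := by
    ext i j
    exact d_tensor h hp hq hr h₁ h₂ _ _
  α := α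
  l := l
  ρ := ρ
  α_iso X Y Z := isDGIso_diag (α_bij X Y Z) _ fun _ => MonoidalDGCategory.α_iso _ _ _
  l_iso X := isDGIso_diag (l_bij X) _ fun _ => MonoidalDGCategory.l_iso _
  ρ_iso X := isDGIso_diag (ρ_bij X) _ fun _ => MonoidalDGCategory.ρ_iso _
  α_nat {X X' Y Y' Z Z' _ _ _ _ _ _} h₁ h₂ h₃ h₄ f g h := by
    ext i j
    obtain ⟨j, rfl⟩ := (α_bij X' Y' Z').surjective j
    rw [α, α, comp_diag _ (α_bij X' Y' Z').injective, diag_comp]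
    exact MonoidalDGCategory.α_nat h₁ h₂ h₃ h₄ _ _ _
  l_nat {X X' _} f := by
    ext i j
    obtain ⟨j, rfl⟩ := (l_bij X').surjective j
    rw [l, l, comp_diag _ (l_bij X').injective, diag_comp]
    refine Eq.trans ?_ (MonoidalDGCategory.l_nat _)
    exact congrArg (fun a => DGCategory.comp _ (MonoidalDGCategory.tensorHom _ a _) _)
      (δ_self unit ())
  ρ_nat {X X' _} f := by
    ext i j
    obtain ⟨j, rfl⟩ := (ρ_bij X').surjective j
    rw [ρ, ρ, comp_diag _ (ρ_bij X').injective, diag_comp]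
    refine Eq.trans ?_ (MonoidalDGCategory.ρ_nat _)
    exact congrArg (fun a => DGCategory.comp _ (MonoidalDGCategory.tensorHom _ _ a) _)
      (δ_self unit ())
  pentagon W X Y Z := by
    rw [← diag_id Z, ← diag_id W]
    simp only [α]
    rw [tensor_diag, tensor_diag, diag_comp_diag, diag_comp_diag, diag_comp_diag]
    refine congrArg (fun φ => diag _ φ) ?_
    funext i
    exact MonoidalDGCategory.pentagon _ _ _ _
  triangle X Y := by
    rw [← diag_id X, ← diag_id Y]
    simp only [α, l, ρ]
    rw [tensor_diag, tensor_diag, diag_comp_diag]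
    refine congrArg (fun φ => diag _ φ) ?_
    funext i
    exact MonoidalDGCategory.triangle _ _

end Monoidal

end Add
end SqrtNegOne
namespace SqrtNegOne

/-! ### One-sided twisted complexes -/

/-- One-sided twisted complexes over `C`: a formal direct sum of objects `a_i` of `C`, over a finite
index set, with an endomorphism `f` of degree one such that `d f + f ∘ f = 0`. One-sidedness means
that, for a suitable enumeration (total order) of the index set, the component `f i j : a_i → a_j`
vanishes unless `i < j`. -/
structure Tw (C : Type u) [DGCategory C] : Type (max u 1) where
  obj : Add C
  f : DGCategory.Hom obj obj 1
  mc : DGCategory.d (q := 2) rfl f + DGCategory.comp (r := 2) rfl f f = 0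
  oneSided : ∃ _ : LinearOrder obj.ι, ∀ i j, ¬ i < j → f i j = 0

namespace Tw

variable {C : Type u} [DGCategory C]

theorem mc' (X : Tw C) {q : ℤ} (h : 1 + 1 = q) :
    DGCategory.d h X.f = DGCategory.comp h X.f X.f := by
  subst h
  exact DGCategory.eq_of_add_eq_zero X.mc

theorem char_two_aux {A : Type} [AddCommGroup A] [Module F A] {x y z : A} (h : x + y = z) :
    y = x + z := by
  have h2 : x + x = 0 := by rw [← two_smul F x, show (2 : F) = 0 from rfl, zero_smul]
  rw [← h, ← add_assoc, h2, zero_add]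

/-- The differential `h ↦ d h + h ∘ f + g ∘ h` on morphisms `(a, f) → (b, g)`. -/
noncomputable def diff {X Y : Tw C} {p q : ℤ} (h : p + 1 = q) :
    DGCategory.Hom X.obj Y.obj p →ₗ[F] DGCategory.Hom X.obj Y.obj q :=
  DGCategory.d h + DGCategory.comp (by rw [add_comm, h]) X.f +
    (DGCategory.comp h).flip Y.f

theorem diff_apply {X Y : Tw C} {p q : ℤ} (h : p + 1 = q) (φ : DGCategory.Hom X.obj Y.obj p) :
    diff h φ = DGCategory.d h φ + DGCategory.comp (by rw [add_comm, h]) X.f φ +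
      DGCategory.comp h φ Y.f := rfl

noncomputable instance : DGCategory (Tw C) where
  Hom X Y p := DGCategory.Hom X.obj Y.obj p
  addCommGroup _ _ _ := inferInstance
  module _ _ _ := inferInstance
  d h := diff h
  one X := DGCategory.one X.obj
  comp h := DGCategory.comp h
  id_comp := DGCategory.id_comp
  comp_id := DGCategory.comp_id
  assoc := DGCategory.assoc
  d_d {X Y p q r} h₁ h₂ φ := by
    have e₁ : 1 + p = q := by omega
    have e₂ : 1 + q = r := by omega
    have e₃ : (2 : ℤ) + p = r := by omega
    have e₄ : p + (2 : ℤ) = r := by omega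
    simp only [diff_apply, map_add]
    rw [DGCategory.d_d h₁ h₂, DGCategory.d_comp e₁ (rfl : (1 : ℤ) + 1 = 2) h₁ h₂ e₃ e₂,
      DGCategory.d_comp h₁ h₁ (rfl : (1 : ℤ) + 1 = 2) h₂ h₂ e₄, X.mc' rfl, Y.mc' rfl,
      DGCategory.assoc rfl e₁ e₃ e₂, DGCategory.assoc e₁ h₁ h₂ e₂,
      DGCategory.assoc h₁ rfl h₂ e₄]
    generalize DGCategory.comp e₂ X.f (DGCategory.comp e₁ X.f φ) = a₁
    generalize DGCategory.comp e₂ X.f (DGCategory.d h₁ φ) = a₂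
    generalize DGCategory.comp h₂ (DGCategory.d h₁ φ) Y.f = a₃
    generalize DGCategory.comp e₄ φ _ = a₄
    generalize DGCategory.comp e₂ X.f (DGCategory.comp h₁ φ Y.f) = a₅
    have h : 0 + a₂ + a₃ + (a₁ + a₂ + a₁ + a₅) + (a₃ + a₄ + a₅ + a₄) =
      (a₁ + a₁) + (a₂ + a₂) + (a₃ + a₃) + (a₄ + a₄) + (a₅ + a₅) := by abel
    rw [h]
    simp only [DGCategory.add_self, add_zero]
  d_comp {X Y Z p q r p' q' r'} h hp hq hr h₁ h₂ φ ψ := by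
    have e₁ : 1 + p = p' := by omega
    have e₂ : 1 + q = q' := by omega
    have e₃ : 1 + r = r' := by omega
    simp only [diff_apply, map_add, LinearMap.add_apply]
    rw [DGCategory.d_comp h hp hq hr h₁ h₂, DGCategory.assoc e₁ h h₁ e₃,
      DGCategory.assoc h hq hr h₂, DGCategory.assoc hp e₂ h₁ h₂]
    generalize DGCategory.comp h₂ φ (DGCategory.comp e₂ Y.f ψ) = a₁
    generalize DGCategory.comp h₁ (DGCategory.d hp φ) ψ = a₂
    generalize DGCategory.comp h₂ φ (DGCategory.d hq ψ) = a₃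
    generalize DGCategory.comp e₃ X.f _ = a₄
    generalize DGCategory.comp h₂ φ (DGCategory.comp hq ψ Z.f) = a₅
    have h : a₂ + a₄ + a₁ + (a₃ + a₁ + a₅) = (a₁ + a₁) + (a₂ + a₃ + a₄ + a₅) := by abel
    rw [h, DGCategory.add_self]
    abel

theorem d_eq {X Y : Tw C} {p q : ℤ} (h : p + 1 = q) (φ : DGCategory.Hom X Y p) :
    DGCategory.d h φ = DGCategory.d (C := Add C) h φ +
      DGCategory.comp (C := Add C) (by rw [add_comm, h]) X.f φ +
      DGCategory.comp (C := Add C) h φ Y.f := rfl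

/-- A closed morphism of formal direct sums which commutes with the twists is closed. -/
theorem closed_of {X Y : Tw C} {p q : ℤ} (h : p + 1 = q) (φ : DGCategory.Hom X.obj Y.obj p)
    (hd : DGCategory.d h φ = 0)
    (hc : DGCategory.comp (by rw [add_comm, h]) X.f φ = DGCategory.comp h φ Y.f) :
    DGCategory.d (C := Tw C) (X := X) (Y := Y) h φ = 0 := by
  rw [d_eq, hd, zero_add]
  exact (congrArg (· + _) hc).trans (DGCategory.add_self _)

/-- A closed isomorphism of degree zero of formal direct sums which commutes with the twists. -/
theorem isDGIso_of {X Y : Tw C} (φ : DGCategory.Hom X.obj Y.obj 0) (h : DGCategory.IsDGIso φ)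
    (hc : DGCategory.comp (add_zero 1) X.f φ = DGCategory.comp (zero_add 1) φ Y.f) :
    DGCategory.IsDGIso (C := Tw C) (X := X) (Y := Y) φ := by
  exact ⟨closed_of _ φ h.1 hc, h.2⟩

/-- An object of `C` as a twisted complex. -/
noncomputable def ofObj (X : C) : Tw C where
  obj := { ι := Unit, obj := fun _ => X }
  f := 0
  mc := by simp
  oneSided := ⟨inferInstanceAs (LinearOrder Unit), fun _ _ _ => rfl⟩

/-- The shift: every summand is shifted, and the components of `f` are transported. -/
noncomputable def sh [HasDGShift C] (n : ℤ) (X : Tw C) : Tw C where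
  obj := HasDGShift.sh n X.obj
  f := HasDGShift.shHom n X.f
  mc := by
    rw [HasDGShift.d_shHom, ← HasDGShift.shHom_comp, ← HasDGShift.shHom_add, X.mc,
      HasDGShift.shHom_zero]
  oneSided := by
    obtain ⟨o, h⟩ := X.oneSided
    refine ⟨o, fun i j hij => ?_⟩
    have hi : Function.Injective fun k : X.obj.ι => k := fun _ _ h => h
    refine (Add.diag_comp _ _ _ _ i j).trans ?_
    refine (congrArg _ (Add.comp_diag (Y := HasDGShift.sh n X.obj) _ hi _ X.f i j)).trans ?_
    rw [h i j hij, map_zero, LinearMap.zero_apply, map_zero]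

/-- Shifts of twisted complexes. -/
noncomputable instance [HasDGShift C] : HasDGShift (Tw C) where
  sh := sh
  s n X _ h := HasDGShift.s n X.obj h
  t n X := HasDGShift.t n X.obj
  s_t n X _ h h' := HasDGShift.s_t n X.obj h h'
  t_s n X _ h := HasDGShift.t_s n X.obj h
  d_s n X _ _ h hq := closed_of (X := X) (Y := sh n X) hq _ (HasDGShift.d_s n X.obj h hq)
    (HasDGShift.s_shHom n X.f h hq _).symm
  d_t n X _ hq := closed_of (X := sh n X) (Y := X) hq _ (HasDGShift.d_t n X.obj hq)
    (HasDGShift.shHom_t n X.f _ hq)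

section Monoidal

variable [MonoidalDGCategory C]

open MonoidalDGCategory

noncomputable def unit : Tw C where
  obj := Add.unit
  f := 0
  mc := by simp
  oneSided := ⟨inferInstanceAs (LinearOrder Unit), fun _ _ _ => rfl⟩

/-- `(a, f) ⊗ (b, g) = (a ⊗ b, f ⊗ 1 + 1 ⊗ g)`. -/
noncomputable def tensorObj (X Y : Tw C) : Tw C where
  obj := MonoidalDGCategory.tensorObj X.obj Y.obj
  f := tensorHom (add_zero 1) X.f (DGCategory.one Y.obj) +
    tensorHom (zero_add 1) (DGCategory.one X.obj) Y.f
  mc := by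
    rw [map_add, d_tensor (q' := 1) _ rfl rfl _ (by omega) (by omega),
      d_tensor (p' := 1) _ rfl rfl _ (by omega) (by omega), DGCategory.d_id, DGCategory.d_id,
      X.mc' rfl, Y.mc' rfl]
    simp only [map_add, LinearMap.add_apply, map_zero, LinearMap.zero_apply, add_zero, zero_add]
    rw [tensor_comp _ _ _ rfl (add_zero 0) (by omega), tensor_comp _ _ _ (add_zero 1) (zero_add 1)
      (by omega), tensor_comp _ _ _ (zero_add 1) (add_zero 1) (by omega),
      tensor_comp _ _ _ (add_zero 0) rfl (by omega)]
    simp only [DGCategory.id_comp, DGCategory.comp_id]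
    generalize tensorHom _ (DGCategory.comp _ X.f X.f) _ = a₁
    generalize tensorHom _ _ (DGCategory.comp _ Y.f Y.f) = a₂
    generalize tensorHom _ X.f Y.f = a₃
    have h : a₁ + a₂ + (a₁ + a₃ + (a₃ + a₂)) = (a₁ + a₁) + (a₂ + a₂) + (a₃ + a₃) := by abel
    rw [h]
    simp only [DGCategory.add_self, add_zero]
  oneSided := by
    obtain ⟨o, h⟩ := X.oneSided
    obtain ⟨o', h'⟩ := Y.oneSided
    refine ⟨inferInstanceAs (LinearOrder (X.obj.ι ×ₗ Y.obj.ι)), ?_⟩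
    rintro ⟨i, i'⟩ ⟨j, j'⟩ hij
    have hij' : ¬ (toLex (i, i') < toLex (j, j')) := hij
    rw [Prod.Lex.toLex_lt_toLex] at hij'
    push Not at hij'
    have e₁ : X.f i j = 0 := h i j (not_lt.mpr hij'.1)
    have e₂ : MonoidalDGCategory.tensorHom (zero_add 1) (X.obj.δ i j) (Y.f i' j') = 0 := by
      by_cases hh : i = j
      · rw [h' i' j' (not_lt.mpr (hij'.2 hh)), map_zero]
      · rw [Add.δ_ne _ hh, map_zero, LinearMap.zero_apply]
    change MonoidalDGCategory.tensorHom (add_zero 1) (X.f i j) (Y.obj.δ i' j') +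
      MonoidalDGCategory.tensorHom (zero_add 1) (X.obj.δ i j) (Y.f i' j') = 0
    rw [e₁, e₂, map_zero, LinearMap.zero_apply, add_zero]

/-- The tensor product of morphisms is the one of formal direct sums. -/
noncomputable instance : MonoidalDGCategory (Tw C) where
  unit := unit
  tensorObj := tensorObj
  tensorHom {X Y X' Y' _ _ _} h :=
    tensorHom (X := X.obj) (Y := Y.obj) (X' := X'.obj) (Y' := Y'.obj) h
  tensor_id X Y := tensor_id X.obj Y.obj
  tensor_comp := tensor_comp (C := Add C)
  d_tensor h hp hq hr h₁ h₂ φ ψ :=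
    twist_tensor (C := Add C) h hp hq hr h₁ h₂ _ _ _ _ _ _ _ φ ψ
  α X Y Z := α X.obj Y.obj Z.obj
  l X := l X.obj
  ρ X := ρ X.obj
  α_iso X Y Z := isDGIso_of (X := tensorObj (tensorObj X Y) Z) (Y := tensorObj X (tensorObj Y Z)) _
    (α_iso X.obj Y.obj Z.obj) (twist_α X.f Y.f Z.f)
  l_iso X := isDGIso_of (X := tensorObj unit X) (Y := X) _ (l_iso X.obj) (twist_l X.f)
  ρ_iso X := isDGIso_of (X := tensorObj X unit) (Y := X) _ (ρ_iso X.obj) (twist_ρ X.f)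
  α_nat := α_nat (C := Add C)
  l_nat f := l_nat (C := Add C) f
  ρ_nat f := ρ_nat (C := Add C) f
  pentagon W X Y Z := pentagon W.obj X.obj Y.obj Z.obj
  triangle X Y := triangle X.obj Y.obj

end Monoidal

end Tw
end SqrtNegOne
namespace SqrtNegOne

/-! ### The zeroth cohomology category -/

/-- The objects of the zeroth cohomology category of `C`. -/
@[ext]
structure H0 (C : Type u) : Type u where
  of ::
  as : C

namespace H0

variable {C : Type u} [DGCategory C]

/-- Closed morphisms of degree zero. -/
def Z (X Y : C) : Submodule F (DGCategory.Hom X Y 0) :=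
  LinearMap.ker (DGCategory.d (zero_add 1))

/-- Exact morphisms of degree zero. -/
def B (X Y : C) : Submodule F (DGCategory.Hom X Y 0) :=
  LinearMap.range (DGCategory.d (X := X) (Y := Y) (neg_add_cancel 1))

/-- The zeroth cohomology of the complex of morphisms. -/
abbrev HomH (X Y : C) : Type := Z X Y ⧸ (B X Y).submoduleOf (Z X Y)

/-- The class of a closed morphism of degree zero. -/
def cls {X Y : C} (f : DGCategory.Hom X Y 0) (hf : DGCategory.d (zero_add 1) f = 0) : HomH X Y :=
  Submodule.Quotient.mk ⟨f, hf⟩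

theorem cls_surjective {X Y : C} (f : HomH X Y) : ∃ g hg, cls g hg = f := by
  obtain ⟨⟨g, hg⟩, rfl⟩ := Submodule.Quotient.mk_surjective _ f
  exact ⟨g, hg, rfl⟩

theorem cls_eq {X Y : C} {f g : DGCategory.Hom X Y 0} {hf hg} (h : f = g) :
    cls f hf = cls g hg := by subst h; rfl

theorem cls_eq_zero {X Y : C} {f : DGCategory.Hom X Y 0} {hf}
    (h : ∃ g : DGCategory.Hom X Y (-1), DGCategory.d (neg_add_cancel 1) g = f) : cls f hf = 0 :=
  (Submodule.Quotient.mk_eq_zero _).mpr h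

theorem closed_comp {X Y Z : C} {f : DGCategory.Hom X Y 0} {g : DGCategory.Hom Y Z 0}
    (hf : DGCategory.d (zero_add 1) f = 0) (hg : DGCategory.d (zero_add 1) g = 0) :
    DGCategory.d (zero_add 1) (DGCategory.comp (add_zero 0) f g) = 0 := by
  rw [DGCategory.d_comp _ (zero_add 1) (zero_add 1) _ (add_zero 1) (zero_add 1), hf, hg, map_zero,
    map_zero, LinearMap.zero_apply, add_zero]

/-- The composition of closed morphisms, with values in cohomology. -/
def compZ (X Y W : C) : Z X Y →ₗ[F] Z Y W →ₗ[F] HomH X W :=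
  LinearMap.mk₂ F (fun f g => cls (DGCategory.comp (add_zero 0) f.1 g.1) (closed_comp f.2 g.2))
    (fun f f' g => cls_eq (hg := (Z X W).add_mem (closed_comp f.2 g.2) (closed_comp f'.2 g.2))
      (LinearMap.map_add₂ _ _ _ _))
    (fun c f g => cls_eq (hg := (Z X W).smul_mem c (closed_comp f.2 g.2))
      (LinearMap.map_smul₂ _ _ _ _))
    (fun f g g' => cls_eq (hg := (Z X W).add_mem (closed_comp f.2 g.2) (closed_comp f.2 g'.2))
      (map_add _ _ _))
    (fun c f g => cls_eq (hg := (Z X W).smul_mem c (closed_comp f.2 g.2)) (map_smul _ _ _))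

/-- The composition in the zeroth cohomology category. -/
def compH (X Y W : C) : HomH X Y →ₗ[F] HomH Y W →ₗ[F] HomH X W :=
  Submodule.liftQ _ (Submodule.liftQ _ (compZ X Y W).flip (by
    rintro ⟨g, hg⟩ ⟨g', hg'⟩
    refine LinearMap.ext fun f => cls_eq_zero ⟨DGCategory.comp (zero_add (-1)) f.1 g', ?_⟩
    rw [DGCategory.d_comp _ (zero_add 1) (neg_add_cancel 1) _ (by omega) (add_zero 0), hg',
      LinearMap.mem_ker.mp f.2, map_zero, LinearMap.zero_apply, zero_add]
    rfl)).flip (by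
    rintro ⟨f, hf⟩ ⟨f', hf'⟩
    refine LinearMap.ext fun g => ?_
    obtain ⟨⟨g, hg⟩, rfl⟩ := Submodule.Quotient.mk_surjective _ g
    refine cls_eq_zero ⟨DGCategory.comp (add_zero (-1)) f' g, ?_⟩
    rw [DGCategory.d_comp _ (neg_add_cancel 1) (zero_add 1) _ (add_zero 0) (by omega), hf',
      LinearMap.mem_ker.mp hg, map_zero, add_zero]
    rfl)

theorem compH_cls {X Y W : C} {f : DGCategory.Hom X Y 0} {g : DGCategory.Hom Y W 0} (hf hg) :
    compH X Y W (cls f hf) (cls g hg) = cls (DGCategory.comp (add_zero 0) f g) (closed_comp hf hg) :=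
  rfl

instance : Category (H0 C) where
  Hom X Y := HomH X.as Y.as
  id X := cls (DGCategory.one X.as) (DGCategory.d_id _ _)
  comp f g := compH _ _ _ f g
  id_comp f := by
    obtain ⟨f, hf, rfl⟩ := cls_surjective f
    exact cls_eq (DGCategory.id_comp f)
  comp_id f := by
    obtain ⟨f, hf, rfl⟩ := cls_surjective f
    exact cls_eq (DGCategory.comp_id f)
  assoc f g h := by
    obtain ⟨f, hf, rfl⟩ := cls_surjective f
    obtain ⟨g, hg, rfl⟩ := cls_surjective g
    obtain ⟨h, hh, rfl⟩ := cls_surjective h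
    exact cls_eq (DGCategory.assoc _ _ _ _ f g h)

instance : Preadditive (H0 C) where
  homGroup X Y := inferInstanceAs (AddCommGroup (HomH X.as Y.as))
  add_comp _ _ _ f f' g := LinearMap.map_add₂ (compH _ _ _) f f' g
  comp_add _ _ _ f g g' := (compH _ _ _ f).map_add g g'

/-- The morphism of the zeroth cohomology category given by a closed morphism of degree zero. -/
def homMk {X Y : C} (f : DGCategory.Hom X Y 0) (hf : DGCategory.d (zero_add 1) f = 0) :
    (⟨X⟩ : H0 C) ⟶ ⟨Y⟩ := cls f hf

theorem homMk_surjective {X Y : H0 C} (f : X ⟶ Y) :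
    ∃ (g : DGCategory.Hom X.as Y.as 0) (hg : _), homMk g hg = f := cls_surjective f

theorem homMk_comp {X Y W : C} {f : DGCategory.Hom X Y 0} {g : DGCategory.Hom Y W 0} (hf hg) :
    homMk f hf ≫ homMk g hg = homMk (DGCategory.comp (add_zero 0) f g) (closed_comp hf hg) := rfl

theorem homMk_id (X : C) :
    homMk (DGCategory.one X) (DGCategory.d_id _ _) = 𝟙 (⟨X⟩ : H0 C) := rfl

/-! The shift functors -/

section Shift

variable [HasDGShift C]

open HasDGShift

theorem closed_shHom (n : ℤ) {X Y : C} {f : DGCategory.Hom X Y 0}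
    (hf : DGCategory.d (zero_add 1) f = 0) : DGCategory.d (zero_add 1) (shHom n f) = 0 := by
  rw [d_shHom, hf, shHom_zero]

/-- The shift on morphisms. -/
def shMap (n : ℤ) (X Y : C) : HomH X Y →ₗ[F] HomH (sh n X) (sh n Y) :=
  Submodule.liftQ _
    { toFun := fun f => cls (shHom n f.1) (closed_shHom n f.2)
      map_add' := fun f g => cls_eq (hg := by
        exact (Z _ _).add_mem (closed_shHom n f.2) (closed_shHom n g.2)) (shHom_add n f.1 g.1)
      map_smul' := fun c f => cls_eq (hg := by
        exact (Z _ _).smul_mem c (closed_shHom n f.2)) (by simp [shHom]) }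
    (by
      rintro ⟨f, hf⟩ ⟨f', hf'⟩
      exact cls_eq_zero ⟨shHom n f', by rw [d_shHom, hf']; rfl⟩)

/-- The functor `X ↦ X[n]`. -/
def shF (n : ℤ) : H0 C ⥤ H0 C where
  obj X := ⟨sh n X.as⟩
  map {X Y} f := shMap n X.as Y.as f
  map_id X := cls_eq (shHom_id n X.as)
  map_comp f g := by
    obtain ⟨f, hf, rfl⟩ := cls_surjective f
    obtain ⟨g, hg, rfl⟩ := cls_surjective g
    exact cls_eq (shHom_comp n _ f g)

theorem shF_map_mk (n : ℤ) {X Y : C} (f : DGCategory.Hom X Y 0) (hf) :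
    (shF n).map (homMk f hf) = homMk (shHom n f) (closed_shHom n hf) := rfl

/-- The isomorphism `X[0] ≅ X`. -/
def shZero (X : H0 C) : (shF 0).obj X ≅ X where
  hom := homMk (X := sh 0 X.as) (Y := X.as) (t 0 X.as) (d_t _ _ _)
  inv := homMk (X := X.as) (Y := sh 0 X.as) (s 0 X.as (add_zero 0)) (d_s _ _ _ _)
  hom_inv_id := cls_eq (t_s 0 X.as (add_zero 0))
  inv_hom_id := cls_eq (s_t 0 X.as (add_zero 0) _)

/-- The isomorphism `X[n + m] ≅ X[n][m]`. -/
def shAdd (n m : ℤ) (X : H0 C) : (shF (n + m)).obj X ≅ (shF m).obj ((shF n).obj X) where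
  hom := homMk (addHom n m X.as) (d_addHom _ _ _)
  inv := homMk (addInv n m X.as) (d_addInv _ _ _)
  hom_inv_id := cls_eq (addHom_addInv n m X.as)
  inv_hom_id := cls_eq (addInv_addHom n m X.as)

theorem eqToHom_shF {n m : ℤ} (h : n = m) (X : H0 C) (h' : (shF n).obj X = (shF m).obj X) :
    eqToHom h' = homMk (eqHom h X.as) (d_eqHom h X.as) := by
  subst h
  exact (cls_eq (t_s n X.as (add_neg_cancel n))).symm

/-- The coherence data of the shift functors. -/
def shiftCore : ShiftMkCore (H0 C) ℤ where
  F := shF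
  zero := NatIso.ofComponents shZero (by
    intro X Y f
    obtain ⟨f, hf, rfl⟩ := homMk_surjective f
    exact cls_eq (zero_nat f))
  add n m := NatIso.ofComponents (shAdd n m) (by
    intro X Y f
    obtain ⟨f, hf, rfl⟩ := homMk_surjective f
    exact cls_eq (add_nat n m f))
  assoc_hom_app m₁ m₂ m₃ X := by
    rw [eqToHom_shF (add_assoc m₁ m₂ m₃)]
    exact cls_eq (add_assoc_hom m₁ m₂ m₃ X.as)
  zero_add_hom_app n X := by
    rw [eqToHom_shF (zero_add n)]
    exact cls_eq (zero_add_hom n X.as)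
  add_zero_hom_app n X := by
    rw [eqToHom_shF (add_zero n)]
    exact cls_eq (add_zero_hom n X.as)

/-- The shift of the zeroth cohomology category. -/
instance : HasShift (H0 C) ℤ := hasShiftMk (H0 C) ℤ shiftCore

instance (n : ℤ) : (shiftFunctor (H0 C) n).Additive where
  map_add {X Y f g} := (shMap n X.as Y.as).map_add f g

end Shift
end H0
end SqrtNegOne
namespace SqrtNegOne

/-! ### Cones -/

namespace Add

variable {C : Type u} [DGCategory C]

/-- The direct sum of two formal direct sums. -/
abbrev sum (A B : Add C) : Add C := { ι := A.ι ⊕ B.ι, obj := Sum.elim A.obj B.obj }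

/-- A block upper triangular matrix. -/
def block {A B A' B' : Add C} {p : ℤ} (a : DGCategory.Hom A A' p) (b : DGCategory.Hom A B' p)
    (c : DGCategory.Hom B B' p) : DGCategory.Hom (sum A B) (sum A' B') p
  | .inl i, .inl j => a i j
  | .inl i, .inr j => b i j
  | .inr _, .inl _ => 0
  | .inr i, .inr j => c i j

theorem d_block {A B A' B' : Add C} {p q : ℤ} (h : p + 1 = q) (a : DGCategory.Hom A A' p)
    (b : DGCategory.Hom A B' p) (c : DGCategory.Hom B B' p) :
    DGCategory.d h (block a b c) =
      block (DGCategory.d h a) (DGCategory.d h b) (DGCategory.d h c) := by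
  ext i j
  rcases i with i | i <;> rcases j with j | j
  · rfl
  · rfl
  · exact DGCategory.d_zero _
  · rfl

theorem add_of_right {G : Type} [AddCommGroup G] {a b c : G} (hb : b = 0) (h : a = c) :
    a + b = c := by rw [hb, h, add_zero]

theorem add_of_left {G : Type} [AddCommGroup G] {a b c : G} (ha : a = 0) (h : b = c) :
    a + b = c := by rw [ha, h, zero_add]

theorem comp_block {A B A' B' A'' B'' : Add C} {p q r : ℤ} (h : p + q = r)
    (a : DGCategory.Hom A A' p) (b : DGCategory.Hom A B' p) (c : DGCategory.Hom B B' p)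
    (a' : DGCategory.Hom A' A'' q) (b' : DGCategory.Hom A' B'' q)
    (c' : DGCategory.Hom B' B'' q) :
    DGCategory.comp h (block a b c) (block a' b' c') = block (DGCategory.comp h a a')
      (DGCategory.comp h a b' + DGCategory.comp h b c') (DGCategory.comp h c c') := by
  ext i j
  rw [comp_apply]
  refine (Fintype.sum_sum_type _).trans ?_
  rcases i with i | i <;> rcases j with j | j
  · exact add_of_right (Finset.sum_eq_zero fun k _ => DGCategory.comp_zero h (b i k)) rfl
  · rfl
  · exact (congrArg₂ (· + ·)
      (Finset.sum_eq_zero fun k _ => DGCategory.zero_comp (X := B.obj i) h (a' k j))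
      (Finset.sum_eq_zero fun k _ => DGCategory.comp_zero (Z := A''.obj j) h (c i k))).trans
      (add_zero _)
  · exact add_of_left
      (Finset.sum_eq_zero fun k _ => DGCategory.zero_comp (X := B.obj i) h (b' k j)) rfl

theorem block_add {A B A' B' : Add C} {p : ℤ} (a a' : DGCategory.Hom A A' p)
    (b b' : DGCategory.Hom A B' p) (c c' : DGCategory.Hom B B' p) :
    block a b c + block a' b' c' = block (a + a') (b + b') (c + c') := by
  ext i j
  rcases i with i | i <;> rcases j with j | j
  · rfl
  · rfl
  · exact add_zero _
  · rfl

theorem block_zero {A B A' B' : Add C} {p : ℤ} :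
    block (0 : DGCategory.Hom A A' p) (0 : DGCategory.Hom A B' p) (0 : DGCategory.Hom B B' p) =
      0 := by
  ext i j
  rcases i with i | i <;> rcases j with j | j <;> rfl

/-- The inclusion of the second summand. -/
noncomputable def inr (A B : Add C) : DGCategory.Hom B (sum A B) 0
  | _, .inl _ => 0
  | i, .inr j => B.δ i j

/-- The projection to the first summand. -/
noncomputable def fst (A B : Add C) : DGCategory.Hom (sum A B) A 0
  | .inl i, j => A.δ i j
  | .inr _, _ => 0

theorem d_inr (A B : Add C) : DGCategory.d (zero_add 1) (inr A B) = 0 := by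
  ext i j
  rcases j with j | j
  · exact DGCategory.d_zero (X := B.obj i) (Y := A.obj j) _
  · exact d_δ B i j _

theorem d_fst (A B : Add C) : DGCategory.d (zero_add 1) (fst A B) = 0 := by
  ext i j
  rcases i with i | i
  · exact d_δ A i j _
  · exact DGCategory.d_zero (X := B.obj i) (Y := A.obj j) _

theorem inr_block {A B A' B' : Add C} {p : ℤ} (a : DGCategory.Hom A A' p)
    (b : DGCategory.Hom A B' p) (c : DGCategory.Hom B B' p) :
    DGCategory.comp (zero_add p) (inr A B) (block a b c) =
      DGCategory.comp (add_zero p) c (inr A' B') := by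
  ext i j
  rw [comp_apply, comp_apply]
  refine (Fintype.sum_sum_type _).trans ?_
  rcases j with j | j
  · refine Eq.trans (congrArg₂ (· + ·)
      (Finset.sum_eq_zero fun k _ => DGCategory.zero_comp (zero_add p) (a k j))
      (Finset.sum_eq_zero fun k _ => DGCategory.comp_zero (zero_add p) (B.δ i k))) ?_
    exact (add_zero _).trans (Finset.sum_eq_zero fun k _ =>
      DGCategory.comp_zero (Z := A'.obj j) (add_zero p) (c i k)).symm
  · refine Eq.trans (congrArg (· + _)
      (Finset.sum_eq_zero fun k _ => DGCategory.zero_comp (zero_add p) (b k j))) ?_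
    exact (zero_add _).trans
      ((sum_δ_comp _ _ fun k => c k j).trans (sum_comp_δ _ _ fun k => c i k).symm)

theorem block_fst {A B A' B' : Add C} {p : ℤ} (a : DGCategory.Hom A A' p)
    (b : DGCategory.Hom A B' p) (c : DGCategory.Hom B B' p) :
    DGCategory.comp (add_zero p) (block a b c) (fst A' B') =
      DGCategory.comp (zero_add p) (fst A B) a := by
  ext i j
  rw [comp_apply, comp_apply]
  refine (Fintype.sum_sum_type _).trans ?_
  rcases i with i | i
  · refine Eq.trans (congrArg (_ + ·)
      (Finset.sum_eq_zero fun k _ => DGCategory.comp_zero (add_zero p) (b i k))) ?_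
    exact (add_zero _).trans
      ((sum_comp_δ _ _ fun k => a i k).trans (sum_δ_comp _ _ fun k => a k j).symm)
  · refine Eq.trans (congrArg₂ (· + ·)
      (Finset.sum_eq_zero fun k _ => DGCategory.zero_comp (add_zero p) (A'.δ k j))
      (Finset.sum_eq_zero fun k _ => DGCategory.comp_zero (add_zero p) (c i k))) ?_
    exact (add_zero _).trans (Finset.sum_eq_zero fun k _ =>
      DGCategory.zero_comp (X := B.obj i) (zero_add p) (a k j)).symm

end Add

namespace Tw

variable {C : Type u} [DGCategory C]

/-- The zero object. -/
noncomputable def zero : Tw C where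
  obj := { ι := Empty, obj := Empty.elim }
  f := 0
  mc := by simp
  oneSided := ⟨LinearOrder.lift' (Empty.elim : Empty → ℕ) fun i => i.elim, fun i => i.elim⟩

instance : HasZeroObject (H0 (Tw C)) :=
  ⟨⟨⟨zero⟩, (IsZero.iff_id_eq_zero _).mpr (H0.cls_eq_zero ⟨0, by
    funext i
    exact i.elim⟩)⟩⟩

/-- The twisted complex `(a ⊕ b, f + k + g)` given by `(a, f)`, `(b, g)` and a closed morphism
`k : (a, f) → (b, g)` of degree one. -/
noncomputable def ext (X Y : Tw C) (k : DGCategory.Hom X Y 1)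
    (hk : DGCategory.d (q := 2) rfl k = 0) : Tw C where
  obj := Add.sum X.obj Y.obj
  f := Add.block X.f k Y.f
  mc := by
    rw [d_eq] at hk
    rw [Add.d_block, Add.comp_block, Add.block_add, X.mc, Y.mc, ← Add.block_zero,
      ← add_assoc]
    exact congrArg (fun x => Add.block 0 x 0) hk
  oneSided := by
    obtain ⟨o, h⟩ := X.oneSided
    obtain ⟨o', h'⟩ := Y.oneSided
    refine ⟨inferInstanceAs (LinearOrder (X.obj.ι ⊕ₗ Y.obj.ι)), ?_⟩
    rintro (i | i) (j | j) hij
    · exact h i j fun hh => hij (Sum.Lex.inl_lt_inl_iff.mpr hh)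
    · exact (hij (Sum.Lex.inl_lt_inr _ _)).elim
    · rfl
    · exact h' i j fun hh => hij (Sum.Lex.inr_lt_inr_iff.mpr hh)

variable [HasDGShift C]

/-- The cone of a closed morphism `h : X → Y` of degree zero: the twisted complex on `X[1] ⊕ Y`
whose component `X[1] → Y` is `h`, regarded as a morphism of degree one. -/
noncomputable def cone {X Y : Tw C} (h : DGCategory.Hom X Y 0)
    (hh : DGCategory.d (zero_add 1) h = 0) : Tw C :=
  ext (HasDGShift.sh 1 X) Y (DGCategory.comp (add_zero 1) (HasDGShift.t 1 X) h)
    (DGCategory.d_comp_eq_zero _ _ (HasDGShift.d_t 1 X _) hh)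

/-- The inclusion `Y → cone h`. -/
noncomputable def coneIn {X Y : Tw C} (h : DGCategory.Hom X Y 0)
    (hh : DGCategory.d (zero_add 1) h = 0) : DGCategory.Hom Y (cone h hh) 0 :=
  Add.inr (HasDGShift.sh 1 X.obj) Y.obj

theorem d_coneIn {X Y : Tw C} (h : DGCategory.Hom X Y 0)
    (hh : DGCategory.d (zero_add 1) h = 0) : DGCategory.d (zero_add 1) (coneIn h hh) = 0 :=
  closed_of (X := Y) (Y := cone h hh) _ _ (Add.d_inr _ _) (Add.inr_block _ _ _).symm

/-- The projection `cone h → X[1]`. -/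
noncomputable def coneOut {X Y : Tw C} (h : DGCategory.Hom X Y 0)
    (hh : DGCategory.d (zero_add 1) h = 0) : DGCategory.Hom (cone h hh) (HasDGShift.sh 1 X) 0 :=
  Add.fst (HasDGShift.sh 1 X.obj) Y.obj

theorem d_coneOut {X Y : Tw C} (h : DGCategory.Hom X Y 0)
    (hh : DGCategory.d (zero_add 1) h = 0) : DGCategory.d (zero_add 1) (coneOut h hh) = 0 :=
  closed_of (X := cone h hh) (Y := HasDGShift.sh 1 X) _ _ (Add.d_fst _ _) (Add.block_fst _ _ _)

/-- The triangle `X → Y → cone h → X[1]`. -/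
noncomputable def coneTriangle {X Y : Tw C} (h : DGCategory.Hom X Y 0)
    (hh : DGCategory.d (zero_add 1) h = 0) : Triangle (H0 (Tw C)) :=
  Triangle.mk (H0.homMk h hh) (H0.homMk (coneIn h hh) (d_coneIn h hh))
    (show (⟨cone h hh⟩ : H0 (Tw C)) ⟶ (⟨X⟩ : H0 (Tw C))⟦(1 : ℤ)⟧ from
      H0.homMk (coneOut h hh) (d_coneOut h hh))

/-- The triangles which are isomorphic to the triangle of a cone. -/
def exactTriangles (C : Type u) [DGCategory C] [HasDGShift C] : Set (Triangle (H0 (Tw C))) :=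
  {T | ∃ (X Y : Tw C) (h : DGCategory.Hom X Y 0) (hh : DGCategory.d (zero_add 1) h = 0),
    Nonempty (T ≅ coneTriangle h hh)}

end Tw

/-! ### The Grothendieck group -/

section

universe v

variable (T : Type u) [Category.{v} T] [HasZeroObject T] [HasShift T ℤ] [Preadditive T]
  [∀ n : ℤ, (shiftFunctor T n).Additive] [Pretriangulated T]

/-- The Grothendieck group of a triangulated category: generators `[X]` for all objects, relations
`[Y] = [X] + [Z]` for all distinguished triangles `X → Y → Z → X[1]`. -/
def K0 : Type u :=
  FreeAbelianGroup T ⧸ AddSubgroup.closure {x : FreeAbelianGroup T | ∃ t ∈ distTriang T,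
    x = FreeAbelianGroup.of t.obj₂ - (FreeAbelianGroup.of t.obj₁ + FreeAbelianGroup.of t.obj₃)}

instance : AddCommGroup (K0 T) := inferInstanceAs (AddCommGroup (_ ⧸ _))

variable {T}

/-- The class of an object in the Grothendieck group. -/
def K0.of (X : T) : K0 T := QuotientAddGroup.mk (FreeAbelianGroup.of X)

end

/-! ### The category -/

/-- The additive monoidal DG category of formal direct sums of the objects `Q^k[m]`. -/
abbrev I' : Type 1 := Add Elem

/-- The monoidal DG category of one-sided twisted complexes over `I'`. -/
abbrev I : Type 1 := Tw I'

/-- The object `Q^k[m]` of `I'`. -/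
def I'.Q (k : ℕ) (m : ℤ) : I' := { ι := Unit, obj := fun _ => ⟨k, m⟩ }

/-- The generating object `Q` of `I`. -/
noncomputable def I.Q : I := Tw.ofObj (I'.Q 1 0)

/-- The object of `H0 I` given by an object of `I`. -/
def I.toH0 (X : I) : H0 I := ⟨X⟩

end SqrtNegOne

/-! Triangulated structure. In characteristic two there are no signs, so homogeneous morphisms of
all degrees can be computed with together, in a preadditive category `Tot` with a derivation `D`.
Distinguished triangles are described by explicit homotopies: in `IsExact` three closed morphisms of
total degree one have null-homotopic consecutive composites, and the three resulting secondary
composites are homotopic to identities. This notion is cyclically symmetric, so rotation is a cyclic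
permutation combined with a shift of one vertex. Morphisms of triangles are completed by a formula
(`IsExact.complete`), and an endomorphism of the third vertex compatible with its neighbours squares
to the identity (`IsExact.unipotent`). Hence an exact triangle is determined by its first morphism,
and being exact is the same as being isomorphic to a cone (`mem_exactTriangles_iff`). For the
octahedral axiom, the three cones are direct sums and every identity holds strictly
(`isExact_octahedron`).

The isomorphism `Q ⊗ Q ≅ 1[1]` is the cap, with the cup as inverse, by the handle slide and the loop
relation.

Generation of the Grothendieck group. A one-sided twisted complex is an iterated extension of its
components, so its class is the sum of the classes of the `Q^k[m]` in it (`cl_eq_sum`,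
`cl_ofObj_eq_sum`). Caps identify `Q^(k+2)[m]` with `Q^k[m+1]` and a shift changes the sign, so the
class of `Q^k[m]` is the image under `ψ` of `i^(k+2m)` (`cl_pow`).

Independence. The inverse of `ψ` is the Euler characteristic `χ`, the sum of `i^(k+2m)` over all
summands; what has to be shown is its invariance under isomorphism. The weight `k+2m` satisfies an
inequality along every diagram (`IsDiag.le`), with equality exactly when there are no half strands.
Discarding the diagrams with half strands is therefore compatible with composition, and yields
matrices over the field with two elements (`Elem.ε_comp`, `Add.mat_comp`). A contractible complex
gives matrices with `a² = 0` and `ab + ba = 1`. Then `a + bab` is an involution whose non-zero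
entries join weights differing by two, and a non-zero term of its determinant is a permutation of
the summands that negates every `i^(k+2m)`. So `χ = -χ`, and `χ = 0` (`χ_eq_zero_of_contractible`).
Applied to the cone of an isomorphism, this is the invariance of `χ`. As weights add under tensor
products, `χ` is multiplicative, and the ring structure is the one transported from the Gaussian
integers. -/

namespace SqrtNegOne

/-! ### The total category of a DG category -/

/-- The preadditive category with the same objects, whose morphisms are the finite sums of
homogeneous morphisms. -/
structure Tot (C : Type u) : Type u where
  of ::
  as : C

namespace Tot

variable {C : Type u} [DGCategory C]

/-- The sums of homogeneous morphisms. -/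
abbrev THom (X Y : C) : Type := DirectSum ℤ fun n => DGCategory.Hom X Y n

/-- Composition of sums of homogeneous morphisms. -/
noncomputable def tcomp (X Y Z : C) : THom X Y →+ THom Y Z →+ THom X Z :=
  DirectSum.toAddMonoid fun p => AddMonoidHom.flip <| DirectSum.toAddMonoid fun q =>
    AddMonoidHom.flip <| AddMonoidHom.mk' (fun f => AddMonoidHom.mk'
      (fun g => DirectSum.of (fun n => DGCategory.Hom X Z n) (p + q) (DGCategory.comp rfl f g))
      (fun g g' => by rw [map_add, map_add]))
      (fun f f' => by ext g; simp)

/-- The differential of a sum of homogeneous morphisms. -/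
noncomputable def tD (X Y : C) : THom X Y →+ THom X Y :=
  DirectSum.toAddMonoid fun p =>
    (DirectSum.of (fun n => DGCategory.Hom X Y n) (p + 1)).comp
      (DGCategory.d (rfl : p + 1 = p + 1)).toAddMonoidHom

/-- A homogeneous morphism as a sum of homogeneous morphisms. -/
noncomputable abbrev tof {X Y : C} {p : ℤ} (f : DGCategory.Hom X Y p) : THom X Y :=
  DirectSum.of (fun n => DGCategory.Hom X Y n) p f

theorem tcomp_of {X Y Z : C} {p q r : ℤ} (h : p + q = r) (f : DGCategory.Hom X Y p)
    (g : DGCategory.Hom Y Z q) : tcomp X Y Z (tof f) (tof g) = tof (DGCategory.comp h f g) := by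
  subst h
  simp [tcomp, tof]

theorem tD_of {X Y : C} {p q : ℤ} (h : p + 1 = q) (f : DGCategory.Hom X Y p) :
    tD X Y (tof f) = tof (DGCategory.d h f) := by
  subst h
  simp [tD, tof]

/-- No separate case for zero is needed, because zero is homogeneous (of degree zero, say). -/
theorem thom_induction {X Y : C} {P : THom X Y → Prop} (x : THom X Y)
    (h : ∀ (p : ℤ) (f : DGCategory.Hom X Y p), P (tof f)) (hadd : ∀ x y, P x → P y → P (x + y)) :
    P x := by
  induction x using DirectSum.induction_on with
  | zero => simpa [tof] using h 0 0
  | of p f => exact h p f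
  | add x y hx hy => exact hadd x y hx hy

noncomputable instance : Category (Tot C) where
  Hom X Y := THom X.as Y.as
  id X := tof (DGCategory.one X.as)
  comp f g := tcomp _ _ _ f g
  id_comp {X Y} f := by
    induction f using thom_induction with
    | h p f => rw [tcomp_of (zero_add p), DGCategory.id_comp]
    | hadd x y hx hy => rw [map_add, hx, hy]
  comp_id {X Y} f := by
    induction f using thom_induction with
    | h p f => rw [tcomp_of (add_zero p), DGCategory.comp_id]
    | hadd x y hx hy => rw [map_add, AddMonoidHom.add_apply, hx, hy]
  assoc {W X Y Z} f g h := by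
    induction f using thom_induction with
    | hadd x y hx hy => simp only [map_add, AddMonoidHom.add_apply, hx, hy]
    | h p f =>
    induction g using thom_induction with
    | hadd x y hx hy => simp only [map_add, AddMonoidHom.add_apply, hx, hy]
    | h q g =>
    induction h using thom_induction with
    | hadd x y hx hy => simp only [map_add, hx, hy]
    | h r h =>
      rw [tcomp_of rfl, tcomp_of rfl, tcomp_of rfl, tcomp_of (add_assoc p q r).symm]
      exact congrArg tof (DGCategory.assoc _ _ _ _ f g h)

noncomputable instance : Preadditive (Tot C) where
  homGroup X Y := inferInstanceAs (AddCommGroup (THom X.as Y.as))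
  add_comp X Y Z f f' g := congrArg (fun k : THom Y.as Z.as →+ THom X.as Z.as => k g)
    ((tcomp X.as Y.as Z.as).map_add f f')
  comp_add X Y Z f g g' := (tcomp X.as Y.as Z.as f).map_add g g'

/-- The differential. -/
noncomputable def D {X Y : Tot C} : (X ⟶ Y) →+ (X ⟶ Y) := tD X.as Y.as

/-- A homogeneous morphism as a morphism of the total category. -/
noncomputable def hom {X Y : C} {p : ℤ} (f : DGCategory.Hom X Y p) : (of X : Tot C) ⟶ of Y :=
  tof f

/-- Each degree embeds in the direct sum, so identities of homogeneous morphisms may be checked in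
`Tot`, where no equations between degrees have to be carried along. -/
theorem hom_inj {X Y : C} {p : ℤ} {f g : DGCategory.Hom X Y p} (h : hom f = hom g) : f = g :=
  DirectSum.of_injective (β := fun n => DGCategory.Hom X Y n) p h

theorem hom_comp {X Y Z : C} {p q r : ℤ} (h : p + q = r) (f : DGCategory.Hom X Y p)
    (g : DGCategory.Hom Y Z q) : hom (DGCategory.comp h f g) = hom f ≫ hom g :=
  (tcomp_of h f g).symm

theorem hom_d {X Y : C} {p q : ℤ} (h : p + 1 = q) (f : DGCategory.Hom X Y p) :
    hom (DGCategory.d h f) = D (hom f) := (tD_of h f).symm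

theorem hom_one (X : C) : hom (DGCategory.one X) = 𝟙 (of X) := rfl

theorem hom_add {X Y : C} {p : ℤ} (f g : DGCategory.Hom X Y p) : hom (f + g) = hom f + hom g :=
  (DirectSum.of (fun n => DGCategory.Hom X Y n) p).map_add f g

theorem hom_zero {X Y : C} {p : ℤ} : hom (0 : DGCategory.Hom X Y p) = 0 :=
  (DirectSum.of (fun n => DGCategory.Hom X Y n) p).map_zero

theorem hom_induction {X Y : Tot C} {P : (X ⟶ Y) → Prop} (x : X ⟶ Y)
    (h : ∀ (p : ℤ) (f : DGCategory.Hom X.as Y.as p), P (hom f))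
    (hadd : ∀ x y, P x → P y → P (x + y)) : P x :=
  thom_induction x h hadd

theorem add_self {X Y : Tot C} (x : X ⟶ Y) : x + x = 0 := by
  induction x using hom_induction with
  | h p f => rw [← hom_add, DGCategory.add_self, hom_zero]
  | hadd x y hx hy => rw [add_add_add_comm, hx, hy, add_zero]

theorem add_add_cancel {X Y : Tot C} (x y : X ⟶ Y) : x + (x + y) = y := by
  rw [← add_assoc, add_self, zero_add]

theorem neg_eq {X Y : Tot C} (x : X ⟶ Y) : -x = x :=
  neg_eq_of_add_eq_zero_left (add_self x)

theorem add_eq_zero_iff {X Y : Tot C} {x y : X ⟶ Y} : x + y = 0 ↔ x = y := by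
  rw [add_eq_zero_iff_eq_neg, neg_eq]

theorem eq_of_add {X Y : Tot C} {x y : X ⟶ Y} (h : x + y = 0) : x = y := add_eq_zero_iff.mp h

/-- Used after `abel_nf`, which collects equal terms into multiples by two. -/
theorem two_zsmul_eq {X Y : Tot C} (x : X ⟶ Y) : (2 : ℤ) • x = 0 := by
  rw [two_zsmul, add_self]

theorem D_comp {X Y Z : Tot C} (x : X ⟶ Y) (y : Y ⟶ Z) : D (x ≫ y) = D x ≫ y + x ≫ D y := by
  induction x using hom_induction with
  | hadd x x' hx hx' => simp only [Preadditive.add_comp, map_add, hx, hx']; abel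
  | h p f =>
  induction y using hom_induction with
  | hadd x x' hx hx' => simp only [Preadditive.comp_add, map_add, hx, hx']; abel
  | h q g =>
    rw [← hom_d rfl, ← hom_d rfl]
    refine Eq.trans ?_ (congrArg₂ (· + ·) (hom_comp (add_right_comm p 1 q) _ _)
      (hom_comp (add_assoc p q 1).symm _ _))
    rw [← hom_add, ← DGCategory.d_comp rfl, hom_d, hom_comp]
    rfl

theorem D_id (X : Tot C) : D (𝟙 X) = 0 := by
  have h := D_comp (𝟙 X) (𝟙 X)
  simpa using h

/-- The homogeneous morphisms of degree `n`. -/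
def IsDeg (n : ℤ) {X Y : Tot C} (x : X ⟶ Y) : Prop :=
  ∃ f : DGCategory.Hom X.as Y.as n, hom f = x

theorem isDeg_hom {X Y : C} {n : ℤ} (f : DGCategory.Hom X Y n) : IsDeg n (hom f) := ⟨f, rfl⟩

theorem isDeg_id (X : Tot C) : IsDeg 0 (𝟙 X) := ⟨_, rfl⟩

theorem isDeg_zero (n : ℤ) (X Y : Tot C) : IsDeg n (0 : X ⟶ Y) := ⟨0, hom_zero⟩

theorem IsDeg.comp {X Y Z : Tot C} {p q r : ℤ} {x : X ⟶ Y} {y : Y ⟶ Z} (hx : IsDeg p x)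
    (hy : IsDeg q y) (h : p + q = r := by omega) : IsDeg r (x ≫ y) := by
  obtain ⟨f, rfl⟩ := hx
  obtain ⟨g, rfl⟩ := hy
  exact ⟨DGCategory.comp h f g, hom_comp h f g⟩

theorem IsDeg.add {X Y : Tot C} {p : ℤ} {x y : X ⟶ Y} (hx : IsDeg p x) (hy : IsDeg p y) :
    IsDeg p (x + y) := by
  obtain ⟨f, rfl⟩ := hx
  obtain ⟨g, rfl⟩ := hy
  exact ⟨f + g, hom_add f g⟩

theorem IsDeg.cast {X Y : Tot C} {p q : ℤ} {x : X ⟶ Y} (hx : IsDeg p x)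
    (h : p = q := by omega) : IsDeg q x := h ▸ hx

/-- The two morphisms differ by the differential of a morphism of degree `-1`. -/
def Htpy {X Y : Tot C} (x y : X ⟶ Y) : Prop :=
  ∃ η : X ⟶ Y, IsDeg (-1) η ∧ D η = x + y

theorem Htpy.of_eq {X Y : Tot C} {x y : X ⟶ Y} (h : x = y) : Htpy x y :=
  ⟨0, isDeg_zero _ _ _, by rw [map_zero, h, add_self]⟩

theorem Htpy.trans {X Y : Tot C} {x y z : X ⟶ Y} (h : Htpy x y) (h' : Htpy y z) : Htpy x z := by
  obtain ⟨η, h, e⟩ := h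
  obtain ⟨η', h', e'⟩ := h'
  refine ⟨η + η', h.add h', ?_⟩
  rw [map_add, e, e', add_assoc, add_add_cancel]

/-- Adding the differential of a morphism of degree `-1`. -/
theorem Htpy.of_D {X Y : Tot C} {x y : X ⟶ Y} (η : X ⟶ Y) (h : IsDeg (-1) η)
    (e : D η = x + y) : Htpy x y := ⟨η, h, e⟩

/-- Composition with closed morphisms commutes with `D`. Only the sum of the two degrees has to
vanish, so that the shift morphisms of degrees `-1` and `1` are allowed. -/
theorem Htpy.whisker {W X Y Z : Tot C} {x y : X ⟶ Y} (h : Htpy x y) {w : W ⟶ X} {z : Y ⟶ Z}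
    {p q : ℤ} (hw : IsDeg p w) (hz : IsDeg q z) (dw : D w = 0) (dz : D z = 0)
    (hpq : p + q = 0 := by omega) : Htpy (w ≫ x ≫ z) (w ≫ y ≫ z) := by
  obtain ⟨η, h, e⟩ := h
  refine ⟨w ≫ η ≫ z, hw.comp (h.comp hz rfl), ?_⟩
  simp [D_comp, dw, dz, e]

end Tot
end SqrtNegOne

namespace SqrtNegOne

namespace Tot

variable {C : Type u} [DGCategory C]

/-! ### Exact triples -/

/-- A triple of closed morphisms `f : X → Y`, `g : Y → Z`, `h : Z → X` of degrees `p`, `q`, `r` with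
`p + q + r = 1`, whose composites are null-homotopic by homotopies `a`, `b`, `c` such that
the three secondary composites are homotopic to identities. -/
structure IsExact {X Y Z : Tot C} (p q r : ℤ) (f : X ⟶ Y) (g : Y ⟶ Z) (h : Z ⟶ X) : Prop where
  sum : p + q + r = 1
  deg₁ : IsDeg p f
  deg₂ : IsDeg q g
  deg₃ : IsDeg r h
  closed₁ : D f = 0
  closed₂ : D g = 0
  closed₃ : D h = 0
  homotopies : ∃ (a : X ⟶ Z) (b : Z ⟶ Y) (c : Y ⟶ X),
    (IsDeg (p + q - 1) a ∧ IsDeg (r + p - 1) b ∧ IsDeg (q + r - 1) c) ∧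
    (D a = f ≫ g ∧ D b = h ≫ f ∧ D c = g ≫ h) ∧
    Htpy (a ≫ h + f ≫ c) (𝟙 X) ∧ Htpy (c ≫ f + g ≫ b) (𝟙 Y) ∧ Htpy (b ≫ g + h ≫ a) (𝟙 Z)

variable {X Y Z : Tot C} {p q r : ℤ} {f : X ⟶ Y} {g : Y ⟶ Z} {h : Z ⟶ X}

/-- The definition is invariant under cyclic permutation; the homotopies `a`, `b`, `c` become `c`,
`a`, `b`. -/
theorem IsExact.cyc (H : IsExact p q r f g h) : IsExact q r p g h f := by
  obtain ⟨hs, h₁, h₂, h₃, d₁, d₂, d₃, a, b, c, ⟨ha, hb, hc⟩, ⟨da, db, dc⟩, e₁, e₂, e₃⟩ := H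
  exact ⟨by omega, h₂, h₃, h₁, d₂, d₃, d₁, c, a, b, ⟨hc, ha, hb⟩, ⟨dc, da, db⟩, e₂, e₃, e₁⟩

/-- Replacing the first vertex by a homotopy equivalent one, up to a shift. -/
theorem IsExact.transport₁ (H : IsExact p q r f g h) {X' : Tot C} {n m : ℤ} {α : X' ⟶ X}
    {β : X ⟶ X'} (hα : IsDeg n α) (hβ : IsDeg m β) (hnm : n + m = 0) (dα : D α = 0)
    (dβ : D β = 0) (e : Htpy (α ≫ β) (𝟙 X')) (e' : Htpy (β ≫ α) (𝟙 X)) :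
    IsExact (n + p) q (r + m) (α ≫ f) g (h ≫ β) := by
  obtain ⟨hs, h₁, h₂, h₃, d₁, d₂, d₃, a, b, c, ⟨ha, hb, hc⟩, ⟨da, db, dc⟩, e₁, e₂, e₃⟩ := H
  obtain ⟨η, hη, dη⟩ := e'
  -- The composite through the new vertex is `h ≫ β ≫ α ≫ f` instead of `h ≫ f`. With `D η = β ≫ α +
  -- 𝟙`, the difference is `D (h ≫ η ≫ f)`, which explains the correction of `b`. The last two
  -- secondary composites then differ from the old ones by the differentials of `c ≫ η ≫ f` and `h ≫
  -- η ≫ a`.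
  refine ⟨by omega, hα.comp h₁, h₂, h₃.comp hβ, by simp [D_comp, dα, d₁], d₂,
    by simp [D_comp, dβ, d₃], α ≫ a, b + h ≫ η ≫ f, c ≫ β,
    ⟨hα.comp ha, (hb.cast).add ((h₃.comp (hη.comp h₁ rfl))), hc.comp hβ⟩,
    ⟨?_, ?_, ?_⟩, ?_, ?_, ?_⟩
  · simp [D_comp, dα, da]
  · simp [D_comp, db, d₁, d₃, dη, add_comm, add_add_cancel]
  · simp [D_comp, dβ, dc]
  · refine Htpy.trans (Htpy.of_eq ?_) ((e₁.whisker hα hβ dα dβ).trans ?_)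
    · simp
    · simpa using e
  · refine Htpy.trans (Htpy.of_D (c ≫ η ≫ f) (hc.comp (hη.comp h₁ rfl)) ?_) e₂
    simp [D_comp, d₁, dc, dη]
    abel_nf
    simp [two_zsmul_eq]
  · refine Htpy.trans (Htpy.of_D (h ≫ η ≫ a) (h₃.comp (hη.comp ha rfl)) ?_) e₃
    simp [D_comp, d₃, da, dη]
    abel_nf
    simp [two_zsmul_eq]

theorem IsExact.cast (H : IsExact p q r f g h) {p' q' r' : ℤ} {f' : X ⟶ Y} {g' : Y ⟶ Z}
    {h' : Z ⟶ X} (hp : p = p' := by omega) (hq : q = q' := by omega) (hr : r = r' := by omega)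
    (hf : f = f' := by simp) (hg : g = g' := by simp) (hh : h = h' := by simp) :
    IsExact p' q' r' f' g' h' := by
  subst hp hq hr hf hg hh; exact H

/-- Replacing all vertices by homotopy equivalent ones. -/
theorem IsExact.transport (H : IsExact p q r f g h) {X' Y' Z' : Tot C}
    {α : X' ⟶ X} {α' : X ⟶ X'} {β : Y' ⟶ Y} {β' : Y ⟶ Y'} {γ : Z' ⟶ Z} {γ' : Z ⟶ Z'}
    (hα : IsDeg 0 α) (hα' : IsDeg 0 α') (hβ : IsDeg 0 β) (hβ' : IsDeg 0 β') (hγ : IsDeg 0 γ)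
    (hγ' : IsDeg 0 γ') (dα : D α = 0) (dα' : D α' = 0) (dβ : D β = 0) (dβ' : D β' = 0)
    (dγ : D γ = 0) (dγ' : D γ' = 0) (e₁ : Htpy (α ≫ α') (𝟙 X')) (e₁' : Htpy (α' ≫ α) (𝟙 X))
    (e₂ : Htpy (β ≫ β') (𝟙 Y')) (e₂' : Htpy (β' ≫ β) (𝟙 Y)) (e₃ : Htpy (γ ≫ γ') (𝟙 Z'))
    (e₃' : Htpy (γ' ≫ γ) (𝟙 Z)) :
    IsExact p q r (α ≫ f ≫ β') (β ≫ g ≫ γ') (γ ≫ h ≫ α') :=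
  (((((H.transport₁ hα hα' (add_zero 0) dα dα' e₁ e₁').cyc.transport₁ hβ hβ' (add_zero 0) dβ dβ' e₂
    e₂').cyc.transport₁ hγ hγ' (add_zero 0) dγ dγ' e₃ e₃').cyc).cast)

/-- A morphism of the first two vertices of exact triples which commutes with the first morphisms
up to homotopy extends to the third vertices. -/
theorem IsExact.complete (H : IsExact p q r f g h) {X' Y' Z' : Tot C} {f' : X' ⟶ Y'}
    {g' : Y' ⟶ Z'} {h' : Z' ⟶ X'} (H' : IsExact p q r f' g' h') {α : X ⟶ X'} {β : Y ⟶ Y'}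
    (hα : IsDeg 0 α) (hβ : IsDeg 0 β) (dα : D α = 0) (dβ : D β = 0)
    (e : ∃ ξ : X ⟶ Y', IsDeg (p - 1) ξ ∧ D ξ = f ≫ β + α ≫ f') :
    ∃ γ : Z ⟶ Z', IsDeg 0 γ ∧ D γ = 0 ∧
      (∃ ζ : Y ⟶ Z', IsDeg (q - 1) ζ ∧ D ζ = g ≫ γ + β ≫ g') ∧
      (∃ ζ : Z ⟶ X', IsDeg (r - 1) ζ ∧ D ζ = h ≫ α + γ ≫ h') := by
  obtain ⟨hs, h₁, h₂, h₃, d₁, d₂, d₃, a, b, c, ⟨ha, hb, hc⟩, ⟨da, db, dc⟩, -, ⟨η, hη, dη⟩, -⟩ := H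
  obtain ⟨-, h₁', h₂', h₃', d₁', d₂', d₃', a', b', c', ⟨ha', hb', hc'⟩, ⟨da', db', dc'⟩,
    ⟨θ, hθ, dθ⟩, -⟩ := H'
  obtain ⟨ξ, hξ, dξ⟩ := e
  -- There are two routes from `Z` to `Z'`, through `X` with the null-homotopy `a'` and through `Y`
  -- with the null-homotopy `b`. Their differentials `h ≫ α ≫ f' ≫ g'` and `h ≫ f ≫ β ≫ g'` are
  -- matched by the term with `ξ`, so the sum is closed. The homotopies for the two squares use `η :
  -- c ≫ f + g ≫ b ~ 𝟙 Y` and `θ : a' ≫ h' + f' ≫ c' ~ 𝟙 X'`.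
  refine ⟨h ≫ α ≫ a' + b ≫ β ≫ g' + h ≫ ξ ≫ g', ?_, ?_,
    ⟨c ≫ α ≫ a' + c ≫ ξ ≫ g' + η ≫ β ≫ g', ?_, ?_⟩,
    ⟨b ≫ β ≫ c' + h ≫ ξ ≫ c' + h ≫ α ≫ θ, ?_, ?_⟩⟩
  · exact ((h₃.comp (hα.comp ha' rfl)).add (hb.comp (hβ.comp h₂' rfl))).add
      (h₃.comp (hξ.comp h₂' rfl))
  · simp [D_comp, d₃, dα, da', db, dβ, d₂', dξ]
    abel_nf
    simp [two_zsmul_eq]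
  · exact ((hc.comp (hα.comp ha' rfl)).add (hc.comp (hξ.comp h₂' rfl))).add
      (hη.comp (hβ.comp h₂' rfl))
  · have hD : D (c ≫ α ≫ a' + c ≫ ξ ≫ g' + η ≫ β ≫ g') = g ≫ (h ≫ α ≫ a' + h ≫ ξ ≫ g') +
        c ≫ (α ≫ f' ≫ g' + (f ≫ β + α ≫ f') ≫ g') + (c ≫ f + g ≫ b + 𝟙 Y) ≫ β ≫ g' := by
      simp only [map_add, D_comp, dα, dβ, d₂', da', dξ, dc, dη, zero_comp, comp_zero, add_zero,
        zero_add, Category.assoc, Preadditive.add_comp, Preadditive.comp_add]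
      abel
    rw [hD]
    apply eq_of_add
    simp
    abel_nf
    simp [two_zsmul_eq]
  · exact ((hb.comp (hβ.comp hc' rfl)).add (h₃.comp (hξ.comp hc' rfl))).add
      (h₃.comp (hα.comp hθ rfl))
  · apply eq_of_add
    simp [D_comp, dα, dβ, d₃, dc', dξ, db, dθ]
    abel_nf
    simp [two_zsmul_eq]

/-- The third morphism of an exact triple is a weak cokernel. -/
theorem IsExact.weak_cokernel (H : IsExact p q r f g h) {W : Tot C} {u : Z ⟶ W} (hu : IsDeg 0 u)
    (du : D u = 0) (e : ∃ ξ : Y ⟶ W, IsDeg (q - 1) ξ ∧ D ξ = g ≫ u) :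
    ∃ v : X ⟶ W, IsDeg (-r) v ∧ D v = 0 ∧ Htpy u (h ≫ v) := by
  obtain ⟨hs, h₁, h₂, h₃, d₁, d₂, d₃, a, b, c, ⟨ha, hb, hc⟩, ⟨da, db, dc⟩, -, -, ⟨η, hη, dη⟩⟩ := H
  obtain ⟨ξ, hξ, dξ⟩ := e
  -- Both summands of `v` have differential `f ≫ g ≫ u`, so their sum is closed.
  refine ⟨f ≫ ξ + a ≫ u, (h₁.comp hξ).add (ha.comp hu), ?_, η ≫ u + b ≫ ξ,
    (hη.comp hu).add (hb.comp hξ), ?_⟩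
  · simp [D_comp, d₁, dξ, da, du, add_self]
  · simp [D_comp, dη, du, dξ, db]
    abel_nf
    simp [two_zsmul_eq]

/-- An endomorphism of the third vertex of an exact triple which commutes with the adjacent
morphisms up to homotopy is unipotent up to homotopy. -/
theorem IsExact.unipotent (H : IsExact p q r f g h) {e : Z ⟶ Z} (he : IsDeg 0 e) (de : D e = 0)
    (e₁ : ∃ ξ : Y ⟶ Z, IsDeg (q - 1) ξ ∧ D ξ = g ≫ e + g)
    (e₂ : ∃ ξ : Z ⟶ X, IsDeg (r - 1) ξ ∧ D ξ = e ≫ h + h) : Htpy (e ≫ e) (𝟙 Z) := by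
  -- As `g ≫ (e + 𝟙) ~ 0`, the morphism `e + 𝟙` factors up to homotopy as `h ≫ v`. As `(e + 𝟙) ≫ h ~
  -- 0`, its square is null-homotopic, and in characteristic two this square is `e ≫ e + 𝟙`.
  obtain ⟨v, hv, dv, k, hk, dk⟩ := H.weak_cokernel (u := e + 𝟙 Z) (he.add (isDeg_id _))
    (by simp [de, D_id]) (by simpa using e₁)
  obtain ⟨ξ, hξ, dξ⟩ := e₂
  refine ⟨(e + 𝟙 Z) ≫ k + ξ ≫ v, ((he.add (isDeg_id _)).comp hk rfl).add (hξ.comp hv), ?_⟩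
  simp [D_comp, de, dk, dξ, dv]
  abel_nf
  simp [two_zsmul_eq]

/-! ### Cones as direct sum decompositions, and the octahedral axiom. -/

/-- A closed morphism `k : X → Y` of degree `n` and a decomposition of `E` as a direct sum of `X` and
`Y` whose inclusions and projections are closed up to `k`. -/
structure IsSplit {X Y E : Tot C} (n m : ℤ) (k : X ⟶ Y) (inl : X ⟶ E) (inr : Y ⟶ E) (fst : E ⟶ X)
    (snd : E ⟶ Y) : Prop where
  sum : n + m = 1
  deg : IsDeg n k
  closed : D k = 0
  deg_inl : IsDeg (n - 1) inl
  deg_inr : IsDeg 0 inr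
  deg_fst : IsDeg m fst
  deg_snd : IsDeg 0 snd
  D_inl : D inl = k ≫ inr
  D_inr : D inr = 0
  D_fst : D fst = 0
  D_snd : D snd = fst ≫ k
  inl_fst : inl ≫ fst = 𝟙 X
  inr_snd : inr ≫ snd = 𝟙 Y
  inl_snd : inl ≫ snd = 0
  inr_fst : inr ≫ fst = 0
  total : snd ≫ inr + fst ≫ inl = 𝟙 E

variable {E : Tot C} {n m : ℤ} {k : X ⟶ Y} {inl : X ⟶ E} {inr : Y ⟶ E} {fst : E ⟶ X} {snd : E ⟶ Y}

/-- The null-homotopies are `inl`, `snd` and `0`, and the secondary composites are identities on the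
nose by the relations of the decomposition. -/
theorem IsSplit.isExact (H : IsSplit n m k inl inr fst snd) : IsExact n 0 m k inr fst := by
  obtain ⟨hn, hk, dk, h₁, h₂, h₃, h₄, d₁, d₂, d₃, d₄, e₁, e₂, -, e₃, e₄⟩ := H
  refine ⟨by omega, hk, h₂, h₃, dk, d₂, d₃, inl, snd, 0, ⟨h₁.cast, h₄.cast, isDeg_zero _ _ _⟩,
    ⟨d₁, d₄, by simp [e₃]⟩, .of_eq ?_, .of_eq ?_, .of_eq ?_⟩
  · simp [e₁]
  · simp [e₂]
  · exact e₄

/-- Replacing the first summand by a shift of it. -/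
theorem IsSplit.transport₁ (H : IsSplit n m k inl inr fst snd) {X' : Tot C} {a b : ℤ} {α : X' ⟶ X}
    {β : X ⟶ X'} (hα : IsDeg a α) (hβ : IsDeg b β) (hab : a + b = 0) (dα : D α = 0) (dβ : D β = 0)
    (e : α ≫ β = 𝟙 X') (e' : β ≫ α = 𝟙 X) :
    IsSplit (a + n) (m + b) (α ≫ k) (α ≫ inl) inr (fst ≫ β) snd := by
  obtain ⟨hn, hk, dk, h₁, h₂, h₃, h₄, d₁, d₂, d₃, d₄, e₁, e₂, e₃, e₄, e₅⟩ := H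
  refine ⟨by omega, hα.comp hk, by simp [D_comp, dα, dk], hα.comp h₁, h₂, h₃.comp hβ, h₄,
    by simp [D_comp, dα, d₁], d₂, by simp [D_comp, dβ, d₃], ?_, ?_, e₂, ?_, ?_, ?_⟩
  · rw [d₄, Category.assoc, ← Category.assoc β, e', Category.id_comp]
  · rw [Category.assoc, ← Category.assoc inl, e₁, Category.id_comp, e]
  · rw [Category.assoc, e₃, comp_zero]
  · rw [← Category.assoc, e₄, zero_comp]
  · rw [Category.assoc, ← Category.assoc β, e', Category.id_comp, e₅]

/-- The octahedral axiom for the cones of `f`, `g` and `f ≫ g`. -/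
theorem isExact_octahedron {X Y Z A B E : Tot C} {f : X ⟶ Y} {g : Y ⟶ Z} {i : X ⟶ A} {j : Y ⟶ A}
    {p : A ⟶ X} {q : A ⟶ Y} {i' : Y ⟶ B} {j' : Z ⟶ B} {p' : B ⟶ Y} {q' : B ⟶ Z} {i'' : X ⟶ E}
    {j'' : Z ⟶ E} {p'' : E ⟶ X} {q'' : E ⟶ Z} (H : IsSplit 0 1 f i j p q)
    (H' : IsSplit 0 1 g i' j' p' q') (H'' : IsSplit 0 1 (f ≫ g) i'' j'' p'' q'') :
    IsExact 0 0 1 (p ≫ i'' + q ≫ g ≫ j'') (p'' ≫ f ≫ i' + q'' ≫ j') (p' ≫ j) ∧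
      j ≫ (p ≫ i'' + q ≫ g ≫ j'') = g ≫ j'' ∧ (p ≫ i'' + q ≫ g ≫ j'') ≫ p'' = p ∧
      j'' ≫ (p'' ≫ f ≫ i' + q'' ≫ j') = j' ∧
      p'' ≫ f = (p'' ≫ f ≫ i' + q'' ≫ j') ≫ p' := by
  obtain ⟨-, hf, df, hi, hj, hp, hq, di, dj, dp, dq, ip, jq, iq, jp, pi⟩ := H
  obtain ⟨-, hg, dg, hi', hj', hp', hq', di', dj', dp', dq', ip', jq', iq', jp', pi'⟩ := H'
  obtain ⟨-, -, -, hi'', hj'', hp'', hq'', di'', dj'', dp'', dq'', ip'', jq'', iq'', jp'', pi''⟩ := H''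
  -- The relations of the three decompositions, in the form in which `simp` can use them inside
  -- right-associated composites.
  have c₁ {W : Tot C} (x : X ⟶ W) : i'' ≫ p'' ≫ x = x := by rw [← Category.assoc, ip'', Category.id_comp]
  have c₂ {W : Tot C} (x : Z ⟶ W) : i'' ≫ q'' ≫ x = 0 := by rw [← Category.assoc, iq'', zero_comp]
  have c₃ {W : Tot C} (x : X ⟶ W) : j'' ≫ p'' ≫ x = 0 := by rw [← Category.assoc, jp'', zero_comp]
  have c₄ {W : Tot C} (x : Z ⟶ W) : j'' ≫ q'' ≫ x = x := by rw [← Category.assoc, jq'', Category.id_comp]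
  have b₁ {W : Tot C} (x : Y ⟶ W) : i' ≫ p' ≫ x = x := by rw [← Category.assoc, ip', Category.id_comp]
  have b₂ {W : Tot C} (x : Z ⟶ W) : i' ≫ q' ≫ x = 0 := by rw [← Category.assoc, iq', zero_comp]
  have b₃ {W : Tot C} (x : Y ⟶ W) : j' ≫ p' ≫ x = 0 := by rw [← Category.assoc, jp', zero_comp]
  have b₄ {W : Tot C} (x : Z ⟶ W) : j' ≫ q' ≫ x = x := by rw [← Category.assoc, jq', Category.id_comp]
  have a₁ {W : Tot C} (x : X ⟶ W) : i ≫ p ≫ x = x := by rw [← Category.assoc, ip, Category.id_comp]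
  have a₂ {W : Tot C} (x : Y ⟶ W) : i ≫ q ≫ x = 0 := by rw [← Category.assoc, iq, zero_comp]
  have a₃ {W : Tot C} (x : X ⟶ W) : j ≫ p ≫ x = 0 := by rw [← Category.assoc, jp, zero_comp]
  have a₄ {W : Tot C} (x : Y ⟶ W) : j ≫ q ≫ x = x := by rw [← Category.assoc, jq, Category.id_comp]
  refine ⟨?_, by simp [a₃, a₄], by simp [ip'', jp''], by simp [c₃, c₄], by simp [ip', jp']⟩
  -- The morphisms `A → E → B` are induced by `𝟙 X` and `g`, and by `f` and `𝟙 Z`. The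
  -- null-homotopies `q ≫ i'`, `q' ≫ j''` and `p'' ≫ i` pass through the common summands `Y`, `Z`
  -- and `X`, and make all three secondary composites equal to identities.
  refine ⟨rfl, (hp.comp hi'').add (hq.comp (hg.comp hj'' rfl)),
    (hp''.comp (hf.comp hi' rfl)).add (hq''.comp hj'), hp'.comp hj, ?_, ?_, ?_, q ≫ i', q' ≫ j'',
    p'' ≫ i, ⟨hq.comp hi', hq'.comp hj'', hp''.comp hi⟩, ⟨?_, ?_, ?_⟩, .of_eq ?_, .of_eq ?_,
    .of_eq ?_⟩
  · simp [D_comp, dp, di'', dq, dg, dj'', add_self]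
  · simp [D_comp, dp'', df, di', dq'', dj', add_self]
  · simp [D_comp, dp', dj]
  · simp [D_comp, dq, di', c₁, c₂, c₃, c₄]
  · simp [D_comp, dq', dj'', a₃, a₄]
  · simp [D_comp, dp'', di, b₁, b₃]
  · simp [b₁, c₁, c₃, ← pi, add_comm]
  · simp [a₁, a₂, b₂, b₄, ← pi'', add_comm]
  · simp [a₄, c₃, c₄, ← pi', add_comm]

end Tot
end SqrtNegOne

namespace SqrtNegOne

open Tot

namespace H0

variable {C : Type u} [DGCategory C]

/-! ### Representatives of morphisms of the zeroth cohomology category -/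

/-- The object as an object of the total category. -/
abbrev tot (X : H0 C) : Tot C := ⟨X.as⟩

/-- The closed morphism `x` of degree zero represents the morphism `u`. -/
def Rep {X Y : H0 C} (u : X ⟶ Y) (x : tot X ⟶ tot Y) : Prop :=
  ∃ (f : DGCategory.Hom X.as Y.as 0) (hf : DGCategory.d (zero_add 1) f = 0),
    homMk f hf = u ∧ Tot.hom f = x

/-- The quotient is defined by differences and `Htpy` by sums; these agree in characteristic two. -/
theorem homMk_eq_iff {X Y : C} {f g : DGCategory.Hom X Y 0} (hf hg) :
    homMk f hf = homMk g hg ↔ Htpy (Tot.hom f) (Tot.hom g) := by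
  refine (Submodule.Quotient.eq _).trans ⟨?_, ?_⟩
  · rintro ⟨η, hη⟩
    refine ⟨Tot.hom η, isDeg_hom η, ?_⟩
    rw [← hom_d (neg_add_cancel 1), hη, ← hom_add]
    refine congrArg Tot.hom ((sub_eq_add_neg _ _).trans (congrArg (f + ·) ?_))
    exact neg_eq_of_add_eq_zero_left (DGCategory.add_self g)
  · rintro ⟨_, ⟨η, rfl⟩, hη⟩
    refine ⟨η, ?_⟩
    rw [← hom_d (neg_add_cancel 1), ← hom_add] at hη
    refine (hom_inj hη).trans (Eq.symm ((sub_eq_add_neg _ _).trans (congrArg (f + ·) ?_)))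
    exact neg_eq_of_add_eq_zero_left (DGCategory.add_self g)

variable {X Y W : H0 C}

theorem exists_rep (u : X ⟶ Y) : ∃ x, Rep u x := by
  obtain ⟨f, hf, rfl⟩ := homMk_surjective u
  exact ⟨_, f, hf, rfl, rfl⟩

theorem rep_homMk {X Y : C} (f : DGCategory.Hom X Y 0) (hf : DGCategory.d (zero_add 1) f = 0) :
    Rep (homMk f hf) (Tot.hom f) := ⟨f, hf, rfl, rfl⟩

theorem exists_of_closed {x : tot X ⟶ tot Y} (hx : IsDeg 0 x) (dx : D x = 0) :
    ∃ u : X ⟶ Y, Rep u x := by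
  obtain ⟨f, rfl⟩ := hx
  rw [← hom_d (zero_add 1)] at dx
  exact ⟨_, f, hom_inj (dx.trans hom_zero.symm), rfl, rfl⟩

theorem Rep.isDeg {u : X ⟶ Y} {x} (h : Rep u x) : IsDeg 0 x := by
  obtain ⟨f, hf, rfl, rfl⟩ := h
  exact isDeg_hom f

theorem Rep.closed {u : X ⟶ Y} {x} (h : Rep u x) : D x = 0 := by
  obtain ⟨f, hf, rfl, rfl⟩ := h
  rw [← hom_d (zero_add 1), hf, hom_zero]

theorem Rep.eq_iff {u v : X ⟶ Y} {x y} (h : Rep u x) (h' : Rep v y) : u = v ↔ Htpy x y := by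
  obtain ⟨f, hf, rfl, rfl⟩ := h
  obtain ⟨g, hg, rfl, rfl⟩ := h'
  exact homMk_eq_iff hf hg

theorem Rep.of_htpy {u : X ⟶ Y} {x y} (h : Rep u x) (hy : IsDeg 0 y) (dy : D y = 0)
    (e : Htpy x y) : Rep u y := by
  obtain ⟨v, hv⟩ := exists_of_closed hy dy
  exact (h.eq_iff hv).mpr e ▸ hv

theorem Rep.comp {u : X ⟶ Y} {v : Y ⟶ W} {x y} (h : Rep u x) (h' : Rep v y) :
    Rep (u ≫ v) (x ≫ y) := by
  obtain ⟨f, hf, rfl, rfl⟩ := h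
  obtain ⟨g, hg, rfl, rfl⟩ := h'
  exact ⟨_, closed_comp hf hg, rfl, hom_comp _ f g⟩

theorem rep_id (X : H0 C) : Rep (𝟙 X) (𝟙 (tot X)) := ⟨_, DGCategory.d_id _ _, rfl, rfl⟩

theorem rep_zero (X Y : H0 C) : Rep (0 : X ⟶ Y) 0 := ⟨0, map_zero _, rfl, hom_zero⟩

/-- This removes the sign from the rotation axiom. -/
theorem neg_eq (u : X ⟶ Y) : -u = u := by
  obtain ⟨f, hf, rfl⟩ := homMk_surjective u
  refine neg_eq_of_add_eq_zero_left ?_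
  exact cls_eq (hf := (Z _ _).add_mem hf hf) (hg := (Z _ _).zero_mem) (DGCategory.add_self f)

/-! The shift -/

variable [HasDGShift C]

/-- The canonical morphism `X → X[1]` of degree `-1`. -/
noncomputable def σ (X : H0 C) : tot X ⟶ tot (X⟦(1 : ℤ)⟧) :=
  Tot.hom (X := X.as) (Y := HasDGShift.sh 1 X.as)
    (HasDGShift.s 1 X.as (add_neg_cancel 1))

/-- The canonical morphism `X[1] → X` of degree `1`. -/
noncomputable def τ (X : H0 C) : tot (X⟦(1 : ℤ)⟧) ⟶ tot X :=
  Tot.hom (X := HasDGShift.sh 1 X.as) (Y := X.as) (HasDGShift.t 1 X.as)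

theorem isDeg_σ (X : H0 C) : IsDeg (-1) (σ X) := isDeg_hom (Y := HasDGShift.sh 1 X.as) _

theorem isDeg_τ (X : H0 C) : IsDeg 1 (τ X) := isDeg_hom (X := HasDGShift.sh 1 X.as) _

theorem D_σ (X : H0 C) : D (σ X) = 0 := by
  refine (hom_d (Y := HasDGShift.sh 1 X.as) (neg_add_cancel 1) _).symm.trans ?_
  exact (congrArg Tot.hom (HasDGShift.d_s 1 X.as _ _)).trans hom_zero

theorem D_τ (X : H0 C) : D (τ X) = 0 := by
  refine (hom_d (X := HasDGShift.sh 1 X.as) rfl _).symm.trans ?_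
  exact (congrArg Tot.hom (HasDGShift.d_t 1 X.as _)).trans hom_zero

@[simp]
theorem σ_τ (X : H0 C) : σ X ≫ τ X = 𝟙 _ := by
  refine (hom_comp (Y := HasDGShift.sh 1 X.as) (neg_add_cancel 1) _ _).symm.trans ?_
  rw [HasDGShift.s_t]
  rfl

@[simp]
theorem τ_σ (X : H0 C) : τ X ≫ σ X = 𝟙 _ := by
  refine (hom_comp (X := HasDGShift.sh 1 X.as) (Z := HasDGShift.sh 1 X.as)
    (add_neg_cancel 1) _ _).symm.trans ?_
  rw [HasDGShift.t_s]
  rfl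

@[simp]
theorem σ_τ_assoc (X : H0 C) {Z : Tot C} (x : tot X ⟶ Z) : σ X ≫ τ X ≫ x = x := by
  rw [← Category.assoc, σ_τ, Category.id_comp]

@[simp]
theorem comp_τ_σ (X : H0 C) {Z : Tot C} (x : Z ⟶ tot (X⟦(1 : ℤ)⟧)) : (x ≫ τ X) ≫ σ X = x := by
  rw [Category.assoc, τ_σ, Category.comp_id]

theorem Rep.shift {u : X ⟶ Y} {x} (h : Rep u x) : Rep (u⟦(1 : ℤ)⟧') (τ X ≫ x ≫ σ Y) := by
  obtain ⟨f, hf, rfl, rfl⟩ := h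
  refine ⟨HasDGShift.shHom 1 f, closed_shHom 1 hf, rfl, ?_⟩
  exact (hom_comp (X := HasDGShift.sh 1 X.as) (Z := HasDGShift.sh 1 Y.as) _ _ _).trans
    (congrArg (τ X ≫ ·) (hom_comp (Z := HasDGShift.sh 1 Y.as) _ _ _))

/-- A morphism to `X[1]` is written as `z ≫ σ X` with `z` of degree one. In these terms composition
with a shifted morphism is plain composition, and shifts disappear from the calculations. -/
theorem Rep.comp_shift {w : W ⟶ X⟦(1 : ℤ)⟧} {z : tot W ⟶ tot X} (hw : Rep w (z ≫ σ X)) {u : X ⟶ Y}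
    {x : tot X ⟶ tot Y} (hu : Rep u x) : Rep (w ≫ u⟦(1 : ℤ)⟧') ((z ≫ x) ≫ σ Y) := by
  simpa using hw.comp hu.shift

/-! ### Exact triangles -/

/-- A triangle which is represented by an exact triple. -/
def Exact {X Y Z : H0 C} (u : X ⟶ Y) (v : Y ⟶ Z) (w : Z ⟶ X⟦(1 : ℤ)⟧) : Prop :=
  ∃ f g h, Rep u f ∧ Rep v g ∧ Rep w (h ≫ σ X) ∧ IsExact 0 0 1 f g h

variable {Z X' Y' Z' : H0 C} {u : X ⟶ Y} {v : Y ⟶ Z} {w : Z ⟶ X⟦(1 : ℤ)⟧}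
  {u' : X' ⟶ Y'} {v' : Y' ⟶ Z'} {w' : Z' ⟶ X'⟦(1 : ℤ)⟧}

theorem Exact.of_iso (H : Exact u v w) (a : X ≅ X') (b : Y ≅ Y') (c : Z ≅ Z')
    (e₁ : u ≫ b.hom = a.hom ≫ u') (e₂ : v ≫ c.hom = b.hom ≫ v')
    (e₃ : w ≫ a.hom⟦(1 : ℤ)⟧' = c.hom ≫ w') : Exact u' v' w' := by
  obtain ⟨f, g, h, hf, hg, hh, H⟩ := H
  obtain ⟨α', hα'⟩ := exists_rep a.hom
  obtain ⟨α, hα⟩ := exists_rep a.inv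
  obtain ⟨β', hβ'⟩ := exists_rep b.hom
  obtain ⟨β, hβ⟩ := exists_rep b.inv
  obtain ⟨γ', hγ'⟩ := exists_rep c.hom
  obtain ⟨γ, hγ⟩ := exists_rep c.inv
  refine ⟨α ≫ f ≫ β', β ≫ g ≫ γ', γ ≫ h ≫ α', ?_, ?_, ?_,
    H.transport hα.isDeg hα'.isDeg hβ.isDeg hβ'.isDeg hγ.isDeg hγ'.isDeg hα.closed hα'.closed
      hβ.closed hβ'.closed hγ.closed hγ'.closed
      (((hα.comp hα').eq_iff (rep_id _)).mp (by simp))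
      (((hα'.comp hα).eq_iff (rep_id _)).mp (by simp))
      (((hβ.comp hβ').eq_iff (rep_id _)).mp (by simp))
      (((hβ'.comp hβ).eq_iff (rep_id _)).mp (by simp))
      (((hγ.comp hγ').eq_iff (rep_id _)).mp (by simp))
      (((hγ'.comp hγ).eq_iff (rep_id _)).mp (by simp))⟩
  · obtain rfl : a.inv ≫ u ≫ b.hom = u' := by rw [e₁, Iso.inv_hom_id_assoc]
    exact hα.comp (hf.comp hβ')
  · obtain rfl : b.inv ≫ v ≫ c.hom = v' := by rw [e₂, Iso.inv_hom_id_assoc]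
    exact hβ.comp (hg.comp hγ')
  · obtain rfl : c.inv ≫ w ≫ a.hom⟦(1 : ℤ)⟧' = w' := by rw [e₃, Iso.inv_hom_id_assoc]
    simpa using hγ.comp (hh.comp hα'.shift)

/-- Replacing the vertex `X` by `X[1]` along `τ` and `σ` moves the degree one from `h` to `f`; a
cyclic permutation then puts it last. -/
theorem Exact.rotate (H : Exact u v w) : Exact v w (-u⟦(1 : ℤ)⟧') := by
  obtain ⟨f, g, h, hf, hg, hh, H⟩ := H
  refine ⟨g, h ≫ σ _, τ _ ≫ f, hg, hh, ?_, ?_⟩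
  · rw [neg_eq]
    simpa using hf.shift
  · exact (H.transport₁ (isDeg_τ X) (isDeg_σ X) (by omega) (D_τ _) (D_σ _)
      (.of_eq (τ_σ _)) (.of_eq (σ_τ _))).cyc.cast

theorem Exact.of_rotate (H : Exact v w (-u⟦(1 : ℤ)⟧')) : Exact u v w := by
  obtain ⟨g, h, k, hg, hh, hk, H⟩ := H
  rw [neg_eq] at hk
  obtain ⟨f, hf⟩ := exists_rep u
  have H' := H.cyc.cyc.transport₁ (isDeg_σ X) (isDeg_τ X) (by omega) (D_σ _) (D_τ _)
      (.of_eq (σ_τ _)) (.of_eq (τ_σ _))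
  refine ⟨σ _ ≫ k, g, h ≫ τ _, ?_, hg, ?_, H'.cast⟩
  · refine hf.of_htpy H'.deg₁ H'.closed₁ ?_
    -- Both `τ ≫ f ≫ σ` and `k ≫ σ` represent the shift of `u`, so they are homotopic. Whiskering
    -- with `σ` and `τ` undoes the shift and compares `f` with `σ ≫ k`.
    have h2 := ((hf.shift.eq_iff hk).mp rfl).whisker (isDeg_σ X) (isDeg_τ Y) (D_σ _) (D_τ _)
    simpa using h2
  · simpa using hh

theorem Exact.complete (H : Exact u v w) (H' : Exact u' v' w')
    (a : X ⟶ X') (b : Y ⟶ Y') (e : u ≫ b = a ≫ u') :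
    ∃ c : Z ⟶ Z', v ≫ c = b ≫ v' ∧ w ≫ a⟦1⟧' = c ≫ w' := by
  obtain ⟨f, g, h, hf, hg, hh, H⟩ := H
  obtain ⟨f', g', h', hf', hg', hh', H'⟩ := H'
  obtain ⟨α, hα⟩ := exists_rep a
  obtain ⟨β, hβ⟩ := exists_rep b
  obtain ⟨γ, hγ, dγ, e₂, ζ, hζ, dζ⟩ := H.complete H' hα.isDeg hβ.isDeg hα.closed hβ.closed
    (((hf.comp hβ).eq_iff (hα.comp hf')).mp e)
  obtain ⟨c, hc⟩ := exists_of_closed hγ dγ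
  refine ⟨c, ((hg.comp hc).eq_iff (hβ.comp hg')).mpr e₂,
    ((hh.comp hα.shift).eq_iff (hc.comp hh')).mpr ⟨ζ ≫ σ _, hζ.comp (isDeg_σ _), ?_⟩⟩
  simp [D_comp, D_σ, dζ]

theorem Exact.unipotent (H : Exact u v w) (e : Z ⟶ Z) (e₁ : v ≫ e = v) (e₂ : e ≫ w = w) :
    e ≫ e = 𝟙 _ := by
  obtain ⟨f, g, h, hf, hg, hh, H⟩ := H
  obtain ⟨ε, hε⟩ := exists_rep e
  refine ((hε.comp hε).eq_iff (rep_id _)).mpr (H.unipotent hε.isDeg hε.closed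
    (((hg.comp hε).eq_iff hg).mp e₁) ?_)
  obtain ⟨ξ, hξ, dξ⟩ := ((hε.comp hh).eq_iff hh).mp e₂
  exact ⟨ξ ≫ τ _, hξ.comp (isDeg_τ _), by simp [D_comp, D_τ, dξ]⟩

/-- This takes the place of the five lemma: the comparison morphisms in the two directions need not
be inverse to each other, but their composites in both orders are involutions by `Exact.unipotent`.
-/
theorem Exact.iso {v' : Y ⟶ Z'} {w' : Z' ⟶ X⟦(1 : ℤ)⟧} (H : Exact u v w) (H' : Exact u v' w') :
    Nonempty (Triangle.mk u v w ≅ Triangle.mk u v' w') := by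
  obtain ⟨c, h₁, h₂⟩ := H.complete H' (𝟙 X) (𝟙 Y) (by simp)
  obtain ⟨c', h₁', h₂'⟩ := H'.complete H (𝟙 X) (𝟙 Y) (by simp)
  simp only [CategoryTheory.Functor.map_id, Category.comp_id, Category.id_comp] at h₁ h₂ h₁' h₂'
  have e := H.unipotent (c ≫ c') (by rw [← Category.assoc, h₁, h₁'])
    (by rw [Category.assoc, ← h₂', h₂])
  have e' := H'.unipotent (c' ≫ c) (by rw [← Category.assoc, h₁', h₁])
    (by rw [Category.assoc, ← h₂, h₂'])
  rw [Category.assoc] at e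
  -- From `(c ≫ c')² = 𝟙` the morphism `c` has a retraction, and from `(c' ≫ c)² = 𝟙` it is an
  -- epimorphism.
  have : IsSplitMono c := ⟨⟨⟨_, e⟩⟩⟩
  have : Epi c := epi_of_epi_fac ((Category.assoc _ _ _).trans e')
  have : IsIso c := isIso_of_epi_of_isSplitMono c
  exact ⟨Triangle.isoMk _ _ (Iso.refl _) (Iso.refl _) (@asIso _ _ Z Z' c this)
    ((Category.comp_id u).trans (Category.id_comp u).symm) (h₁.trans (Category.id_comp _).symm)
    ((congrArg (w ≫ ·) (CategoryTheory.Functor.map_id _ _)).trans ((Category.comp_id w).trans h₂))⟩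

/-- The octahedral axiom for the cones of `f`, `g` and `f ≫ g`. -/
theorem exists_octahedron {A B E : H0 C} {u : X ⟶ Y} {u' : Y ⟶ Z} {v : Y ⟶ A} {w : A ⟶ X⟦(1 : ℤ)⟧}
    {v' : Z ⟶ B} {w' : B ⟶ Y⟦(1 : ℤ)⟧} {v'' : Z ⟶ E} {w'' : E ⟶ X⟦(1 : ℤ)⟧} {f g i j p q i' j' p'
    q' i'' j'' p'' q''} (hf : Rep u f) (hg : Rep u' g) (H : IsSplit 0 1 f i j p q)
    (H' : IsSplit 0 1 g i' j' p' q') (H'' : IsSplit 0 1 (f ≫ g) i'' j'' p'' q'') (hj : Rep v j)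
    (hp : Rep w (p ≫ σ X)) (hj' : Rep v' j') (hp' : Rep w' (p' ≫ σ Y)) (hj'' : Rep v'' j'')
    (hp'' : Rep w'' (p'' ≫ σ X)) :
    ∃ (m₁ : A ⟶ E) (m₃ : E ⟶ B), v ≫ m₁ = u' ≫ v'' ∧ m₁ ≫ w'' = w ∧ v'' ≫ m₃ = v' ∧
      w'' ≫ u⟦1⟧' = m₃ ≫ w' ∧ Exact m₁ m₃ (w' ≫ v⟦1⟧') := by
  obtain ⟨E, e₁, e₂, e₃, e₄⟩ := isExact_octahedron H H' H''
  obtain ⟨m₁, hm₁⟩ := exists_of_closed E.deg₁ E.closed₁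
  obtain ⟨m₃, hm₃⟩ := exists_of_closed E.deg₂ E.closed₂
  refine ⟨m₁, m₃, ((hj.comp hm₁).eq_iff (hg.comp hj'')).mpr (.of_eq e₁),
    ((hm₁.comp hp'').eq_iff hp).mpr (.of_eq ?_), ((hj''.comp hm₃).eq_iff hj').mpr (.of_eq e₃),
    ((hp''.comp_shift hf).eq_iff (hm₃.comp hp')).mpr (.of_eq ?_),
    _, _, _, hm₁, hm₃, hp'.comp_shift hj, E⟩
  · rw [← Category.assoc, e₂]
  · rw [e₄, Category.assoc]

theorem Exact.of_triangle_iso {T T' : Triangle (H0 C)} (H : Exact T.mor₁ T.mor₂ T.mor₃)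
    (e : T ≅ T') : Exact T'.mor₁ T'.mor₂ T'.mor₃ :=
  H.of_iso (Triangle.π₁.mapIso e) (Triangle.π₂.mapIso e) (Triangle.π₃.mapIso e) e.hom.comm₁
    e.hom.comm₂ e.hom.comm₃

end H0
end SqrtNegOne

namespace SqrtNegOne

open Tot

namespace Add

variable {C : Type u} [DGCategory C]

/-! ### Summands of formal direct sums -/

section Summands

variable (S : Add C) {J J' : Type} [Fintype J] [Fintype J'] (e : J → S.ι) (e' : J' → S.ι)

/-- The direct sum of a family of summands. -/
abbrev pull : Add C := { ι := J, obj := fun i => S.obj (e i) }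

/-- The inclusion of a family of summands. -/
noncomputable def inc : DGCategory.Hom (pull S e) S 0 :=
  diag (X := pull S e) e fun i => DGCategory.one (S.obj (e i))

/-- The projection to a family of summands. -/
noncomputable def pr : DGCategory.Hom S (pull S e) 0 :=
  codiag (X := pull S e) e fun i => DGCategory.one (S.obj (e i))

theorem inc_apply (i : J) (j : S.ι) : inc S e i j = S.δ (e i) j := DGCategory.id_comp _

theorem pr_apply (i : S.ι) (j : J) : pr S e i j = S.δ i (e j) := DGCategory.comp_id _

theorem d_inc {q : ℤ} (h : 0 + 1 = q) : DGCategory.d h (inc S e) = 0 := by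
  ext i j
  rw [d_apply, inc_apply]
  exact d_δ S _ _ _

theorem d_pr {q : ℤ} (h : 0 + 1 = q) : DGCategory.d h (pr S e) = 0 := by
  ext i j
  rw [d_apply, pr_apply]
  exact d_δ S _ _ _

variable {S} {e} {T : Add C}

theorem inc_comp {p : ℤ} (h : 0 + p = p) (f : DGCategory.Hom S T p) (i k) :
    DGCategory.comp h (inc S e) f i k = f (e i) k :=
  (diag_comp (X := pull S e) h e (fun i => DGCategory.one (S.obj (e i))) f i k).trans
    (DGCategory.id_comp (f (e i) k))

theorem comp_pr {p : ℤ} (h : p + 0 = p) (f : DGCategory.Hom T S p) (k i) :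
    DGCategory.comp h f (pr S e) k i = f k (e i) :=
  (comp_codiag (X := pull S e) h e (fun i => DGCategory.one (S.obj (e i))) f k i).trans
    (DGCategory.comp_id (f k (e i)))

theorem comp_inc {p : ℤ} (h : p + 0 = p) (he : Function.Injective e)
    (f : DGCategory.Hom T (pull S e) p) (k i) :
    DGCategory.comp h f (inc S e) k (e i) = f k i :=
  (comp_diag (X := pull S e) h he (fun i => DGCategory.one (S.obj (e i))) f k i).trans
    (DGCategory.comp_id (f k i))

theorem comp_inc_of_ne {p : ℤ} (h : p + 0 = p) (f : DGCategory.Hom T (pull S e) p) (k) {j : S.ι}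
    (hj : ∀ i, e i ≠ j) : DGCategory.comp h f (inc S e) k j = 0 := by
  rw [comp_apply]
  refine Finset.sum_eq_zero fun i _ => ?_
  rw [inc_apply, δ_ne _ (hj i), map_zero]

theorem pr_comp {p : ℤ} (h : 0 + p = p) (he : Function.Injective e)
    (f : DGCategory.Hom (pull S e) T p) (i k) :
    DGCategory.comp h (pr S e) f (e i) k = f i k := by
  rw [comp_apply, Finset.sum_eq_single i, pr_apply, δ_self, DGCategory.id_comp]
  · intro j _ hj
    rw [pr_apply, δ_ne _ (he.ne hj.symm), DGCategory.zero_comp]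
  · simp

theorem pr_comp_of_ne {p : ℤ} (h : 0 + p = p) (f : DGCategory.Hom (pull S e) T p) {j : S.ι} (k)
    (hj : ∀ i, e i ≠ j) : DGCategory.comp h (pr S e) f j k = 0 := by
  rw [comp_apply]
  refine Finset.sum_eq_zero fun i _ => ?_
  rw [pr_apply, δ_ne _ (hj i).symm, DGCategory.zero_comp]

theorem inc_comp_pr (he : Function.Injective e) :
    DGCategory.comp (add_zero 0) (inc S e) (pr S e) = DGCategory.one (pull S e) := by
  ext i j
  rw [inc_comp, pr_apply, one_apply]
  by_cases h : i = j
  · subst h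
    rw [δ_self, δ_self]
  · rw [δ_ne _ h, δ_ne _ (he.ne h)]

theorem inc_comp_pr_of_ne {e' : J' → S.ι} (h : ∀ i j, e i ≠ e' j) :
    DGCategory.comp (add_zero 0) (inc S e) (pr S e') = 0 := by
  ext i j
  rw [inc_comp, pr_apply, δ_ne _ (h i j)]
  rfl

/-- Bijectivity says that the two families are complementary: each row of the identity matrix comes
from exactly one of them. -/
theorem pr_comp_inc_add {e' : J' → S.ι} (he : Function.Bijective (Sum.elim e e')) :
    DGCategory.comp (add_zero 0) (pr S e) (inc S e) +
      DGCategory.comp (add_zero 0) (pr S e') (inc S e') = DGCategory.one S := by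
  have h₁ : Function.Injective e := fun i j h => Sum.inl_injective (he.injective h)
  have h₂ : Function.Injective e' := fun i j h => Sum.inr_injective (he.injective h)
  have h₃ : ∀ i j, e i ≠ e' j := fun i j h => Sum.inl_ne_inr (he.injective h)
  ext i j
  rw [add_apply]
  obtain ⟨i | i, rfl⟩ := he.surjective i
  · refine (congrArg₂ (· + ·) (pr_comp _ h₁ _ i j)
      (pr_comp_of_ne _ _ j fun k => (h₃ i k).symm)).trans ?_
    exact (add_zero _).trans (inc_apply S e i j)
  · refine (congrArg₂ (· + ·) (pr_comp_of_ne _ _ j fun k => h₃ k i)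
      (pr_comp _ h₂ _ i j)).trans ?_
    exact (zero_add _).trans (inc_apply S e' i j)

end Summands

end Add

namespace Tw

variable {C : Type u} [DGCategory C]

/-! ### Triangular twisted complexes -/

/-- A twisted complex whose index set is the disjoint union of two sets such that the twist is block
triangular is an extension of twisted complexes. -/
theorem isSplit_of_triangular (E X Y : Tw C) {J₁ J₂ : Type} [Fintype J₁] [Fintype J₂]
    {e₁ : J₁ → E.obj.ι} {e₂ : J₂ → E.obj.ι} (he : Function.Bijective (Sum.elim e₁ e₂))
    (hX : X.obj = Add.pull E.obj e₁) (hY : Y.obj = Add.pull E.obj e₂)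
    (k : DGCategory.Hom X Y 1) (dk : DGCategory.d (q := 2) rfl k = 0)
    (inr : DGCategory.Hom Y E 0) (fst : DGCategory.Hom E X 0)
    (hinr : inr ≍ Add.inc E.obj e₂) (hfst : fst ≍ Add.pr E.obj e₁)
    (h₁₁ : X.f ≍ (fun i j => E.f (e₁ i) (e₁ j) :
      DGCategory.Hom (Add.pull E.obj e₁) (Add.pull E.obj e₁) 1))
    (h₁₂ : k ≍ (fun i j => E.f (e₁ i) (e₂ j) :
      DGCategory.Hom (Add.pull E.obj e₁) (Add.pull E.obj e₂) 1))
    (h₂₂ : Y.f ≍ (fun i j => E.f (e₂ i) (e₂ j) :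
      DGCategory.Hom (Add.pull E.obj e₂) (Add.pull E.obj e₂) 1))
    (h₂₁ : ∀ i j, E.f (e₂ i) (e₁ j) = 0) :
    ∃ inl snd, IsSplit 1 0 (Tot.hom k) inl (Tot.hom inr) (Tot.hom fst) snd := by
  have i₁ : Function.Injective e₁ := fun i j h => Sum.inl_injective (he.injective h)
  have i₂ : Function.Injective e₂ := fun i j h => Sum.inr_injective (he.injective h)
  have i₃ : ∀ i j, e₁ i ≠ e₂ j := fun i j h => Sum.inl_ne_inr (he.injective h)
  -- With `X` and `Y` taken apart, the equations between their underlying sums can be substituted,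
  -- and the heterogeneous equations become ordinary ones.
  obtain ⟨_, f₁, mc₁, o₁⟩ := X
  obtain ⟨_, f₂, mc₂, o₂⟩ := Y
  obtain rfl : _ = _ := hX
  obtain rfl : _ = _ := hY
  obtain rfl := eq_of_heq h₁₁
  obtain rfl := eq_of_heq h₂₂
  obtain rfl := eq_of_heq h₁₂
  obtain rfl := eq_of_heq hinr
  obtain rfl := eq_of_heq hfst
  refine ⟨Tot.hom (X := Tw.mk _ _ mc₁ o₁) (Y := E) (Add.inc E.obj e₁),
    Tot.hom (X := E) (Y := Tw.mk _ _ mc₂ o₂) (Add.pr E.obj e₂), add_zero 1, isDeg_hom _, ?_,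
    isDeg_hom _, isDeg_hom _, isDeg_hom _, isDeg_hom _, ?_, ?_, ?_, ?_, ?_, ?_, ?_, ?_, ?_⟩
  · exact (hom_d _ _).symm.trans ((congrArg Tot.hom dk).trans hom_zero)
  · refine (hom_d (zero_add 1) _).symm.trans ((congrArg Tot.hom ?_).trans
      (hom_comp (add_zero 1) _ _))
    rw [d_eq]
    refine (congrArg (· + _ + _) (Add.d_inc E.obj e₁ _)).trans ?_
    refine (congrArg (· + _) (zero_add _)).trans ?_
    -- The differential is the sum of `X.f` followed by the inclusion and of the inclusion followed
    -- by `E.f`. In the columns of the first block the two terms are equal and cancel; in those of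
    -- the second block only `E.f` remains, and this is `k`.
    funext i j
    obtain ⟨j | j, rfl⟩ := he.surjective j
    · refine (congrArg₂ (· + ·) (Add.comp_inc (add_zero 1) i₁ _ i j)
        (Add.inc_comp (zero_add 1) _ i (e₁ j))).trans ?_
      exact (DGCategory.add_self _).trans
        (Add.comp_inc_of_ne (add_zero 1) _ i fun k => (i₃ j k).symm).symm
    · refine (congrArg₂ (· + ·) (Add.comp_inc_of_ne (add_zero 1) _ i fun k => i₃ k j)
        (Add.inc_comp (zero_add 1) _ i (e₂ j))).trans ?_
      exact (zero_add _).trans (Add.comp_inc (add_zero 1) i₂ (fun i j => E.f (e₁ i) (e₂ j)) i j).symm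
  · refine (hom_d (zero_add 1) _).symm.trans ((congrArg Tot.hom ?_).trans hom_zero)
    refine closed_of _ _ (Add.d_inc _ _ _) ?_
    funext i j
    refine Eq.trans ?_ (Add.inc_comp (zero_add 1) _ i j).symm
    obtain ⟨j | j, rfl⟩ := he.surjective j
    · exact (Add.comp_inc_of_ne (add_zero 1) _ i fun k => (i₃ j k).symm).trans (h₂₁ i j).symm
    · exact Add.comp_inc (add_zero 1) i₂ _ i j
  · refine (hom_d (zero_add 1) _).symm.trans ((congrArg Tot.hom ?_).trans hom_zero)
    refine closed_of _ _ (Add.d_pr _ _ _) ?_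
    funext i j
    refine (Add.comp_pr (add_zero 1) _ i j).trans ?_
    obtain ⟨i | i, rfl⟩ := he.surjective i
    · exact (Add.pr_comp (zero_add 1) i₁ (fun i j => E.f (e₁ i) (e₁ j)) i j).symm
    · exact (h₂₁ i j).trans (Add.pr_comp_of_ne (zero_add 1) _ j fun k => i₃ k i).symm
  · refine (hom_d (zero_add 1) _).symm.trans ((congrArg Tot.hom ?_).trans
      (hom_comp (zero_add 1) _ _))
    rw [d_eq]
    refine (congrArg (· + _ + _) (Add.d_pr E.obj e₂ _)).trans ?_
    refine (congrArg (· + _) (zero_add _)).trans ?_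
    funext i j
    obtain ⟨i | i, rfl⟩ := he.surjective i
    · refine (congrArg₂ (· + ·) (Add.comp_pr (add_zero 1) _ (e₁ i) j)
        (Add.pr_comp_of_ne (zero_add 1) _ j fun k => (i₃ i k).symm)).trans ?_
      exact (add_zero _).trans
        (Add.pr_comp (zero_add 1) i₁ (fun i j => E.f (e₁ i) (e₂ j)) i j).symm
    · refine (congrArg₂ (· + ·) (Add.comp_pr (add_zero 1) _ (e₂ i) j)
        (Add.pr_comp (zero_add 1) i₂ _ i j)).trans ?_
      exact (DGCategory.add_self _).trans
        (Add.pr_comp_of_ne (zero_add 1) _ j fun k => i₃ k i).symm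
  · exact (hom_comp (add_zero 0) _ _).symm.trans (congrArg Tot.hom (Add.inc_comp_pr i₁))
  · exact (hom_comp (add_zero 0) _ _).symm.trans (congrArg Tot.hom (Add.inc_comp_pr i₂))
  · exact (hom_comp (add_zero 0) _ _).symm.trans ((congrArg Tot.hom
      (Add.inc_comp_pr_of_ne i₃)).trans hom_zero)
  · exact (hom_comp (add_zero 0) _ _).symm.trans ((congrArg Tot.hom
      (Add.inc_comp_pr_of_ne fun i j => (i₃ j i).symm)).trans hom_zero)
  · rw [add_comm]
    refine (congrArg₂ (· + ·) (hom_comp (add_zero 0) _ _).symm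
      (hom_comp (add_zero 0) _ _).symm).trans ?_
    exact (hom_add _ _).symm.trans (congrArg Tot.hom (Add.pr_comp_inc_add he))

end Tw
end SqrtNegOne

namespace SqrtNegOne

open Tot

namespace Tw

variable {C : Type u} [DGCategory C]

/-! ### The triangulated structure -/

/-- The twist of `ext` is block triangular by definition. It remains to recognise `Add.inr` and
`Add.fst`, defined by cases, as the inclusion and projection of a family of summands. -/
theorem isSplit_ext (X Y : Tw C) (k : DGCategory.Hom X Y 1)
    (dk : DGCategory.d (q := 2) rfl k = 0) :
    ∃ inl snd, IsSplit 1 0 (Tot.hom k) inl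
      (Tot.hom (X := Y) (Y := ext X Y k dk) (Add.inr X.obj Y.obj))
      (Tot.hom (X := ext X Y k dk) (Y := X) (Add.fst X.obj Y.obj)) snd := by
  have hb : Function.Bijective
      (Sum.elim Sum.inl Sum.inr : X.obj.ι ⊕ Y.obj.ι → X.obj.ι ⊕ Y.obj.ι) := by
    rw [Sum.elim_inl_inr]
    exact Function.bijective_id
  refine isSplit_of_triangular (ext X Y k dk) X Y (e₁ := Sum.inl) (e₂ := Sum.inr) hb rfl rfl k dk
    _ _ (heq_of_eq ?_) (heq_of_eq ?_) HEq.rfl HEq.rfl HEq.rfl fun _ _ => rfl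
  · funext i j
    refine Eq.trans ?_ (Add.inc_apply (Add.sum X.obj Y.obj) Sum.inr i j).symm
    rcases j with j | j
    · exact (Add.δ_ne (Add.sum X.obj Y.obj) Sum.inr_ne_inl).symm
    · by_cases h : i = j
      · subst h
        exact (Add.δ_self Y.obj i).trans (Add.δ_self (Add.sum X.obj Y.obj) (.inr i)).symm
      · exact (Add.δ_ne Y.obj h).trans
          (Add.δ_ne (Add.sum X.obj Y.obj) (Sum.inr_injective.ne h)).symm
  · funext i j
    refine Eq.trans ?_ (Add.pr_apply (Add.sum X.obj Y.obj) Sum.inl i j).symm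
    rcases i with i | i
    · by_cases h : i = j
      · subst h
        exact (Add.δ_self X.obj i).trans (Add.δ_self (Add.sum X.obj Y.obj) (.inl i)).symm
      · exact (Add.δ_ne X.obj h).trans
          (Add.δ_ne (Add.sum X.obj Y.obj) (Sum.inl_injective.ne h)).symm
    · exact (Add.δ_ne (Add.sum X.obj Y.obj) Sum.inr_ne_inl).symm

variable [HasDGShift C]

open H0

/-- The cone is an extension of `X[1]` by `Y`. Replacing `X[1]` by `X` along `σ` and `τ` turns the
gluing morphism into `h` itself, so that the cones of `f`, `g` and their composite are expressed by
the same three objects. -/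
theorem isSplit_cone {X Y : Tw C} (h : DGCategory.Hom X Y 0)
    (hh : DGCategory.d (zero_add 1) h = 0) :
    ∃ (inl : (⟨X⟩ : Tot (Tw C)) ⟶ ⟨cone h hh⟩) (inr : (⟨Y⟩ : Tot (Tw C)) ⟶ ⟨cone h hh⟩)
      (fst : (⟨cone h hh⟩ : Tot (Tw C)) ⟶ ⟨X⟩) (snd : (⟨cone h hh⟩ : Tot (Tw C)) ⟶ ⟨Y⟩),
      IsSplit 0 1 (Tot.hom h) inl inr fst snd ∧ Rep (coneTriangle h hh).mor₂ inr ∧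
        Rep (coneTriangle h hh).mor₃ (fst ≫ σ ⟨X⟩) := by
  obtain ⟨inl, snd, H⟩ := isSplit_ext (HasDGShift.sh 1 X) Y
    (DGCategory.comp (add_zero 1) (HasDGShift.t 1 X) h)
    (DGCategory.d_comp_eq_zero _ _ (HasDGShift.d_t 1 X _) hh)
  have H' := H.transport₁ (isDeg_σ ⟨X⟩) (isDeg_τ ⟨X⟩) (neg_add_cancel 1) (D_σ _) (D_τ _) (σ_τ _)
    (τ_σ _)
  have e : σ ⟨X⟩ ≫ Tot.hom (X := HasDGShift.sh 1 X)
      (DGCategory.comp (add_zero 1) (HasDGShift.t 1 X) h) = Tot.hom h :=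
    (congrArg (σ ⟨X⟩ ≫ ·) (hom_comp _ _ _)).trans (σ_τ_assoc ⟨X⟩ _)
  refine ⟨_, _, _, _, e ▸ H', rep_homMk _ (d_coneIn h hh), ?_⟩
  exact (congrArg (Rep (coneTriangle h hh).mor₃) (comp_τ_σ ⟨X⟩ (Tot.hom (coneOut h hh)))).mpr
    (rep_homMk _ (d_coneOut h hh))

theorem exact_cone {X Y : Tw C} (h : DGCategory.Hom X Y 0)
    (hh : DGCategory.d (zero_add 1) h = 0) :
    Exact (coneTriangle h hh).mor₁ (coneTriangle h hh).mor₂ (coneTriangle h hh).mor₃ := by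
  obtain ⟨inl, inr, fst, snd, H, h₁, h₂⟩ := isSplit_cone h hh
  exact ⟨_, _, _, rep_homMk h hh, h₁, h₂, H.isExact⟩

/-- Cones are exact and exactness is invariant under isomorphism. Conversely, an exact triangle is
isomorphic, by `Exact.iso`, to the cone of any representative of its first morphism. All axioms can
thus be verified for exact triples. -/
theorem mem_exactTriangles_iff (T : Triangle (H0 (Tw C))) :
    T ∈ exactTriangles C ↔ Exact T.mor₁ T.mor₂ T.mor₃ := by
  constructor
  · rintro ⟨X, Y, h, hh, ⟨e⟩⟩
    exact (exact_cone h hh).of_triangle_iso e.symm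
  · intro H
    obtain ⟨X, Y, Z, f, g, h⟩ := T
    obtain ⟨f, hf, rfl⟩ := homMk_surjective f
    exact ⟨X.as, Y.as, f, hf, H.iso (exact_cone f hf)⟩

open ZeroObject in
theorem exact_contractible (X : H0 (Tw C)) : Exact (𝟙 X) (0 : X ⟶ 0) 0 := by
  -- The only non-zero homotopy is the identity of `X`, which bounds the zero composite of the
  -- second and third morphisms.
  refine ⟨𝟙 _, 0, 0, rep_id X, rep_zero _ _, by simpa using rep_zero _ _,
    rfl, isDeg_id _, isDeg_zero _ _ _, isDeg_zero _ _ _, D_id _, map_zero _, map_zero _,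
    0, 0, 𝟙 _, ⟨isDeg_zero _ _ _, isDeg_zero _ _ _, isDeg_id _⟩, ⟨by simp, by simp, ?_⟩,
    .of_eq (by simp), .of_eq (by simp), ?_⟩
  · simpa using D_id _
  -- The chosen zero object is zero in cohomology only, so its identity is null-homotopic and need
  -- not vanish.
  · have h := ((rep_zero _ _).eq_iff (rep_id _)).mp ((isZero_zero (H0 (Tw C))).eq_of_src 0 (𝟙 _))
    simpa using h

noncomputable instance : Pretriangulated (H0 (Tw C)) where
  distinguishedTriangles := exactTriangles C
  isomorphic_distinguished T hT T' e := by
    rw [mem_exactTriangles_iff] at hT ⊢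
    exact hT.of_triangle_iso e.symm
  contractible_distinguished X := by
    rw [mem_exactTriangles_iff]
    exact exact_contractible X
  distinguished_cocone_triangle {X Y} f := by
    obtain ⟨f, hf, rfl⟩ := homMk_surjective f
    exact ⟨_, _, _, X.as, Y.as, f, hf, ⟨Iso.refl _⟩⟩
  rotate_distinguished_triangle T := by
    rw [mem_exactTriangles_iff, mem_exactTriangles_iff]
    exact ⟨Exact.rotate, Exact.of_rotate⟩
  complete_distinguished_triangle_morphism T T' hT hT' a b e := by
    rw [mem_exactTriangles_iff] at hT hT'
    exact hT.complete hT' a b e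

theorem distinguished_of_exact {X Y Z : H0 (Tw C)} {u : X ⟶ Y} {v : Y ⟶ Z}
    {w : Z ⟶ X⟦(1 : ℤ)⟧} (H : Exact u v w) : Triangle.mk u v w ∈ distTriang (H0 (Tw C)) :=
  (mem_exactTriangles_iff _).mpr H

instance : IsTriangulated (H0 (Tw C)) := by
  -- It suffices to find, for every composable pair, one choice of triangles with an octahedron. The
  -- choice is the cones of `f`, of `g` and of their strict composite.
  refine IsTriangulated.mk' fun X Y Z u v => ?_
  obtain ⟨f, hf, rfl⟩ := homMk_surjective u
  obtain ⟨g, hg, rfl⟩ := homMk_surjective v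
  obtain ⟨i, j, p, q, H, hj, hp⟩ := isSplit_cone f hf
  obtain ⟨i', j', p', q', H', hj', hp'⟩ := isSplit_cone g hg
  obtain ⟨i'', j'', p'', q'', H'', hj'', hp''⟩ := isSplit_cone _ (closed_comp hf hg)
  rw [Tot.hom_comp] at H''
  obtain ⟨m₁, m₃, e₁, e₂, e₃, e₄, E⟩ := exists_octahedron (rep_homMk f hf) (rep_homMk g hg) H H' H''
    hj hp hj' hp' hj'' hp''
  exact ⟨X, Y, Z, _, _, _, homMk f hf, homMk g hg, Iso.refl _, Iso.refl _, Iso.refl _,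
    (Category.comp_id _).trans (Category.id_comp _).symm,
    (Category.comp_id _).trans (Category.id_comp _).symm, _, _,
    distinguished_of_exact (exact_cone f hf), _, _, distinguished_of_exact (exact_cone g hg), _, _,
    distinguished_of_exact (exact_cone _ (closed_comp hf hg)),
    ⟨⟨m₁, m₃, e₁, e₂, e₃, e₄, distinguished_of_exact E⟩⟩⟩

end Tw
end SqrtNegOne

namespace SqrtNegOne

/-! ### The weight -/

/-- Strands, cups and caps preserve the number of points plus twice the degree still to come; a half
strand increases it by one. -/
theorem IsDiag.le {k l : ℕ} {w : List Gen} (h : IsDiag k w l) : (k : ℤ) ≤ l + 2 * gr w := by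
  induction w generalizing k with
  | nil => obtain rfl : k = l := h; simp [gr]
  | cons g w ih =>
    obtain ⟨rfl, h⟩ := h
    have h1 := ih h
    obtain ⟨a, e, b⟩ := g
    have h2 : gr (⟨a, e, b⟩ :: w) = e.gr + gr w := rfl
    rw [h2]
    cases e <;> simp only [Gen.dom, Gen.cod, Elt.dom, Elt.cod, Elt.gr] at h1 ⊢ <;> omega

theorem Cls.le {k l : ℕ} {n : ℤ} (c : Cls k l n) : (k : ℤ) ≤ l + 2 * n := by
  obtain ⟨w, h, rfl⟩ := c
  exact h.le

namespace Elem

/-- The weight `k + 2 m` of `Q^k[m]`. -/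
def wt (X : Elem) : ℤ := X.pow + 2 * X.shift

/-- The sum of the coefficients of the diagrams without half strands. -/
noncomputable def ε (X Y : Elem) (p : ℤ) : DGCategory.Hom X Y p →ₗ[F] F :=
  open Classical in if wt X = wt Y + 2 * p then Finsupp.linearCombination F fun _ => (1 : F) else 0

theorem wt_le {X Y : Elem} {p : ℤ} (c : Cls X.pow Y.pow (p + Y.shift - X.shift)) :
    wt X ≤ wt Y + 2 * p := by
  have := c.le
  unfold wt
  omega

theorem ε_single {X Y : Elem} {p : ℤ} (c : Cls X.pow Y.pow (p + Y.shift - X.shift)) :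
    ε X Y p (Finsupp.single c 1) = open Classical in if wt X = wt Y + 2 * p then 1 else 0 := by
  unfold ε
  split_ifs
  · exact (Finsupp.linearCombination_single _ _ _).trans (one_smul _ _)
  · rfl

theorem ε_eq_zero {X Y : Elem} {p : ℤ} (f : DGCategory.Hom X Y p) (h : wt X ≠ wt Y + 2 * p) :
    ε X Y p f = 0 := by
  rw [ε, if_neg h, LinearMap.zero_apply]

/-- The defect in the weight inequality is non-negative and additive under stacking, so it vanishes
for a composite exactly when it vanishes for both factors. In other words, the diagrams with half
strands form an ideal. -/
theorem ε_comp {X Y Z : Elem} {p q r : ℤ} (h : p + q = r) (f : DGCategory.Hom X Y p)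
    (g : DGCategory.Hom Y Z q) : ε X Z r (DGCategory.comp h f g) = ε X Y p f * ε Y Z q g := by
  refine basis_induction (P := fun f => ε X Z r (DGCategory.comp h f g) = ε X Y p f * ε Y Z q g) f
    ?_ ?_ fun c => ?_
  · rw [map_zero, map_zero, LinearMap.zero_apply, map_zero, zero_mul]
  · intro x y hx hy
    rw [map_add, map_add, LinearMap.add_apply, map_add, hx, hy, add_mul]
  refine basis_induction (P := fun g => ε X Z r (DGCategory.comp h (Finsupp.single c 1) g) =
    ε X Y p (Finsupp.single c 1) * ε Y Z q g) g ?_ ?_ fun c' => ?_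
  · rw [map_zero, map_zero, map_zero, mul_zero]
  · intro x y hx hy
    rw [map_add, map_add, map_add, hx, hy, mul_add]
  refine (congrArg (ε X Z r) (bilin_single _ c c')).trans ?_
  have h₁ := wt_le c
  have h₂ := wt_le c'
  rw [ε_single, ε_single, ε_single]
  subst h
  split_ifs <;> first | omega | simp

theorem ε_one (X : Elem) : ε X X 0 (DGCategory.one X) = 1 := by
  refine (ε_single _).trans (if_pos ?_)
  omega

end Elem

namespace Add

/-- The index set of the summands `Q^k[m]`. -/
abbrev Idx (X : Add (Add Elem)) : Type := Σ i : X.ι, (X.obj i).ι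

/-- The weight of a summand. -/
def wt (X : Add (Add Elem)) (i : Idx X) : ℤ := ((X.obj i.1).obj i.2).wt

/-- The matrix of the sums of the coefficients of the diagrams without half strands. -/
noncomputable def mat {X Y : Add (Add Elem)} {p : ℤ} (f : DGCategory.Hom X Y p) :
    Matrix (Idx X) (Idx Y) F :=
  fun i j => Elem.ε _ _ p (f i.1 j.1 i.2 j.2)

theorem mat_ne_zero {X Y : Add (Add Elem)} {p : ℤ} {f : DGCategory.Hom X Y p} {i : Idx X}
    {j : Idx Y} (h : mat f i j ≠ 0) : wt X i = wt Y j + 2 * p := by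
  by_contra h'
  exact h (Elem.ε_eq_zero _ h')

/-- A morphism is a matrix of matrices, and `Idx` merges the two layers of indices; multiplicativity
of `ε` does the rest. -/
theorem mat_comp {X Y Z : Add (Add Elem)} {p q r : ℤ} (h : p + q = r) (f : DGCategory.Hom X Y p)
    (g : DGCategory.Hom Y Z q) : mat (DGCategory.comp h f g) = mat f * mat g := by
  ext i k
  rw [Matrix.mul_apply, Fintype.sum_sigma]
  have e : DGCategory.comp h f g i.1 k.1 i.2 k.2 =
      ∑ j, ∑ b, DGCategory.comp h (f i.1 j i.2 b) (g j k.1 b k.2) := by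
    rw [comp_apply, Finset.sum_apply, Finset.sum_apply]
    rfl
  refine (congrArg (Elem.ε _ _ r) e).trans ?_
  simp only [map_sum, Elem.ε_comp]
  rfl

theorem mat_one [∀ X : Add (Add Elem), DecidableEq (Idx X)] (X : Add (Add Elem)) :
    mat (DGCategory.one X) = 1 := by
  ext ⟨i, a⟩ ⟨j, b⟩
  change Elem.ε _ _ 0 (X.δ i j a b) = _
  by_cases h : i = j
  · subst h
    rw [δ_self]
    change Elem.ε _ _ 0 ((X.obj i).δ a b) = _
    by_cases h' : a = b
    · subst h'
      rw [δ_self, Matrix.one_apply_eq, Elem.ε_one]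
    · rw [δ_ne _ h', map_zero, Matrix.one_apply_ne]
      simpa using h'
  · rw [δ_ne _ h, Matrix.one_apply_ne]
    · exact map_zero _
    · intro h'
      exact h (congrArg Sigma.fst h')

theorem mat_add {X Y : Add (Add Elem)} {p : ℤ} (f g : DGCategory.Hom X Y p) :
    mat (f + g) = mat f + mat g := by
  ext i j
  exact map_add (Elem.ε _ _ p) _ _

theorem mat_zero {X Y : Add (Add Elem)} {p : ℤ} : mat (0 : DGCategory.Hom X Y p) = 0 := by
  ext i j
  exact map_zero (Elem.ε _ _ p)

end Add

/-! ### Linear algebra of contractions, and powers of the imaginary unit. -/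

/-- A homogeneous involution built from a contraction. -/
theorem sq_eq_one_of_contraction {R : Type} [Ring R] {a b : R} (ha : a * a = 0)
    (h : a * b + b * a = 1) : (a + b * a * b) * (a + b * a * b) = 1 := by
  -- The contraction `b` need not square to zero, but `b * a * b` is a contraction which does, since
  -- `a * b * a = a` and `a * (b * b) * a = 0`. The sum of two square-zero elements with
  -- anticommutator one squares to one.
  have h1 : a * b * a = a := by
    have := congrArg (a * ·) h
    simp only [mul_add, ← mul_assoc, ha, zero_mul, zero_add, mul_one] at this
    exact this
  have h3 : a * (b * b) * a = 0 := by
    have e1 : a * b * (a * b + b * a) = a * b := by rw [h, mul_one]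
    have e2 : a * b * (a * b) = a * b := by rw [← mul_assoc, h1]
    have e3 : a * b * (b * a) = 0 := by
      rw [mul_add, e2] at e1
      simpa using e1
    simpa only [mul_assoc] using e3
  calc (a + b * a * b) * (a + b * a * b)
      = a * a + (a * b * a) * b + b * (a * b * a) + b * (a * (b * b) * a) * b := by noncomm_ring
    _ = 1 := by rw [ha, h1, h3, zero_add, mul_zero, zero_mul, add_zero, h]

/-- The imaginary unit. -/
def imag : GaussianIntˣ where
  val := ⟨0, 1⟩
  inv := ⟨0, -1⟩
  val_inv := by decide
  inv_val := by decide

/-- The powers of the imaginary unit. -/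
def ipow (n : ℤ) : GaussianInt := (imag ^ n : GaussianIntˣ)

theorem ipow_add (m n : ℤ) : ipow (m + n) = ipow m * ipow n := by
  simp [ipow, zpow_add]

theorem ipow_one : ipow 1 = ⟨0, 1⟩ := rfl

theorem ipow_add_two (n : ℤ) : ipow (n + 2) = -ipow n := by
  have h : ipow 2 = -1 := by
    rw [show (2 : ℤ) = 1 + 1 by rfl, ipow_add, ipow_one]
    decide
  rw [ipow_add, h, mul_neg, mul_one]

theorem ipow_sub_two (n : ℤ) : ipow (n - 2) = -ipow n := by
  have h := ipow_add_two (n - 2)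
  rw [sub_add_cancel] at h
  rw [h, neg_neg]

/-- A nonsingular matrix whose non-zero entries join weights which differ by two. -/
theorem sum_ipow_eq_zero {ι : Type} [Fintype ι] [DecidableEq ι] (w : ι → ℤ) (U : Matrix ι ι F)
    (hU : U * U = 1) (h : ∀ i j, U i j ≠ 0 → w i = w j + 2 ∨ w i = w j - 2) :
    ∑ i, ipow (w i) = 0 := by
  have hdet : U.det ≠ 0 := by
    intro h0
    have := congrArg Matrix.det hU
    rw [Matrix.det_mul, h0, zero_mul, Matrix.det_one] at this
    exact zero_ne_one this
  rw [Matrix.det_apply] at hdet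
  -- A non-zero term of the Leibniz expansion is a permutation `s` along which all entries are
  -- non-zero. Each step of `s` changes the weight by two, hence negates the power of `i`.
  obtain ⟨s, -, hs⟩ := Finset.exists_ne_zero_of_sum_ne_zero hdet
  have hs' : ∏ i, U (s i) i ≠ 0 := fun h0 => hs (by rw [h0, smul_zero])
  have key : ∀ i, ipow (w (s i)) = -ipow (w i) := by
    intro i
    rcases h _ _ (Finset.prod_ne_zero_iff.mp hs' i (Finset.mem_univ i)) with e | e
    · rw [e, ipow_add_two]
    · rw [e, ipow_sub_two]
  have e1 : ∑ i, ipow (w i) = -∑ i, ipow (w i) := by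
    rw [← Finset.sum_neg_distrib]
    exact (Equiv.sum_comp s fun i => ipow (w i)).symm.trans (Finset.sum_congr rfl fun i _ => key i)
  exact self_eq_neg.mp e1

namespace I

/-! ### The Euler characteristic -/

/-- The Euler characteristic, the sum of the values `i ^ (k + 2 m)` over all summands `Q^k[m]`. -/
noncomputable def χ (X : I) : GaussianInt := ∑ i : Add.Idx X.obj, ipow (Add.wt X.obj i)

/-- The twist and the contraction become matrices `a` and `b` with `a² = 0` and `ab + ba = 1`, and
the involution `a + bab` pairs off summands with opposite contributions. No minimal model and no
basis of the morphism spaces is needed. -/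
theorem χ_eq_zero_of_contractible (X : I) (η : DGCategory.Hom X X (-1))
    (h : DGCategory.d (neg_add_cancel 1) η = DGCategory.one X) : χ X = 0 := by
  classical
  rw [Tw.d_eq] at h
  -- The internal differential is zero, so only the two terms with the twist are left in the
  -- differential of `η`; in the same way the Maurer–Cartan equation reduces to `X.f² = 0`.
  have h1 : Add.mat X.f * Add.mat η + Add.mat η * Add.mat X.f = 1 := by
    rw [← Add.mat_one X.obj, ← Add.mat_comp (by omega : 1 + -1 = (0 : ℤ)),
      ← Add.mat_comp (by omega : -1 + 1 = (0 : ℤ)), ← Add.mat_add]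
    exact congrArg Add.mat ((congrArg (· + _) (zero_add _)).symm.trans h)
  have h2 : Add.mat X.f * Add.mat X.f = 0 := by
    rw [← Add.mat_comp (rfl : (1 : ℤ) + 1 = 2)]
    exact (congrArg Add.mat ((zero_add _).symm.trans X.mc)).trans Add.mat_zero
  refine sum_ipow_eq_zero _ _ (sq_eq_one_of_contraction h2 h1) fun i j hij => ?_
  -- Entries of `a`, of degree `1`, raise the weight difference by two. Entries of `b * a * b`, of
  -- total degree `-1`, lower it by two.
  · by_cases h0 : Add.mat X.f i j = 0
    · right
      rw [Matrix.add_apply, h0, zero_add, Matrix.mul_apply] at hij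
      obtain ⟨k, -, hk⟩ := Finset.exists_ne_zero_of_sum_ne_zero hij
      have hk₂ := Add.mat_ne_zero (right_ne_zero_of_mul hk)
      have hk₁ := left_ne_zero_of_mul hk
      rw [Matrix.mul_apply] at hk₁
      obtain ⟨l, -, hl⟩ := Finset.exists_ne_zero_of_sum_ne_zero hk₁
      have hl₁ := Add.mat_ne_zero (left_ne_zero_of_mul hl)
      have hl₂ := Add.mat_ne_zero (right_ne_zero_of_mul hl)
      omega
    · left
      have := Add.mat_ne_zero h0
      omega

/-- The shift by one adds two to all weights, which multiplies the powers of `i` by `-1`. -/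
theorem χ_cone {X Y : I} (h : DGCategory.Hom X Y 0) (hh : DGCategory.d (zero_add 1) h = 0) :
    χ (Tw.cone h hh) = χ Y - χ X := by
  have e : χ (Tw.cone h hh) = ∑ i : X.obj.ι ⊕ Y.obj.ι, ∑ a,
      ipow (Add.wt (Tw.cone h hh).obj ⟨i, a⟩) := Fintype.sum_sigma _
  rw [e, Fintype.sum_sum_type, add_comm, sub_eq_add_neg, χ, χ, Fintype.sum_sigma,
    Fintype.sum_sigma, ← Finset.sum_neg_distrib]
  refine congrArg (_ + ·) (Finset.sum_congr rfl fun i _ => ?_)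
  rw [← Finset.sum_neg_distrib]
  refine Finset.sum_congr rfl fun a _ => ?_
  rw [← ipow_add_two]
  refine congrArg ipow ?_
  change (((X.obj.obj i).obj a).pow : ℤ) + 2 * (((X.obj.obj i).obj a).shift + 1) =
    ((X.obj.obj i).obj a).pow + 2 * ((X.obj.obj i).obj a).shift + 2
  ring

/-- The summands of a tensor product are indexed by pairs in both layers, and their weights add. -/
theorem χ_tensor (X Y : I) : χ (MonoidalDGCategory.tensorObj X Y) = χ X * χ Y := by
  have e : χ (MonoidalDGCategory.tensorObj X Y) = ∑ i : X.obj.ι × Y.obj.ι,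
      ∑ a : (X.obj.obj i.1).ι × (Y.obj.obj i.2).ι,
        ipow (Add.wt (MonoidalDGCategory.tensorObj X Y).obj ⟨i, a⟩) := Fintype.sum_sigma _
  rw [e, Fintype.sum_prod_type, χ, χ, Fintype.sum_sigma, Fintype.sum_sigma, Finset.sum_mul_sum]
  refine Finset.sum_congr rfl fun i _ => Finset.sum_congr rfl fun j _ => ?_
  rw [Fintype.sum_prod_type, Finset.sum_mul_sum]
  refine Finset.sum_congr rfl fun a _ => Finset.sum_congr rfl fun b _ => ?_
  rw [← ipow_add]
  refine congrArg ipow ?_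
  change ((_ + _ : ℕ) : ℤ) + 2 * (_ + _) = _ + 2 * _ + (_ + 2 * _)
  push_cast
  ring

theorem χ_ofObj (a : I') : χ (Tw.ofObj a) = ∑ i, ipow ((a.obj i).wt) := by
  refine (Fintype.sum_sigma _).trans ?_
  exact Fintype.sum_unique (fun _ : Unit => ∑ i, ipow ((a.obj i).wt))

theorem χ_ofObj_Q (k : ℕ) (m : ℤ) : χ (Tw.ofObj (I'.Q k m)) = ipow (k + 2 * m) :=
  (χ_ofObj _).trans (Fintype.sum_unique fun _ : Unit => ipow (k + 2 * m))

end I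

end SqrtNegOne

namespace SqrtNegOne

open Tot

/-! ### Grothendieck groups of triangulated categories -/

namespace K0

universe v

variable {T : Type u} [Category.{v} T] [HasZeroObject T] [HasShift T ℤ] [Preadditive T]
  [∀ n : ℤ, (shiftFunctor T n).Additive] [Pretriangulated T]

theorem of_distinguished {t : Triangle T} (ht : t ∈ distTriang T) :
    K0.of t.obj₂ = K0.of t.obj₁ + K0.of t.obj₃ := by
  refine eq_of_sub_eq_zero ?_
  exact (QuotientAddGroup.eq_zero_iff _).mpr (AddSubgroup.subset_closure ⟨t, ht, rfl⟩)

/-- For a zero object the triangle `X → X → X` is distinguished, being isomorphic to the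
contractible one. -/
theorem of_isZero {X : T} (h : IsZero X) : K0.of X = 0 := by
  have h1 := of_distinguished (isomorphic_distinguished _ (contractible_distinguished X)
    (Triangle.mk (𝟙 X) (0 : X ⟶ X) 0) (Triangle.isoMk _ _ (Iso.refl _) (Iso.refl _)
      (h.iso (isZero_zero T)) ((Category.comp_id _).trans (Category.id_comp _).symm) (h.eq_of_src _ _) (h.eq_of_src _ _)))
  exact left_eq_add.mp h1

/-- An isomorphism is completed to a distinguished triangle by a zero object. -/
theorem of_iso {X Y : T} (e : X ≅ Y) : K0.of X = K0.of Y := by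
  have h1 := of_distinguished (isomorphic_distinguished _ (contractible_distinguished X)
    (Triangle.mk e.hom (0 : Y ⟶ ((contractibleTriangle X).obj₃)) 0) (Triangle.isoMk _ _
      (Iso.refl _) e.symm (Iso.refl _) (e.hom_inv_id.trans (Category.id_comp _).symm)
      (zero_comp.trans comp_zero.symm) (zero_comp.trans comp_zero.symm)))
  have h2 : K0.of (contractibleTriangle X).obj₃ = 0 := of_isZero (isZero_zero T)
  have h3 : K0.of Y = K0.of X + K0.of (contractibleTriangle X).obj₃ := h1
  rw [h3, h2, add_zero]

theorem of_shift (X : T) : K0.of (X⟦(1 : ℤ)⟧) = -K0.of X := by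
  have h1 := of_distinguished (rot_of_distTriang _ (contractible_distinguished X))
  have h2 : K0.of (contractibleTriangle X).obj₃ = 0 := of_isZero (isZero_zero T)
  have h3 : K0.of (contractibleTriangle X).obj₃ = K0.of X + K0.of (X⟦(1 : ℤ)⟧) := h1
  rw [h2] at h3
  exact eq_neg_of_add_eq_zero_right h3.symm

/-- The homomorphism given by an additive function on objects. -/
def lift {A : Type*} [AddCommGroup A] (χ : T → A)
    (h : ∀ t ∈ distTriang T, χ t.obj₂ = χ t.obj₁ + χ t.obj₃) : K0 T →+ A :=
  QuotientAddGroup.lift _ (FreeAbelianGroup.lift χ) (by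
    rw [AddSubgroup.closure_le]
    rintro _ ⟨t, ht, rfl⟩
    simp [h t ht])

theorem lift_of {A : Type*} [AddCommGroup A] (χ : T → A)
    (h : ∀ t ∈ distTriang T, χ t.obj₂ = χ t.obj₁ + χ t.obj₃) (X : T) :
    lift χ h (K0.of X) = χ X := FreeAbelianGroup.lift_apply_of χ X

theorem hom_ext {A : Type*} [AddCommGroup A] {f g : K0 T →+ A}
    (h : ∀ X : T, f (K0.of X) = g (K0.of X)) : f = g :=
  QuotientAddGroup.addMonoidHom_ext _ (FreeAbelianGroup.lift_ext _ _ h)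

end K0

namespace Tw

variable {C : Type u} [DGCategory C]

theorem isZero_of_isEmpty (X : Tw C) [IsEmpty X.obj.ι] : IsZero (⟨X⟩ : H0 (Tw C)) :=
  (IsZero.iff_id_eq_zero _).mpr (H0.cls_eq_zero ⟨0, by
    funext i
    exact isEmptyElim i⟩)

variable [HasDGShift C]

/-- The class of a twisted complex in the Grothendieck group. -/
noncomputable abbrev cl (X : Tw C) : K0 (H0 (Tw C)) := K0.of ⟨X⟩

-- A cyclic permutation puts the gluing morphism `k` of degree one last, and `Y → E → X → Y[1]`
-- becomes a distinguished triangle.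
open H0 in
theorem cl_of_isSplit {X Y E : Tw C} {k inl inr fst snd}
    (H : IsSplit (X := ⟨X⟩) (Y := ⟨Y⟩) (E := ⟨E⟩) 1 0 k inl inr fst snd) :
    cl E = cl X + cl Y := by
  have H' := H.isExact.cyc
  obtain ⟨u, hu⟩ := exists_of_closed (X := ⟨Y⟩) (Y := ⟨E⟩) H.deg_inr H.D_inr
  obtain ⟨v, hv⟩ := exists_of_closed (X := ⟨E⟩) (Y := ⟨X⟩) H.deg_fst H.D_fst
  obtain ⟨w, hw⟩ := exists_of_closed (X := ⟨X⟩) (Y := ⟨Y⟩⟦(1 : ℤ)⟧) (x := k ≫ σ ⟨Y⟩)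
    (H.deg.comp (isDeg_σ _)) (by rw [D_comp, H.closed, D_σ, zero_comp, comp_zero, add_zero])
  have h := K0.of_distinguished (distinguished_of_exact ⟨_, _, _, hu, hv, hw, H'⟩)
  exact h.trans (add_comm _ _)

/-- The class of a twisted complex is the sum of the classes of its components. -/
theorem cl_eq_sum (X : Tw C) : cl X = ∑ i, cl (ofObj (X.obj.obj i)) := by
  classical
  induction hn : Fintype.card X.obj.ι generalizing X with
  | zero =>
    have : IsEmpty X.obj.ι := Fintype.card_eq_zero_iff.mp hn
    rw [Fintype.sum_empty]
    exact K0.of_isZero (isZero_of_isEmpty X)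
  | succ n ih =>
    obtain ⟨o, ho⟩ := X.oneSided
    have : Nonempty X.obj.ι := Fintype.card_pos_iff.mp (by omega)
    -- By one-sidedness no component of the twist ends in the least index `i₀`. The remaining
    -- components therefore form a twisted complex `Y`, and `X` is an extension of the component at
    -- `i₀` by `Y`.
    obtain ⟨i₀, hi₀⟩ := Finite.exists_min (id : X.obj.ι → X.obj.ι)
    let e₂ : {i // i ≠ i₀} → X.obj.ι := Subtype.val
    have h0 : ∀ i, X.f i i₀ = 0 := fun i => ho i i₀ (not_lt.mpr (hi₀ i))
    -- The Maurer–Cartan equation without its vanishing summand at `i₀`. For `i ≠ i₀` it is the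
    -- equation for `Y`; for `i = i₀` it says that the gluing morphism `k` is closed.
    have hmc (i j : X.obj.ι) : DGCategory.d (q := 2) rfl (X.f i j) +
        ∑ l : {l // l ≠ i₀}, DGCategory.comp (r := 2) rfl (X.f i l) (X.f l j) = 0 := by
      have h1 := congrFun (congrFun X.mc i) j
      rw [Add.add_apply, Add.d_apply, Add.comp_apply, Fintype.sum_eq_add_sum_subtype_ne _ i₀, h0,
        DGCategory.zero_comp, zero_add] at h1
      exact h1
    let Y : Tw C :=
      { obj := Add.pull X.obj e₂
        f := fun i j => X.f i j
        mc := by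
          funext i j
          exact hmc i j
        oneSided := ⟨LinearOrder.lift' e₂ Subtype.val_injective, fun i j hij => ho i j hij⟩ }
    let k : DGCategory.Hom (ofObj (X.obj.obj i₀)) Y 1 := fun _ j => X.f i₀ j
    have dk : DGCategory.d (q := 2) rfl k = 0 := by
      rw [d_eq]
      refine (congrArg (· + _) (Add.add_of_right (DGCategory.zero_comp (C := Add C) _ k)
        rfl)).trans ?_
      funext i j
      exact hmc i₀ j
    have hb : Function.Bijective (Sum.elim (fun _ : Unit => i₀) e₂) := by
      constructor
      · rintro (i | i) (j | j) h
        · rfl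
        · exact (j.2 h.symm).elim
        · exact (i.2 h).elim
        · exact congrArg Sum.inr (Subtype.ext h)
      · intro i
        by_cases h : i = i₀
        · exact ⟨.inl (), h.symm⟩
        · exact ⟨.inr ⟨i, h⟩, rfl⟩
    obtain ⟨inl, snd, H⟩ := isSplit_of_triangular X (ofObj (X.obj.obj i₀)) Y hb rfl rfl k dk
      (Add.inc X.obj e₂) (Add.pr X.obj _) HEq.rfl HEq.rfl
      (heq_of_eq (funext fun _ => funext fun _ => (h0 i₀).symm)) HEq.rfl HEq.rfl fun i _ => h0 i
    rw [cl_of_isSplit H, Fintype.sum_eq_add_sum_subtype_ne _ i₀]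
    refine congrArg (_ + ·) (ih Y ?_)
    have h2 : Fintype.card {i // i ≠ i₀} + 1 = Fintype.card X.obj.ι := by
      rw [Fintype.card_subtype_compl, Fintype.card_subtype_eq]
      omega
    have h3 : Fintype.card Y.obj.ι = Fintype.card {i // i ≠ i₀} := rfl
    omega

end Tw
end SqrtNegOne

namespace SqrtNegOne

open Tot

namespace Tw

variable {C : Type u} [DGCategory C]

/-! ### Direct sums as objects of the category of twisted complexes -/

/-- A morphism of objects as a morphism of twisted complexes. -/
def ofMap {X Y : C} {p : ℤ} (f : DGCategory.Hom X Y p) :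
    DGCategory.Hom (ofObj X) (ofObj Y) p := fun _ _ => f

theorem ofMap_comp {X Y Z : C} {p q r : ℤ} (h : p + q = r) (f : DGCategory.Hom X Y p)
    (g : DGCategory.Hom Y Z q) :
    ofMap (DGCategory.comp h f g) = DGCategory.comp h (ofMap f) (ofMap g) := by
  funext i j
  exact (Fintype.sum_unique fun _ : Unit => DGCategory.comp h f g).symm

theorem ofMap_one (X : C) : ofMap (DGCategory.one X) = DGCategory.one (ofObj X) := by
  funext i j
  exact (Add.δ_self (ofObj X).obj ()).symm

theorem d_ofMap {X Y : C} {p q : ℤ} (h : p + 1 = q) (f : DGCategory.Hom X Y p) :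
    DGCategory.d h (ofMap f) = ofMap (DGCategory.d h f) := by
  rw [d_eq]
  exact Add.add_of_right (DGCategory.comp_zero (C := Add C) _ _)
    (Add.add_of_right (DGCategory.zero_comp (C := Add C) _ _) rfl)

/-- Here the direct sum sits inside a single component of a twisted complex over `Add C`. It is
split with gluing morphism zero. -/
theorem isSplit_sum (a : Add C) {J₁ J₂ : Type} [Fintype J₁] [Fintype J₂] {e₁ : J₁ → a.ι}
    {e₂ : J₂ → a.ι} (he : Function.Bijective (Sum.elim e₁ e₂)) :
    IsSplit 1 0 (0 : Tot.of (ofObj (Add.pull a e₁)) ⟶ Tot.of (ofObj (Add.pull a e₂)))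
      (Tot.hom (ofMap (Add.inc a e₁))) (Tot.hom (ofMap (Add.inc a e₂)))
      (Tot.hom (ofMap (Add.pr a e₁))) (Tot.hom (ofMap (Add.pr a e₂))) := by
  have i₁ : Function.Injective e₁ := fun i j h => Sum.inl_injective (he.injective h)
  have i₂ : Function.Injective e₂ := fun i j h => Sum.inr_injective (he.injective h)
  have i₃ : ∀ i j, e₁ i ≠ e₂ j := fun i j h => Sum.inl_ne_inr (he.injective h)
  have z {X Y : Add C} {p : ℤ} : Tot.hom (ofMap (0 : DGCategory.Hom X Y p)) = 0 := hom_zero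
  have dz {X Y : Add C} {p q : ℤ} (h : p + 1 = q) (f : DGCategory.Hom X Y p)
      (hf : DGCategory.d h f = 0) : D (Tot.hom (ofMap f)) = 0 := by
    rw [← hom_d h, d_ofMap, hf, z]
  have hc {X Y Z : Add C} (f : DGCategory.Hom X Y 0) (g : DGCategory.Hom Y Z 0) :
      Tot.hom (ofMap f) ≫ Tot.hom (ofMap g) =
        Tot.hom (ofMap (DGCategory.comp (add_zero 0) f g)) := by
    rw [ofMap_comp, Tot.hom_comp]
  have h1 (X : Add C) : Tot.hom (ofMap (DGCategory.one X)) = 𝟙 _ := by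
    rw [ofMap_one, hom_one]
  refine ⟨rfl, isDeg_zero _ _ _, map_zero _, (isDeg_hom _).cast, isDeg_hom _, isDeg_hom _,
    isDeg_hom _, ?_, ?_, ?_, ?_, ?_, ?_, ?_, ?_, ?_⟩
  · rw [zero_comp, dz _ _ (Add.d_inc _ _ rfl)]
  · exact dz _ _ (Add.d_inc _ _ rfl)
  · exact dz _ _ (Add.d_pr _ _ rfl)
  · rw [comp_zero, dz _ _ (Add.d_pr _ _ rfl)]
  · rw [hc, Add.inc_comp_pr i₁, h1]
  · rw [hc, Add.inc_comp_pr i₂, h1]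
  · rw [hc, Add.inc_comp_pr_of_ne i₃, z]
  · rw [hc, Add.inc_comp_pr_of_ne fun i j => (i₃ j i).symm, z]
  · rw [hc, hc, ← hom_add, ← h1, ← Add.pr_comp_inc_add he, add_comm (DGCategory.comp _ _ _)]
    rfl

variable [HasDGShift C]

/-- This decomposes the inner layer of direct sums, as `cl_eq_sum` decomposes the outer one. There
is no twist, so the summands can be removed in any order. -/
theorem cl_ofObj_eq_sum (a : Add C) :
    cl (ofObj a) = ∑ i, cl (ofObj { ι := Unit, obj := fun _ => a.obj i }) := by
  classical
  induction hn : Fintype.card a.ι generalizing a with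
  | zero =>
    have : IsEmpty a.ι := Fintype.card_eq_zero_iff.mp hn
    rw [Fintype.sum_empty]
    refine K0.of_isZero ((IsZero.iff_id_eq_zero _).mpr (H0.cls_eq_zero ⟨0, ?_⟩))
    funext i j k
    exact this.elim k
  | succ n ih =>
    have : Nonempty a.ι := Fintype.card_pos_iff.mp (by omega)
    obtain ⟨i₀⟩ := this
    let e₂ : {i // i ≠ i₀} → a.ι := Subtype.val
    have hb : Function.Bijective (Sum.elim (fun _ : Unit => i₀) e₂) := by
      constructor
      · rintro (i | i) (j | j) h
        · rfl
        · exact (j.2 h.symm).elim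
        · exact (i.2 h).elim
        · exact congrArg Sum.inr (Subtype.ext h)
      · intro i
        by_cases h : i = i₀
        · exact ⟨.inl (), h.symm⟩
        · exact ⟨.inr ⟨i, h⟩, rfl⟩
    rw [cl_of_isSplit (isSplit_sum a hb), Fintype.sum_eq_add_sum_subtype_ne _ i₀]
    refine congrArg (_ + ·) (ih (Add.pull a e₂) ?_)
    have h2 : Fintype.card {i // i ≠ i₀} + 1 = Fintype.card a.ι := by
      rw [Fintype.card_subtype_compl, Fintype.card_subtype_eq]
      omega
    have h3 : Fintype.card (Add.pull a e₂).ι = Fintype.card {i // i ≠ i₀} := rfl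
    omega

end Tw

/-! ### Isomorphisms -/

/-- The inverse `g` is automatically closed: differentiating `f g = 1` gives `f (d g) = 0`, and
composing with `g` gives `d g = 0`. -/
theorem H0.nonempty_iso {C : Type u} [DGCategory C] {X Y : C} {f : DGCategory.Hom X Y 0}
    (h : DGCategory.IsDGIso f) : Nonempty ((⟨X⟩ : H0 C) ≅ ⟨Y⟩) := by
  obtain ⟨hf, g, h₁, h₂⟩ := h
  have hg : DGCategory.d (zero_add 1) g = 0 := by
    have h := DGCategory.d_comp (add_zero 0) (zero_add 1) (zero_add 1) (zero_add 1) (add_zero 1)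
      (zero_add 1) f g
    rw [h₁, DGCategory.d_id, hf, DGCategory.zero_comp, zero_add] at h
    have h' := DGCategory.assoc (add_zero 0) (zero_add 1) (zero_add 1) (zero_add 1) g f
      (DGCategory.d (zero_add 1) g)
    rw [h₂, DGCategory.id_comp, ← h, map_zero] at h'
    exact h'
  exact ⟨⟨H0.homMk f hf, H0.homMk g hg, H0.cls_eq h₁, H0.cls_eq h₂⟩⟩

/-- Twisted complexes with zero twists and matching isomorphic components. -/
theorem Tw.nonempty_iso_of_zero {C : Type u} [DGCategory C] {X Y : Tw C} (hX : X.f = 0)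
    (hY : Y.f = 0) {e : X.obj.ι → Y.obj.ι} (he : Function.Bijective e)
    (φ : ∀ i, DGCategory.Hom (X.obj.obj i) (Y.obj.obj (e i)) 0)
    (H : ∀ i, DGCategory.IsDGIso (φ i)) : Nonempty ((⟨X⟩ : H0 (Tw C)) ≅ ⟨Y⟩) := by
  refine H0.nonempty_iso (Tw.isDGIso_of _ (Add.isDGIso_diag he φ H) ?_)
  rw [hX, hY, DGCategory.zero_comp, DGCategory.comp_zero]

open MonoidalDGCategory in
theorem Tw.tensorObj_f_eq_zero {C : Type u} [DGCategory C] [MonoidalDGCategory C] {X Y : Tw C}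
    (hX : X.f = 0) (hY : Y.f = 0) : (Tw.tensorObj X Y).f = 0 := by
  change tensorHom (add_zero 1) X.f (DGCategory.one Y.obj) +
    tensorHom (zero_add 1) (DGCategory.one X.obj) Y.f = 0
  rw [hX, hY, map_zero, map_zero, LinearMap.zero_apply, add_zero]

/-- The isomorphism given by a cap, with a cup as its inverse. -/
theorem Elem.exists_cap {X Y : Elem} (h : X.pow = Y.pow + 2) (h' : Y.shift = X.shift + 1) :
    ∃ f : DGCategory.Hom X Y 0, DGCategory.IsDGIso f := by
  let c : Cls X.pow Y.pow (0 + Y.shift - X.shift) :=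
    Quot.mk _ ⟨[⟨Y.pow, .cap, 0⟩], ⟨h, rfl⟩, by simp [gr, Elt.gr, h']⟩
  let c' : Cls Y.pow X.pow (0 + X.shift - Y.shift) :=
    Quot.mk _ ⟨[⟨Y.pow, .cup, 0⟩], ⟨rfl, h.symm⟩, by simp [gr, Elt.gr, h']⟩
  refine ⟨Finsupp.single c 1, rfl, Finsupp.single c' 1, ?_, ?_⟩
  -- Cap followed by cup is the handle slide, cup followed by cap is the loop. The shifts differ by
  -- one, so that cap and cup, of degrees `1` and `-1`, have degree zero here.
  · refine (bilin_single _ c c').trans (congrArg (Finsupp.single · 1) ?_)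
    exact Quot.sound ⟨[], [], _, _, .handle Y.pow 0, rfl, rfl⟩
  · refine (bilin_single _ c' c).trans (congrArg (Finsupp.single · 1) ?_)
    exact Quot.sound ⟨[], [], _, _, .loop Y.pow 0, rfl, rfl⟩

/-! ### The relation `Q ⊗ Q ≅ 1[1]` and the classes of the objects `Q^k[m]`. -/

namespace I

/-- Both sides have a single summand, `Q^2[0]` and `Q^0[1]`, and no twist, so the cap gives the
isomorphism; what is left is bookkeeping between `Unit × Unit` and `Unit` in both layers of indices.
-/
theorem Q_tensor_Q : Nonempty ((MonoidalDGCategory.tensorObj I.Q I.Q).toH0 ≅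
    (MonoidalDGCategory.unit : I).toH0⟦(1 : ℤ)⟧) := by
  obtain ⟨f, hf⟩ := Elem.exists_cap (X := ⟨2, 0⟩) (Y := ⟨0, 1⟩) rfl rfl
  refine Tw.nonempty_iso_of_zero (X := MonoidalDGCategory.tensorObj I.Q I.Q)
    (Y := HasDGShift.sh 1 (MonoidalDGCategory.unit : I)) ?_ ?_ (e := fun _ => ())
    ⟨fun _ _ _ => Subsingleton.elim (α := Unit × Unit) _ _, fun _ => ⟨((), ()), rfl⟩⟩ (fun _ => ?_) fun _ => ?_
  · exact Tw.tensorObj_f_eq_zero rfl rfl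
  · exact HasDGShift.shHom_zero (C := Add I') _ _ _ _
  · exact Add.diag (fun _ => ()) fun _ => f
  · exact Add.isDGIso_diag ⟨fun _ _ _ => Subsingleton.elim (α := Unit × Unit) _ _, fun _ => ⟨((), ()), rfl⟩⟩ _ fun _ => hf

theorem bijective_unit : Function.Bijective fun _ : Unit => () := Function.bijective_id

/-- The object `Q^k[m]`. -/
noncomputable abbrev pow (k : ℕ) (m : ℤ) : I := Tw.ofObj (I'.Q k m)

theorem cl_pow_add_two (k : ℕ) (m : ℤ) : Tw.cl (pow (k + 2) m) = Tw.cl (pow k (m + 1)) := by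
  obtain ⟨f, hf⟩ := Elem.exists_cap (X := ⟨k + 2, m⟩) (Y := ⟨k, m + 1⟩) rfl rfl
  obtain ⟨e⟩ := Tw.nonempty_iso_of_zero (X := pow (k + 2) m) (Y := pow k (m + 1)) rfl rfl
    (e := fun _ => ()) bijective_unit (fun _ => Add.diag (X := I'.Q (k + 2) m)
      (Y := I'.Q k (m + 1)) (fun _ => ()) fun _ => f)
    fun _ => Add.isDGIso_diag bijective_unit _ fun _ => hf
  exact K0.of_iso e

theorem cl_pow_add_one (k : ℕ) (m : ℤ) : Tw.cl (pow k (m + 1)) = -Tw.cl (pow k m) := by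
  obtain ⟨e⟩ := Tw.nonempty_iso_of_zero (X := pow k (m + 1)) (Y := HasDGShift.sh 1 (pow k m)) rfl
    (HasDGShift.shHom_zero (C := Add I') _ _ _ _)
    (e := fun _ => ()) bijective_unit
    (fun _ => DGCategory.one (I'.Q k (m + 1)))
    fun _ => ⟨DGCategory.d_id _ _, DGCategory.one _, DGCategory.id_comp _, DGCategory.id_comp _⟩
  exact (K0.of_iso e).trans (K0.of_shift (⟨pow k m⟩ : H0 I))

/-- The homomorphism with `1 ↦ [1]` and `i ↦ [Q]`. -/
noncomputable def ψ : GaussianInt →+ K0 (H0 I) where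
  toFun z := z.re • Tw.cl (pow 0 0) + z.im • Tw.cl (pow 1 0)
  map_zero' := by simp
  map_add' z w := by
    simp only [Zsqrtd.re_add, Zsqrtd.im_add, add_smul]
    abel

/-- Caps lower `k` by two without changing the weight, and shifts give signs, in accordance with `i²
= -1`. This reduces to `1` and `Q`, where `ψ` has its defining values. -/
theorem cl_pow (k : ℕ) (m : ℤ) : Tw.cl (pow k m) = ψ (ipow (k + 2 * m)) := by
  induction k using Nat.strong_induction_on generalizing m with
  | _ k ih =>
  -- Passes from the shift zero to all shifts, in both directions.
  have base (h : Tw.cl (pow k 0) = ψ (ipow k)) : Tw.cl (pow k m) = ψ (ipow (k + 2 * m)) := by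
    induction m using Int.induction_on with
    | zero => simpa using h
    | succ n hn =>
      rw [cl_pow_add_one, hn, ← map_neg, ← ipow_add_two]
      ring_nf
    | pred n hn =>
      have h1 := cl_pow_add_one k (-n - 1)
      rw [sub_add_cancel, hn] at h1
      rw [← neg_eq_iff_eq_neg.mpr h1, ← map_neg, ← ipow_sub_two]
      ring_nf
  match k with
  | 0 =>
    refine base ?_
    simp [ψ, ipow]
  | 1 =>
    refine base ?_
    simp [ψ, ipow_one]
  | k + 2 =>
    rw [cl_pow_add_two, ih k (by omega)]
    congr 2
    push_cast
    ring

/-- Both layers of direct sums are split off; this makes `ψ` surjective. -/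
theorem cl_eq (X : I) : Tw.cl X = ψ (χ X) := by
  rw [Tw.cl_eq_sum, χ, Fintype.sum_sigma, map_sum]
  refine Finset.sum_congr rfl fun i _ => ?_
  rw [Tw.cl_ofObj_eq_sum, map_sum]
  exact Finset.sum_congr rfl fun j _ => cl_pow _ _

end I

end SqrtNegOne

/-! ### The Grothendieck group as the ring of Gaussian integers. -/

namespace SqrtNegOne

namespace I

/-- The cone of a representative of an isomorphism is a zero object in cohomology, that is,
contractible, so its Euler characteristic `χ Y - χ X` vanishes. -/
theorem χ_eq_of_iso {X Y : H0 I} (e : X ≅ Y) : χ X.as = χ Y.as := by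
  obtain ⟨f, hf, h⟩ := H0.homMk_surjective e.hom
  have h0 : IsZero (⟨Tw.cone f hf⟩ : H0 I) := by
    refine (Triangle.isZero₃_iff_isIso₁ (Tw.coneTriangle f hf)
      (Tw.distinguished_of_exact (Tw.exact_cone f hf))).mpr ?_
    exact (congrArg IsIso h).mpr inferInstance
  obtain ⟨η, hη⟩ := (Submodule.Quotient.mk_eq_zero _).mp
    (h0.eq_of_src (𝟙 (⟨Tw.cone f hf⟩ : H0 I)) 0)
  have h1 := χ_cone f hf
  rw [χ_eq_zero_of_contractible _ η hη] at h1
  exact (sub_eq_zero.mp h1.symm).symm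

theorem χ_distinguished (t : Triangle (H0 I)) (ht : t ∈ distTriang (H0 I)) :
    χ t.obj₂.as = χ t.obj₁.as + χ t.obj₃.as := by
  obtain ⟨X, Y, h, hh, ⟨e⟩⟩ := ht
  have h₁ : χ t.obj₁.as = χ X := χ_eq_of_iso (Triangle.π₁.mapIso e)
  have h₂ : χ t.obj₂.as = χ Y := χ_eq_of_iso (Triangle.π₂.mapIso e)
  have h₃ : χ t.obj₃.as = χ (Tw.cone h hh) := χ_eq_of_iso (Triangle.π₃.mapIso e)
  rw [h₁, h₂, h₃, χ_cone, add_sub_cancel]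

/-- The Grothendieck group is the group of Gaussian integers. -/
noncomputable def φ : K0 (H0 I) ≃+ GaussianInt :=
  AddMonoidHom.toAddEquiv (K0.lift (fun X => χ X.as) χ_distinguished) ψ
    (K0.hom_ext fun X => by
      rw [AddMonoidHom.comp_apply, K0.lift_of, AddMonoidHom.id_apply]
      exact (cl_eq X.as).symm)
    -- The other composite is determined by `χ 1 = 1` and `χ Q = i`.
    (AddMonoidHom.ext fun z => by
      have h (k : ℕ) : K0.lift (fun X : H0 I => χ X.as) χ_distinguished (Tw.cl (pow k 0)) =
          ipow (k + 2 * 0) := (K0.lift_of _ _ _).trans (χ_ofObj_Q k 0)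
      rw [AddMonoidHom.comp_apply, AddMonoidHom.id_apply]
      refine (map_add _ _ _).trans ?_
      rw [map_zsmul, map_zsmul, h, h]
      ext <;> simp [ipow, imag])

theorem φ_of (X : I) : φ (K0.of X.toH0) = χ X := 
  K0.lift_of (fun X : H0 I => χ X.as) χ_distinguished X.toH0

/-- The multiplication of the Grothendieck group. -/
noncomputable def mul : K0 (H0 I) →+ K0 (H0 I) →+ K0 (H0 I) :=
  ((AddMonoidHom.mul.compr₂ φ.symm.toAddMonoidHom).compl₂ φ.toAddMonoidHom).comp φ.toAddMonoidHom

theorem φ_mul (a b : K0 (H0 I)) : φ (mul a b) = φ a * φ b := φ.apply_symm_apply _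

/-- The multiplication is transported along `φ`, so it is biadditive from the start; that it is
induced by the tensor product is exactly the multiplicativity of `χ`. -/
theorem mul_of (X Y : I) : mul (K0.of X.toH0) (K0.of Y.toH0) =
    K0.of (MonoidalDGCategory.tensorObj X Y).toH0 := by
  refine φ.injective ?_
  rw [φ_mul, φ_of, φ_of, φ_of, χ_tensor]

end I

end SqrtNegOne

open SqrtNegOne in
theorem theorem1 :
    ∃ T : Pretriangulated (H0 I),
      T.distinguishedTriangles = Tw.exactTriangles I' ∧
      IsTriangulated (H0 I) ∧
      Nonempty ((MonoidalDGCategory.tensorObj I.Q I.Q).toH0 ≅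
        (MonoidalDGCategory.unit : I).toH0⟦(1 : ℤ)⟧) ∧
      ∃ mul : K0 (H0 I) →+ K0 (H0 I) →+ K0 (H0 I),
        (∀ X Y : I, mul (K0.of X.toH0) (K0.of Y.toH0) =
          K0.of (MonoidalDGCategory.tensorObj X Y).toH0) ∧
        ∃ φ : K0 (H0 I) ≃+ GaussianInt,
          (∀ a b : K0 (H0 I), φ (mul a b) = φ a * φ b) ∧
          φ (K0.of (MonoidalDGCategory.unit : I).toH0) = 1 ∧
          φ (K0.of I.Q.toH0) = ⟨0, 1⟩ :=
  ⟨inferInstance, rfl, inferInstance, I.Q_tensor_Q, I.mul, I.mul_of, I.φ, I.φ_mul,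
    -- The unit object is definitionally `Q^0[0]`, so both values are powers `i^k`, with `k = 0` and
    -- `k = 1`.
    (I.φ_of _).trans (I.χ_ofObj_Q 0 0), (I.φ_of _).trans (I.χ_ofObj_Q 1 0)⟩
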